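/- Let $(M^n,g_M)$ be a complete, connected, smooth $n$-dimensional Riemannian manifold without boundary, let $f\colon M\to\mathbb R$ be smooth, let $0<m<\infty$ be real, and let $$\mathrm{Ric}_f^m=\mathrm{Ric}+\mathrm{Hess}\,f-\tfrac1m\,df\otimes df$$ be the $m$-Bakry–Emery Ricci tensor of the weighted manifold $(M^n,g_M,e^{-f}d\mathrm{vol})$. For each pair of distinct points $p,q\in M$ let $\gamma_{p,q}\colon[0,\mathrm{dist}(p,q)]\to M$ be a minimizing geodesic from $p$ to $q$ parametrized by arc length. Suppose that there are constants $c>0$ and $G\ge 0$ such that for each pair of distinct points $p,q\in M$ there is a function $g\in C^1(M)$ with $\sup_M|g|\le G$ and $$\mathrm{Ric}_f^m(\dot\gamma_{p,q},\dot\gamma_{p,q})\big|_{\gamma_{p,q}(t)}\ \ge\ (m+n-1)\Big[c^2+\frac{d}{dt}\big(g\circ\gamma_{p,q}\big)(t)\Big]\qquad\text{for all } t\in[0,\mathrm{dist}(p,q)].$$ Then $M$ is compact and $$\mathrm{diam}(M)\le\frac1c\left[\frac{2G}{c}+\sqrt{\frac{4G^2}{c^2}+\pi^2}\right].$$ -/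

import Mathlib

open Set Manifold Bundle
open scoped ContDiff

noncomputable section

namespace WeightedManifold

-- `ℝⁿ` is a manifold over itself through the identity chart.
attribute [local instance 5000] chartedSpaceSelf

/-- The partial derivative `∂ᵢ F` at `y` of a function `F` on `ℝⁿ`. -/
def partialDeriv {n : ℕ} (i : Fin n) (F : EuclideanSpace ℝ (Fin n) → ℝ)
    (y : EuclideanSpace ℝ (Fin n)) : ℝ :=
  fderiv ℝ F y (EuclideanSpace.single i 1)

section Curvature

variable {n : ℕ} {M : Type*} [TopologicalSpace M] [ChartedSpace (EuclideanSpace ℝ (Fin n)) M]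
  [RiemannianBundle (fun x : M ↦ TangentSpace (𝓡 n) x)]

/-- The Gram matrix `g_{ij}(y) = ⟨∂ᵢ, ∂ⱼ⟩` of the Riemannian metric in the preferred chart
`φ` at `x₀`, as a function of the coordinates `y ∈ φ.target`; here `∂ᵢ = d(φ⁻¹)_y eᵢ`. -/
def metricCoeff (x₀ : M) (y : EuclideanSpace ℝ (Fin n)) : Matrix (Fin n) (Fin n) ℝ :=
  Matrix.of fun i j ↦
    inner ℝ
      (mfderiv (𝓡 n) (𝓡 n) (extChartAt (𝓡 n) x₀).symm y (EuclideanSpace.single i (1 : ℝ)))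
      (mfderiv (𝓡 n) (𝓡 n) (extChartAt (𝓡 n) x₀).symm y (EuclideanSpace.single j (1 : ℝ)))

/-- The Christoffel symbols `Γᵏᵢⱼ` of the Levi-Civita connection in the preferred chart at `x₀`:
`Γᵏᵢⱼ = ½ ∑ₗ gᵏˡ (∂ᵢ gⱼₗ + ∂ⱼ gᵢₗ - ∂ₗ gᵢⱼ)`. -/
def christoffel (x₀ : M) (k i j : Fin n) (y : EuclideanSpace ℝ (Fin n)) : ℝ :=
  (1 / 2 : ℝ) * ∑ l, (metricCoeff x₀ y)⁻¹ k l *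
    (partialDeriv i (fun z ↦ metricCoeff x₀ z j l) y
      + partialDeriv j (fun z ↦ metricCoeff x₀ z i l) y
      - partialDeriv l (fun z ↦ metricCoeff x₀ z i j) y)

/-- The components of the Ricci tensor in the preferred chart at `x₀`:
`Rᵢⱼ = ∑ₖ (∂ₖ Γᵏᵢⱼ - ∂ⱼ Γᵏᵢₖ) + ∑ₖₗ (Γᵏₖₗ Γˡᵢⱼ - Γᵏⱼₗ Γˡᵢₖ)`
(so that round spheres have positive Ricci curvature). -/
def ricciCoeff (x₀ : M) (i j : Fin n) (y : EuclideanSpace ℝ (Fin n)) : ℝ :=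
  (∑ k, (partialDeriv k (christoffel x₀ k i j) y - partialDeriv j (christoffel x₀ k i k) y))
    + ∑ k, ∑ l, (christoffel x₀ k k l y * christoffel x₀ l i j y
        - christoffel x₀ k j l y * christoffel x₀ l i k y)

/-- The components of the Riemannian Hessian of `f` in the preferred chart at `x₀`:
`∂ᵢ∂ⱼ f - ∑ₖ Γᵏᵢⱼ ∂ₖ f`. -/
def hessianCoeff (f : M → ℝ) (x₀ : M) (i j : Fin n) (y : EuclideanSpace ℝ (Fin n)) : ℝ :=
  partialDeriv i (partialDeriv j (f ∘ (extChartAt (𝓡 n) x₀).symm)) y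
    - ∑ k, christoffel x₀ k i j y * partialDeriv k (f ∘ (extChartAt (𝓡 n) x₀).symm) y

/-- The components of a tangent vector at `x` in the preferred chart at `x`. -/
def tangentCoord (x : M) (v : TangentSpace (𝓡 n) x) : EuclideanSpace ℝ (Fin n) :=
  mfderiv (𝓡 n) (𝓡 n) (extChartAt (𝓡 n) x) x v

/-- The differential `df(v)` at `x`. -/
def differential (f : M → ℝ) (x : M) (v : TangentSpace (𝓡 n) x) : ℝ :=
  mfderiv (𝓡 n) 𝓘(ℝ, ℝ) f x v

/-- The Ricci tensor `Ric(v, w)` at `x`. -/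
def ricci (x : M) (v w : TangentSpace (𝓡 n) x) : ℝ :=
  ∑ i, ∑ j, ricciCoeff x i j (extChartAt (𝓡 n) x x) * tangentCoord x v i * tangentCoord x w j

/-- The Hessian `Hess f (v, w)` at `x` with respect to the Riemannian metric. -/
def hessian (f : M → ℝ) (x : M) (v w : TangentSpace (𝓡 n) x) : ℝ :=
  ∑ i, ∑ j, hessianCoeff f x i j (extChartAt (𝓡 n) x x) * tangentCoord x v i * tangentCoord x w j

/-- The `m`-Bakry-Emery Ricci tensor `Ric + Hess f - (1/m) df ⊗ df` at `x`, for finite `m`. -/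
def bakryEmeryRicci (m : ℝ) (f : M → ℝ) (x : M) (v w : TangentSpace (𝓡 n) x) : ℝ :=
  ricci x v w + hessian f x v w
    - (1 / m) * (differential f x v * differential f x w)

end Curvature

/-- The velocity at time `t` of a curve defined on `[0, L]` (one-sided at the endpoints). -/
def velocity (n : ℕ) {M : Type*} [TopologicalSpace M] [ChartedSpace (EuclideanSpace ℝ (Fin n)) M]
    (L : ℝ) (γ : ℝ → M) (t : ℝ) : TangentSpace (𝓡 n) (γ t) :=
  mfderivWithin 𝓘(ℝ, ℝ) (𝓡 n) γ (Icc 0 L) t (1 : ℝ)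

/-- `γ`, restricted to `[0, L]`, is a geodesic parametrized by arc length: it is smooth, has unit
speed, and at each time `t` satisfies the geodesic equation `γ̈ᵏ + ∑ᵢⱼ Γᵏᵢⱼ(γ) γ̇ⁱ γ̇ʲ = 0`
in the preferred chart at `γ t`. -/
structure IsUnitSpeedGeodesic (n : ℕ) {M : Type*} [TopologicalSpace M]
    [ChartedSpace (EuclideanSpace ℝ (Fin n)) M]
    [RiemannianBundle (fun x : M ↦ TangentSpace (𝓡 n) x)] (L : ℝ) (γ : ℝ → M) : Prop where
  smooth : ContMDiffOn 𝓘(ℝ, ℝ) (𝓡 n) ∞ γ (Icc 0 L)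
  unit_speed : ∀ t ∈ Icc 0 L, ‖velocity n L γ t‖ = 1
  geodesic_eq : ∀ t ∈ Icc 0 L, ∀ k : Fin n,
    iteratedDerivWithin 2 (fun s ↦ extChartAt (𝓡 n) (γ t) (γ s) k) (Icc 0 L) t
      + ∑ i, ∑ j, christoffel (γ t) k i j (extChartAt (𝓡 n) (γ t) (γ t))
          * derivWithin (fun s ↦ extChartAt (𝓡 n) (γ t) (γ s) i) (Icc 0 L) t
          * derivWithin (fun s ↦ extChartAt (𝓡 n) (γ t) (γ s) j) (Icc 0 L) t = 0

/-- `γ` is a minimizing geodesic from `p` to `q` parametrized by arc length. Since it has unit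
speed and is defined on `[0, dist p q]`, its length is the distance from `p` to `q`. -/
structure IsMinimizingGeodesic (n : ℕ) {M : Type*} [MetricSpace M]
    [ChartedSpace (EuclideanSpace ℝ (Fin n)) M]
    [RiemannianBundle (fun x : M ↦ TangentSpace (𝓡 n) x)] (p q : M) (γ : ℝ → M) : Prop where
  isGeodesic : IsUnitSpeedGeodesic n (dist p q) γ
  source : γ 0 = p
  target : γ (dist p q) = q

end WeightedManifold

end

/-! Let γ be a minimizing geodesic on `[A, B]` and let φ vanish at both ends. The second variations
in the directions φ eᵢ, for a parallel orthonormal frame eᵢ normal to γ, add up to ∫ (n-1)φ'² - φ²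
Ric(γ', γ') ≥ 0. Write u = (f ∘ γ)' and w = g ∘ γ; since γ is a geodesic, Hess f(γ', γ') = u', so
the hypothesis says Ric ≥ (m+n-1)(c² + w') - u' + u²/m. Insert this, integrate by parts, and absorb
u by -2φφ'u - φ²u²/m ≤ mφ'². Every remaining term carries the factor m+n-1, which leaves ∫ φ'² -
c²φ² + 2φφ'w ≥ 0. For φ a half period of the sine, ∫ |φφ'| = 1 and |w| ≤ G give c²l² - 4Gl - π² ≤ 0
with l = B - A (`sq_mul_sub_le_of_index`); the diameter bound is the larger root of this quadratic
(`le_of_sq_mul_sub_le`).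

The index inequality (`le_of_second_variation`) is obtained from distances, with no global variation
of γ. In a chart, push the point γ(t) along the parabola with initial velocity φ eᵢ and zero
covariant acceleration, and record a bound ℓ + k s²/2 + o(s²) for its distance from γ(A)
(`SecondOrderBound`). The triangle inequality and the length of a short strip in one chart show that
k grows by at most the integral of the index form (`SecondOrderBound.step`). Bounds pass from chart
to chart because the transformation law of the Christoffel symbols makes the two parabolas agree up
to o(s²) (`SecondOrderBound.transition`). Summing over a frame turns curvature into Ricci
(`NormalBound.exists_step`), and a supremum argument carries the bound from A to B
(`propagate_of_local_rate`). At B the field vanishes, the parabola is constant, and minimality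
forces every k ≥ 0.

Compactness follows from the Hopf–Rinow argument: closed balls are compact, and by the distance
bound M is one of them. -/

section

set_option maxSynthPendingDepth 3

/-! ### Levi-Civita connections on open sets of a vector space -/

section LocalGeometry

open Filter Topology

variable {E : Type*} [NormedAddCommGroup E] [NormedSpace ℝ E]

/-- `g` is a smooth Riemannian metric on the open set `U` of a vector space, and `Γ` is the bilinear
form of the Christoffel symbols of its Levi-Civita connection. -/
structure IsLeviCivita (U : Set E) (g : E → E →L[ℝ] E →L[ℝ] ℝ)
    (Γ : E → E →L[ℝ] E →L[ℝ] E) : Prop where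
  isOpen : IsOpen U
  contDiffOn_metric : ContDiffOn ℝ ∞ g U
  contDiffOn_gamma : ContDiffOn ℝ ∞ Γ U
  metric_symm : ∀ x ∈ U, ∀ u v, g x u v = g x v u
  metric_pos : ∀ x ∈ U, ∀ u, u ≠ 0 → 0 < g x u u
  gamma_symm : ∀ x ∈ U, ∀ u v, Γ x u v = Γ x v u
  compat : ∀ x ∈ U, ∀ u v w,
    fderiv ℝ g x u v w = g x (Γ x u v) w + g x v (Γ x u w)

/-- The Riemann curvature `R(u, v) w` of the connection with Christoffel form `Γ`. -/
noncomputable def curvature (Γ : E → E →L[ℝ] E →L[ℝ] E) (x u v w : E) : E :=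
  fderiv ℝ Γ x u v w - fderiv ℝ Γ x v u w + Γ x u (Γ x v w) - Γ x v (Γ x u w)

theorem hasDerivAt_quadratic (x v z : E) (s : ℝ) :
    HasDerivAt (fun r : ℝ ↦ x + r • v + (r ^ 2 / 2) • z) (v + s • z) s := by
  have h1 : HasDerivAt (fun r : ℝ ↦ r ^ 2 / 2) s s := by
    simpa using (hasDerivAt_pow 2 s).div_const 2
  exact ((((hasDerivAt_id s).smul_const v).const_add x).fun_add (h1.smul_const z)).congr_deriv
    (by simp)

/-- Half the second derivative in `s` of the squared speed `g(X_t, X_t)` of a variation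
`X = x + s v + s² z / 2`, where `x'`, `v'`, `z'` are the derivatives of `x`, `v`, `z`. -/
noncomputable def sqSpeedSecondDeriv (g : E → E →L[ℝ] E →L[ℝ] ℝ) (Γ : E → E →L[ℝ] E →L[ℝ] E)
    (x v z x' v' z' : E) (s : ℝ) : ℝ :=
  -- Here `P` and `Q` are the `s`-derivatives of `X` and `T`, and `W` is the covariant derivative of
  -- `T` in `s`; the value is g(D_s W, T) + g(W, W).
  let X := x + s • v + (s ^ 2 / 2) • z
  let T := x' + s • v' + (s ^ 2 / 2) • z'
  let P := v + s • z
  let Q := v' + s • z'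
  let W := Q + Γ X P T
  g X (z' + (fderiv ℝ Γ X P P T + Γ X z T + Γ X P Q) + Γ X P W) T + g X W (Q + Γ X P T)

namespace IsLeviCivita

variable {U : Set E} {g : E → E →L[ℝ] E →L[ℝ] ℝ} {Γ : E → E →L[ℝ] E →L[ℝ] E}

theorem contDiffAt_metric (h : IsLeviCivita U g Γ) {x : E} (hx : x ∈ U) : ContDiffAt ℝ ∞ g x :=
  h.contDiffOn_metric.contDiffAt (h.isOpen.mem_nhds hx)

theorem contDiffAt_gamma (h : IsLeviCivita U g Γ) {x : E} (hx : x ∈ U) : ContDiffAt ℝ ∞ Γ x :=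
  h.contDiffOn_gamma.contDiffAt (h.isOpen.mem_nhds hx)

theorem hasFDerivAt_metric (h : IsLeviCivita U g Γ) {x : E} (hx : x ∈ U) :
    HasFDerivAt g (fderiv ℝ g x) x :=
  ((h.contDiffAt_metric hx).differentiableAt (by simp)).hasFDerivAt

theorem hasFDerivAt_gamma (h : IsLeviCivita U g Γ) {x : E} (hx : x ∈ U) :
    HasFDerivAt Γ (fderiv ℝ Γ x) x :=
  ((h.contDiffAt_gamma hx).differentiableAt (by simp)).hasFDerivAt

theorem fderiv_gamma_symm (h : IsLeviCivita U g Γ) {x : E} (hx : x ∈ U) (z u v : E) :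
    fderiv ℝ Γ x z u v = fderiv ℝ Γ x z v u := by
  have h1 : HasFDerivAt (fun y ↦ Γ y u v) (((fderiv ℝ Γ x).flip u).flip v) x := by
    have := ((h.hasFDerivAt_gamma hx).clm_apply (hasFDerivAt_const u x)).clm_apply
      (hasFDerivAt_const v x)
    convert this using 1
    ext; simp
  have h2 : HasFDerivAt (fun y ↦ Γ y v u) (((fderiv ℝ Γ x).flip v).flip u) x := by
    have := ((h.hasFDerivAt_gamma hx).clm_apply (hasFDerivAt_const v x)).clm_apply
      (hasFDerivAt_const u x)
    convert this using 1
    ext; simp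
  have h3 : (fun y ↦ Γ y u v) =ᶠ[𝓝 x] fun y ↦ Γ y v u := by
    filter_upwards [h.isOpen.mem_nhds hx] with y hy using h.gamma_symm y hy u v
  have := h1.unique (h2.congr_of_eventuallyEq h3)
  simpa using DFunLike.congr_fun this z

/-- Derivative of the metric along curves, in terms of covariant derivatives. -/
theorem hasDerivAt_metric (h : IsLeviCivita U g Γ) {x u v : ℝ → E} {x' u' v' : E} {t : ℝ}
    (hx : x t ∈ U) (hx' : HasDerivAt x x' t) (hu : HasDerivAt u u' t) (hv : HasDerivAt v v' t) :
    HasDerivAt (fun s ↦ g (x s) (u s) (v s))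
      (g (x t) (u' + Γ (x t) x' (u t)) (v t) + g (x t) (u t) (v' + Γ (x t) x' (v t))) t := by
  have h1 := (((h.hasFDerivAt_metric hx).comp_hasDerivAt t hx').clm_apply hu).clm_apply hv
  refine h1.congr_deriv ?_
  simp [h.compat _ hx]
  ring

theorem hasDerivAt_gamma (h : IsLeviCivita U g Γ) {x u v : ℝ → E} {x' u' v' : E} {t : ℝ}
    (hx : x t ∈ U) (hx' : HasDerivAt x x' t) (hu : HasDerivAt u u' t) (hv : HasDerivAt v v' t) :
    HasDerivAt (fun s ↦ Γ (x s) (u s) (v s))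
      (fderiv ℝ Γ (x t) x' (u t) (v t) + Γ (x t) u' (v t) + Γ (x t) (u t) v') t := by
  have h1 := (((h.hasFDerivAt_gamma hx).comp_hasDerivAt t hx').clm_apply hu).clm_apply hv
  simpa using h1

/-- The second derivative of the metric in terms of the Christoffel form. -/
theorem fderiv_fderiv_metric (h : IsLeviCivita U g Γ) {x : E} (hx : x ∈ U) (u v w z : E) :
    fderiv ℝ (fderiv ℝ g) x u v w z =
      g x (fderiv ℝ Γ x u v w + Γ x u (Γ x v w)) z + g x (Γ x v w) (Γ x u z)
        + g x (Γ x u w) (Γ x v z) + g x w (fderiv ℝ Γ x u v z + Γ x u (Γ x v z)) := by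
  have hg2 : HasFDerivAt (fderiv ℝ g) (fderiv ℝ (fderiv ℝ g) x) x :=
    (((h.contDiffAt_metric hx).fderiv_right (m := 1) (by norm_cast)).differentiableAt
      (by simp)).hasFDerivAt
  let c : ℝ → E := fun s ↦ x + s • u
  have hc : HasDerivAt c u 0 := by
    simpa [c] using ((hasDerivAt_id (0 : ℝ)).smul_const u).const_add x
  have hc0 : c 0 = x := by simp [c]
  have h1 : HasDerivAt (fun s ↦ fderiv ℝ g (c s) v w z) (fderiv ℝ (fderiv ℝ g) x u v w z) 0 := by
    rw [← hc0] at hg2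
    have := (((hg2.comp_hasDerivAt 0 hc).clm_apply (hasDerivAt_const 0 v)).clm_apply
      (hasDerivAt_const 0 w)).clm_apply (hasDerivAt_const 0 z)
    simpa [hc0] using this
  have hcU : c 0 ∈ U := by rwa [hc0]
  have hG : ∀ y : E, HasDerivAt (fun s ↦ Γ (c s) v y) (fderiv ℝ Γ x u v y) 0 := fun y ↦ by
    simpa [hc0] using h.hasDerivAt_gamma hcU hc (hasDerivAt_const 0 v) (hasDerivAt_const 0 y)
  have h2 := (h.hasDerivAt_metric hcU hc (hG w) (hasDerivAt_const 0 z)).add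
    (h.hasDerivAt_metric hcU hc (hasDerivAt_const 0 w) (hG z))
  have h3 : (fun s ↦ fderiv ℝ g (c s) v w z) =ᶠ[𝓝 0]
      ((fun s ↦ g (c s) (Γ (c s) v w) z) + fun s ↦ g (c s) w (Γ (c s) v z)) := by
    filter_upwards [hc.continuousAt.preimage_mem_nhds (h.isOpen.mem_nhds hcU)] with s hs
    exact h.compat _ hs v w z
  have := h1.unique (h2.congr_of_eventuallyEq h3)
  rw [this]
  simp [hc0]
  ring

/-- The curvature endomorphism is skew-adjoint. -/
theorem metric_curvature_skew (h : IsLeviCivita U g Γ) {x : E} (hx : x ∈ U) (u v w z : E) :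
    g x (curvature Γ x u v w) z = - g x w (curvature Γ x u v z) := by
  have hs : fderiv ℝ (fderiv ℝ g) x u v = fderiv ℝ (fderiv ℝ g) x v u :=
    ((h.contDiffAt_metric hx).isSymmSndFDerivAt (by simp; norm_cast)) u v
  have h1 := h.fderiv_fderiv_metric hx u v w z
  have h2 := h.fderiv_fderiv_metric hx v u w z
  -- The second derivatives agree by Schwarz and the products of two `Γ` terms cancel, so only the
  -- two curvature terms survive.
  rw [hs, h2] at h1
  simp only [curvature, map_add, map_sub, add_apply,
    sub_apply] at h1 ⊢
  linarith

/-- First derivative of the squared speed of the variation `x + s v + s² z / 2`, where `x'`, `v'`,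
`z'` are the derivatives of `x`, `v`, `z` along the curve. -/
theorem hasDerivAt_sq_speed (h : IsLeviCivita U g Γ) {x v z x' v' z' : E} {s : ℝ}
    (hx : x + s • v + (s ^ 2 / 2) • z ∈ U) :
    HasDerivAt (fun r : ℝ ↦ g (x + r • v + (r ^ 2 / 2) • z)
        (x' + r • v' + (r ^ 2 / 2) • z') (x' + r • v' + (r ^ 2 / 2) • z'))
      (2 * g (x + s • v + (s ^ 2 / 2) • z)
        (v' + s • z' + Γ (x + s • v + (s ^ 2 / 2) • z) (v + s • z)
          (x' + s • v' + (s ^ 2 / 2) • z')) (x' + s • v' + (s ^ 2 / 2) • z')) s := by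
  refine (h.hasDerivAt_metric hx (hasDerivAt_quadratic x v z s) (hasDerivAt_quadratic x' v' z' s)
    (hasDerivAt_quadratic x' v' z' s)).congr_deriv ?_
  rw [h.metric_symm _ hx (x' + s • v' + (s ^ 2 / 2) • z')]
  ring

/-- Second derivative of the squared speed of the variation `x + s v + s² z / 2`. -/
theorem hasDerivAt_deriv_sq_speed (h : IsLeviCivita U g Γ) {x v z x' v' z' : E} {s : ℝ}
    (hx : x + s • v + (s ^ 2 / 2) • z ∈ U) :
    HasDerivAt (fun r : ℝ ↦ 2 * g (x + r • v + (r ^ 2 / 2) • z)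
        (v' + r • z' + Γ (x + r • v + (r ^ 2 / 2) • z) (v + r • z)
          (x' + r • v' + (r ^ 2 / 2) • z')) (x' + r • v' + (r ^ 2 / 2) • z'))
      (2 * sqSpeedSecondDeriv g Γ x v z x' v' z' s) s := by
  have hv : ∀ a b : E, HasDerivAt (fun r : ℝ ↦ a + r • b) b s := fun a b ↦ by
    simpa using ((hasDerivAt_id s).smul_const b).const_add a
  have hW := (hv v' z').add (h.hasDerivAt_gamma hx (hasDerivAt_quadratic x v z s) (hv v z)
    (hasDerivAt_quadratic x' v' z' s))
  exact (h.hasDerivAt_metric hx (hasDerivAt_quadratic x v z s) hW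
    (hasDerivAt_quadratic x' v' z' s)).const_mul 2

/-- Along `x` with velocity `T`, for a variation field `φ e` with `e` parallel, and vanishing
transversal acceleration, the second derivative of the squared speed is given by the curvature. -/
theorem sqSpeedSecondDeriv_zero (h : IsLeviCivita U g Γ) {x T e : E} (hx : x ∈ U) (φ φ' : ℝ)
    (he : g x e e = 1) :
    sqSpeedSecondDeriv g Γ x (φ • e) (-Γ x (φ • e) (φ • e)) T (φ' • e - φ • Γ x T e)
      (-(fderiv ℝ Γ x T (φ • e) (φ • e) + Γ x (φ' • e - φ • Γ x T e) (φ • e)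
        + Γ x (φ • e) (φ' • e - φ • Γ x T e))) 0 =
      φ' ^ 2 - φ ^ 2 * g x (curvature Γ x e T T) e := by
  -- With zero transversal acceleration, commuting the covariant derivatives leaves φ² g(R(e,T)e,
  -- T); skew-adjointness gives it the sign of the index form. The other term is |φ' e|² = φ'²,
  -- because `e` is parallel.
  have h1 : g x (curvature Γ x e T e) T = - g x (curvature Γ x e T T) e := by
    rw [h.metric_curvature_skew hx, h.metric_symm x hx]
  have h2 : Γ x (Γ x e e) T = Γ x T (Γ x e e) := h.gamma_symm x hx _ _
  have h3 : Γ x (Γ x T e) e = Γ x e (Γ x T e) := h.gamma_symm x hx _ _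
  have h4 : Γ x e T = Γ x T e := h.gamma_symm x hx _ _
  have h5 := h.fderiv_gamma_symm hx e e T
  have h6 : φ ^ 2 * g x (curvature Γ x e T T) e = - (φ ^ 2 * g x (curvature Γ x e T e) T) := by
    rw [h1]; ring
  rw [h6]
  simp only [sqSpeedSecondDeriv, curvature, zero_smul, add_zero, map_add, map_sub, map_neg,
    map_smul, add_apply, sub_apply, neg_apply, smul_apply, smul_eq_mul, ne_eq, OfNat.ofNat_ne_zero,
    not_false_eq_true, zero_pow, zero_div, h2, h3, h4, h5, he]
  ring

end IsLeviCivita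

end LocalGeometry

/-! ### One-sided and uniform Taylor estimates -/

section Taylor

open Filter Topology

/-- Two applications of the mean value theorem. Only an upper bound on the second derivative is
needed, not its continuity. -/
theorem le_taylor_two_of_nonneg {f f₁ f₂ : ℝ → ℝ} {s C : ℝ} (hs : 0 ≤ s)
    (hf : ∀ r ∈ Icc 0 s, HasDerivAt f (f₁ r) r) (hf₁ : ∀ r ∈ Icc 0 s, HasDerivAt f₁ (f₂ r) r)
    (hC : ∀ r ∈ Icc 0 s, f₂ r ≤ C) : f s ≤ f 0 + s * f₁ 0 + s ^ 2 / 2 * C := by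
  rcases hs.eq_or_lt with rfl | hs
  · simp
  have h1 : ∀ r ∈ Icc 0 s, f₁ r ≤ f₁ 0 + r * C := by
    intro r hr
    rcases hr.1.eq_or_lt with rfl | h0
    · simp
    obtain ⟨c, hc, hc'⟩ := exists_hasDerivAt_eq_slope f₁ f₂ h0
      (fun u hu ↦ (hf₁ u ⟨hu.1, hu.2.trans hr.2⟩).continuousAt.continuousWithinAt)
      (fun u hu ↦ hf₁ u ⟨hu.1.le, hu.2.le.trans hr.2⟩)
    have h3 := hC c ⟨hc.1.le, hc.2.le.trans hr.2⟩
    rw [hc', div_le_iff₀ (by linarith)] at h3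
    linarith
  have hq : ∀ r ∈ Icc 0 s, HasDerivAt (fun r ↦ f r - r * f₁ 0 - r ^ 2 / 2 * C)
      (f₁ r - f₁ 0 - r * C) r := by
    intro r hr
    have h2 : HasDerivAt (fun r : ℝ ↦ r ^ 2 / 2 * C) (r * C) r := by
      simpa using ((hasDerivAt_pow 2 r).div_const 2).mul_const C
    simpa using ((hf r hr).fun_sub ((hasDerivAt_id r).mul_const (f₁ 0))).fun_sub h2
  obtain ⟨c, hc, hc'⟩ := exists_hasDerivAt_eq_slope _ _ hs
    (fun u hu ↦ (hq u hu).continuousAt.continuousWithinAt) (fun u hu ↦ hq u ⟨hu.1.le, hu.2.le⟩)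
  have h3 : f₁ c - f₁ 0 - c * C ≤ 0 := by linarith [h1 c ⟨hc.1.le, hc.2.le⟩]
  rw [hc', div_le_iff₀ (by linarith)] at h3
  norm_num at h3
  linarith

/-- Negative `s` reduces to the previous case by the reflection r ↦ -r, which changes the sign of
`f₁` and keeps that of `f₂`. -/
theorem le_taylor_two {f f₁ f₂ : ℝ → ℝ} {s C : ℝ}
    (hf : ∀ r, |r| ≤ |s| → HasDerivAt f (f₁ r) r) (hf₁ : ∀ r, |r| ≤ |s| → HasDerivAt f₁ (f₂ r) r)
    (hC : ∀ r, |r| ≤ |s| → f₂ r ≤ C) : f s ≤ f 0 + s * f₁ 0 + s ^ 2 / 2 * C := by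
  rcases le_total 0 s with hs | hs
  · have key : ∀ r ∈ Icc 0 s, |r| ≤ |s| := fun r hr ↦ by
      rw [abs_of_nonneg hr.1, abs_of_nonneg hs]; exact hr.2
    exact le_taylor_two_of_nonneg hs (fun r hr ↦ hf r (key r hr)) (fun r hr ↦ hf₁ r (key r hr))
      (fun r hr ↦ hC r (key r hr))
  · have key : ∀ r ∈ Icc 0 (-s), |-r| ≤ |s| := fun r hr ↦ by
      rw [abs_neg, abs_of_nonneg hr.1, abs_of_nonpos hs]; exact hr.2
    have := le_taylor_two_of_nonneg (f := fun r ↦ f (-r)) (f₁ := fun r ↦ -f₁ (-r))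
      (f₂ := fun r ↦ f₂ (-r)) (s := -s) (C := C) (by linarith)
      (fun r hr ↦ by
        simpa [Function.comp_def] using (hf (-r) (key r hr)).comp r (hasDerivAt_neg r))
      (fun r hr ↦ by
        simpa [Function.comp_def] using
          ((hf₁ (-r) (key r hr)).comp r (hasDerivAt_neg r)).fun_neg)
      (fun r hr ↦ hC _ (key r hr))
    simpa using this

/-- Second order Taylor upper bound, uniform in a parameter in a compact set. -/
theorem eventually_forall_le_taylor_two {h h₁ h₂ : ℝ → ℝ → ℝ} {K : Set ℝ} (hK : IsCompact K)
    (hd : ∀ t ∈ K, ∀ᶠ z : ℝ × ℝ in 𝓝 (0, t), HasDerivAt (fun r ↦ h r z.2) (h₁ z.1 z.2) z.1)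
    (hd₁ : ∀ t ∈ K, ∀ᶠ z : ℝ × ℝ in 𝓝 (0, t), HasDerivAt (fun r ↦ h₁ r z.2) (h₂ z.1 z.2) z.1)
    (hc : ∀ t ∈ K, ContinuousAt (fun z : ℝ × ℝ ↦ h₂ z.1 z.2) (0, t)) {ε : ℝ} (hε : 0 < ε) :
    ∀ᶠ s in 𝓝 (0 : ℝ), ∀ t ∈ K, h s t ≤ h 0 t + s * h₁ 0 t + s ^ 2 / 2 * (h₂ 0 t + ε) := by
  have h1 : ∀ t ∈ K, ∀ᶠ z : ℝ × ℝ in 𝓝 (0, t), h₂ z.1 z.2 ≤ h₂ 0 z.2 + ε := by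
    intro t ht
    have h2 : ContinuousAt (fun z : ℝ × ℝ ↦ h₂ 0 z.2 + ε) (0, t) := by
      have : ContinuousAt (fun z : ℝ × ℝ ↦ ((0 : ℝ), z.2)) (0, t) := by fun_prop
      exact (ContinuousAt.comp (f := fun z : ℝ × ℝ ↦ ((0 : ℝ), z.2)) (hc t ht) this).add
        continuousAt_const
    exact ((hc t ht).eventually_lt h2 (by simpa using hε)).mono fun z hz ↦ hz.le
  have h2 := hK.eventually_forall_of_forall_eventually
    (P := fun s t ↦ HasDerivAt (fun r ↦ h r t) (h₁ s t) s) hd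
  have h3 := hK.eventually_forall_of_forall_eventually
    (P := fun s t ↦ HasDerivAt (fun r ↦ h₁ r t) (h₂ s t) s) hd₁
  have h4 := hK.eventually_forall_of_forall_eventually
    (P := fun s t ↦ h₂ s t ≤ h₂ 0 t + ε) h1
  obtain ⟨δ, hδ, H⟩ := Metric.eventually_nhds_iff.1 (h2.and (h3.and h4))
  refine Metric.eventually_nhds_iff.2 ⟨δ, hδ, fun s hs t ht ↦ ?_⟩
  have key : ∀ r, |r| ≤ |s| → dist r 0 < δ := fun r hr ↦ by
    simpa using hr.trans_lt (by simpa using hs)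
  exact le_taylor_two (fun r hr ↦ (H (key r hr)).1 t ht) (fun r hr ↦ (H (key r hr)).2.1 t ht)
    (fun r hr ↦ (H (key r hr)).2.2 t ht)

/-- A curve with vanishing second order jet at `0` is `o(s²)`. -/
theorem eventually_norm_le_sq_of_jet_eq_zero {E : Type*} [NormedAddCommGroup E] [NormedSpace ℝ E]
    {f f' : ℝ → E} (h0 : f 0 = 0) (h0' : f' 0 = 0)
    (hf : ∀ᶠ s in 𝓝 (0 : ℝ), HasDerivAt f (f' s) s) (hf' : HasDerivAt f' 0 0)
    {ε : ℝ} (hε : 0 < ε) : ∀ᶠ s in 𝓝 (0 : ℝ), ‖f s‖ ≤ ε * s ^ 2 := by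
  have h1 := (hasDerivAt_iff_isLittleO.1 hf').def hε
  simp only [h0', sub_zero, smul_zero] at h1
  obtain ⟨δ, hδ, H⟩ := Metric.eventually_nhds_iff.1 (hf.and h1)
  refine Metric.eventually_nhds_iff.2 ⟨δ, hδ, fun s hs ↦ ?_⟩
  have key : ∀ r ∈ Icc (-|s|) |s|, dist r 0 < δ := fun r hr ↦ by
    simpa using (abs_le.2 hr).trans_lt (by simpa using hs)
  have := (convex_Icc (-|s|) |s|).norm_image_sub_le_of_norm_hasDerivWithin_le (x := 0) (y := s)
    (C := ε * |s|) (fun r hr ↦ (H (key r hr)).1.hasDerivWithinAt)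
    (fun r hr ↦ ((H (key r hr)).2).trans (by
      rw [Real.norm_eq_abs]; exact mul_le_mul_of_nonneg_left (abs_le.2 hr) hε.le))
    (by simp) ⟨neg_abs_le s, le_abs_self s⟩
  simpa [h0, mul_assoc, ← sq] using this

end Taylor

/-! ### Linear differential equations, for parallel transport -/

section LinearODE

open Filter Topology

/-- Local solvability of linear equations, on an interval independent of the initial data. -/
theorem exists_forall_hasDerivAt_linear {E : Type*} [NormedAddCommGroup E] [NormedSpace ℝ E]
    [CompleteSpace E] {A : ℝ → E →L[ℝ] E} {t₀ : ℝ} (hA : ∀ᶠ t in 𝓝 t₀, ContinuousAt A t) :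
    ∃ δ > 0, ∀ a ∈ Ioo (t₀ - δ) (t₀ + δ), ∀ e : E, ∃ Y : ℝ → E, Y a = e ∧
      ∀ t ∈ Ioo (t₀ - δ) (t₀ + δ), HasDerivAt Y (A t (Y t)) t := by
  set K : ℝ := ‖A t₀‖ + 1 with hK
  have hK0 : 0 < K := by positivity
  have h1 : ∀ᶠ t in 𝓝 t₀, ‖A t‖ ≤ K := by
    have := hA.self_of_nhds.norm.eventually_lt (continuousAt_const (y := K))
      (by rw [hK]; linarith)
    exact this.mono fun t ht ↦ ht.le
  obtain ⟨δ₀, hδ₀, H⟩ := Metric.eventually_nhds_iff.1 (hA.and h1)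
  -- On the ball of radius ‖e‖ about e the field is at most 2K‖e‖, and the elapsed time is at most
  -- 2δ. So 4Kδ ≤ 1 keeps the solution in the ball; both sides scale with ‖e‖, so δ does not depend
  -- on e.
  obtain ⟨δ, hδ, hδ1, hδ2⟩ : ∃ δ > 0, δ < δ₀ ∧ 4 * K * δ ≤ 1 := by
    refine ⟨min (δ₀ / 2) (1 / (4 * K)), by positivity, ?_, ?_⟩
    · exact (min_le_left _ _).trans_lt (by linarith)
    · calc 4 * K * min (δ₀ / 2) (1 / (4 * K)) ≤ 4 * K * (1 / (4 * K)) := by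
            gcongr; exact min_le_right _ _
        _ = 1 := by field_simp
  refine ⟨δ, hδ, fun a ha e ↦ ?_⟩
  have key : ∀ t ∈ Icc (t₀ - δ) (t₀ + δ), ContinuousAt A t ∧ ‖A t‖ ≤ K := fun t ht ↦ by
    apply H
    rw [Real.dist_eq, abs_lt]
    constructor <;> linarith [ht.1, ht.2]
  have hPL : IsPicardLindelof (fun t y ↦ A t y) (tmin := t₀ - δ) (tmax := t₀ + δ)
      ⟨a, ha.1.le, ha.2.le⟩ e ‖e‖₊ 0 (⟨2 * K * ‖e‖, by positivity⟩) ⟨K, hK0.le⟩ := by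
    refine ⟨fun t ht ↦ ?_, fun x _ ↦ ?_, fun t ht x hx ↦ ?_, ?_⟩
    · refine LipschitzWith.lipschitzOnWith ?_
      exact (A t).lipschitz.weaken (by exact_mod_cast (key t ht).2)
    · exact fun t ht ↦ ((key t ht).1.clm_apply continuousAt_const).continuousWithinAt
    · have hx' : ‖x‖ ≤ 2 * ‖e‖ := by
        have := norm_le_norm_add_norm_sub' x e
        rw [mem_closedBall_iff_norm] at hx
        simp only [coe_nnnorm] at hx
        linarith
      calc ‖A t x‖ ≤ ‖A t‖ * ‖x‖ := (A t).le_opNorm x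
        _ ≤ K * (2 * ‖e‖) := by gcongr; exact (key t ht).2
        _ = 2 * K * ‖e‖ := by ring
    · have h2 : max (t₀ + δ - a) (a - (t₀ - δ)) ≤ 2 * δ :=
        max_le (by linarith [ha.1]) (by linarith [ha.2])
      calc 2 * K * ‖e‖ * max (t₀ + δ - a) (a - (t₀ - δ)) ≤ 2 * K * ‖e‖ * (2 * δ) := by gcongr
        _ = (4 * K * δ) * ‖e‖ := by ring
        _ ≤ 1 * ‖e‖ := by gcongr
        _ = _ := by simp
  obtain ⟨Y, hY, hY'⟩ := hPL.exists_eq_forall_mem_Icc_hasDerivWithinAt₀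
  exact ⟨Y, hY, fun t ht ↦ (hY' t ⟨ht.1.le, ht.2.le⟩).hasDerivAt (Icc_mem_nhds ht.1 ht.2)⟩

end LinearODE

/-! ### Traces in orthonormal frames -/

section Trace

variable {n : ℕ}

/-- The trace of an endomorphism computed in a frame that is orthonormal for a bilinear form. -/
theorem sum_apply_orthonormal_eq_sum_coord
    {B : EuclideanSpace ℝ (Fin n) →L[ℝ] EuclideanSpace ℝ (Fin n) →L[ℝ] ℝ}
    {b : Fin n → EuclideanSpace ℝ (Fin n)} (hb : ∀ i j, B (b i) (b j) = if i = j then 1 else 0)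
    (A : EuclideanSpace ℝ (Fin n) →ₗ[ℝ] EuclideanSpace ℝ (Fin n)) :
    ∑ i, B (A (b i)) (b i) = ∑ k, A (EuclideanSpace.single k 1) k := by
  rcases isEmpty_or_nonempty (Fin n) with hn | hn
  · simp
  -- Pairing with `b j` reads off the `j`-th coefficient. This gives linear independence, and
  -- identifies `B (A (b i)) (b i)` as a diagonal entry of the matrix of `A`.
  have hB : ∀ (c : Fin n → ℝ) (j), B (∑ i, c i • b i) (b j) = c j := fun c j ↦ by
    simp [hb]
  have hli : LinearIndependent ℝ b := by
    rw [Fintype.linearIndependent_iff]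
    intro c hc j
    simpa [hc] using (hB c j).symm
  let bas : Module.Basis (Fin n) ℝ (EuclideanSpace ℝ (Fin n)) :=
    basisOfLinearIndependentOfCardEqFinrank hli (by simp)
  have hbas : ∀ i, bas i = b i := fun i ↦ by simp [bas]
  have h1 : LinearMap.trace ℝ _ A = ∑ i, B (A (b i)) (b i) := by
    rw [LinearMap.trace_eq_matrix_trace ℝ bas, Matrix.trace]
    refine Finset.sum_congr rfl fun i _ ↦ ?_
    rw [Matrix.diag_apply, LinearMap.toMatrix_apply, hbas]
    conv_rhs => rw [← bas.sum_repr (A (b i))]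
    simp only [hbas]
    rw [hB]
  rw [← h1, LinearMap.trace_eq_matrix_trace ℝ (EuclideanSpace.basisFun (Fin n) ℝ).toBasis,
    Matrix.trace]
  refine Finset.sum_congr rfl fun i _ ↦ ?_
  simp [LinearMap.toMatrix_apply]

end Trace

/-! ### Change of coordinates for Christoffel symbols -/

section Transition

open Filter Topology

variable {E : Type*} [NormedAddCommGroup E] [NormedSpace ℝ E]
  {U U' : Set E} {g g' : E → E →L[ℝ] E →L[ℝ] ℝ} {Γ Γ' : E → E →L[ℝ] E →L[ℝ] E} {τ : E → E}

/-- The transformation law of the Christoffel symbols under a local isometry `τ`. -/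
theorem IsLeviCivita.fderiv_gamma_eq (h : IsLeviCivita U g Γ) (h' : IsLeviCivita U' g' Γ')
    {x : E} (hx : x ∈ U) (hx' : τ x ∈ U') (hτ : ContDiffAt ℝ ∞ τ x)
    (hiso : ∀ᶠ y in 𝓝 x, ∀ u v, g y u v = g' (τ y) (fderiv ℝ τ y u) (fderiv ℝ τ y v))
    (hsurj : Function.Surjective (fderiv ℝ τ x)) (u v : E) :
    fderiv ℝ τ x (Γ x u v) =
      Γ' (τ x) (fderiv ℝ τ x u) (fderiv ℝ τ x v) + fderiv ℝ (fderiv ℝ τ) x u v := by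
  have hτ1 : HasFDerivAt τ (fderiv ℝ τ x) x := (hτ.differentiableAt (by simp)).hasFDerivAt
  have hτ2 : HasFDerivAt (fderiv ℝ τ) (fderiv ℝ (fderiv ℝ τ) x) x :=
    ((hτ.fderiv_right (m := 1) (by norm_cast)).differentiableAt (by simp)).hasFDerivAt
  have hsymm : ∀ u v, fderiv ℝ (fderiv ℝ τ) x u v = fderiv ℝ (fderiv ℝ τ) x v u := fun u v ↦
    (hτ.isSymmSndFDerivAt (by simp; norm_cast)) u v
  -- The defect of the transformation law. It is symmetric in `u`, `v`; differentiating the isometry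
  -- relation makes g'(S u v, Dτ w) skew in `v`, `w`.
  set S : E → E → E := fun u v ↦ fderiv ℝ τ x (Γ x u v) -
    (Γ' (τ x) (fderiv ℝ τ x u) (fderiv ℝ τ x v) + fderiv ℝ (fderiv ℝ τ) x u v) with hS
  have hSsymm : ∀ u v, S u v = S v u := fun u v ↦ by
    simp only [hS]
    rw [h.gamma_symm x hx, h'.gamma_symm _ hx', hsymm]
  have hpt := hiso.self_of_nhds
  have hskew : ∀ u v w, g' (τ x) (S u v) (fderiv ℝ τ x w) =
      - g' (τ x) (S u w) (fderiv ℝ τ x v) := by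
    intro u v w
    let c : ℝ → E := fun s ↦ x + s • u
    have hc : HasDerivAt c u 0 := by
      simpa [c] using ((hasDerivAt_id (0 : ℝ)).smul_const u).const_add x
    have hc0 : c 0 = x := by simp [c]
    have hcU : c 0 ∈ U := by rwa [hc0]
    have h1 := h.hasDerivAt_metric hcU hc (hasDerivAt_const 0 v) (hasDerivAt_const 0 w)
    have hτc : HasDerivAt (fun s ↦ τ (c s)) (fderiv ℝ τ x u) 0 := by
      rw [← hc0] at hτ1
      simpa [hc0] using! hτ1.comp_hasDerivAt 0 hc
    have hD : ∀ y, HasDerivAt (fun s ↦ fderiv ℝ τ (c s) y) (fderiv ℝ (fderiv ℝ τ) x u y) 0 := by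
      intro y
      rw [← hc0] at hτ2
      have := (hτ2.comp_hasDerivAt 0 hc).clm_apply (hasDerivAt_const 0 y)
      simpa [hc0] using this
    have h2 := h'.hasDerivAt_metric (x := fun s ↦ τ (c s)) (by simpa [hc0] using hx') hτc
      (hD v) (hD w)
    have h3 : (fun s ↦ g (c s) v w) =ᶠ[𝓝 0]
        fun s ↦ g' (τ (c s)) (fderiv ℝ τ (c s) v) (fderiv ℝ τ (c s) w) := by
      have : Tendsto c (𝓝 0) (𝓝 x) := by simpa [hc0] using hc.continuousAt.tendsto
      exact (this.eventually hiso).mono fun s hs ↦ hs v w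
    have h4 := h1.unique (h2.congr_of_eventuallyEq h3)
    simp only [hc0, zero_add, hpt] at h4
    have h5 := h'.metric_symm _ hx' (S u w) (fderiv ℝ τ x v)
    rw [h5]
    simp only [hS, map_sub, map_add, sub_apply, add_apply] at h4 ⊢
    linarith
  -- A trilinear form symmetric in the first two slots and skew in the last two vanishes, as in the
  -- uniqueness of the Levi-Civita connection.
  have hzero : ∀ w, g' (τ x) (S u v) (fderiv ℝ τ x w) = 0 := fun w ↦ by
    have e1 := hskew u v w
    have e2 := hskew w u v
    have e3 := hskew v w u
    rw [hSsymm u w] at e1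
    rw [hSsymm w v] at e2
    rw [hSsymm v u] at e3
    linarith
  by_contra hne
  have hSne : S u v ≠ 0 := fun h0 ↦ hne (sub_eq_zero.1 h0)
  obtain ⟨w, hw⟩ := hsurj (S u v)
  have := h'.metric_pos _ hx' _ hSne
  rw [← hw] at this
  rw [← hw] at hzero
  exact this.ne' (hzero w)

/-- The derivative of the velocity of the image of a curve. -/
theorem hasDerivAt_fderiv_comp {c c' : ℝ → E} {c'' : E} {t : ℝ} (hτ : ContDiffAt ℝ ∞ τ (c t))
    (hc : HasDerivAt c (c' t) t) (hc' : HasDerivAt c' c'' t) :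
    HasDerivAt (fun s ↦ fderiv ℝ τ (c s) (c' s))
      (fderiv ℝ (fderiv ℝ τ) (c t) (c' t) (c' t) + fderiv ℝ τ (c t) c'') t := by
  have hτ2 : HasFDerivAt (fderiv ℝ τ) (fderiv ℝ (fderiv ℝ τ) (c t)) (c t) :=
    ((hτ.fderiv_right (m := 1) (by norm_cast)).differentiableAt (by simp)).hasFDerivAt
  simpa using (hτ2.comp_hasDerivAt t hc).clm_apply hc'

end Transition

/-! ### Squared speed of the variation of a curve -/

section Variation

open Filter Topology

variable {E : Type*} [NormedAddCommGroup E] [NormedSpace ℝ E]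
  {U : Set E} {g : E → E →L[ℝ] E →L[ℝ] ℝ} {Γ : E → E →L[ℝ] E →L[ℝ] E}

/-- The parabola with initial point `x`, initial velocity `v` and vanishing initial covariant
acceleration. -/
noncomputable def jetCurve (Γ : E → E →L[ℝ] E →L[ℝ] E) (x v : E) (s : ℝ) : E :=
  x + s • v + (s ^ 2 / 2) • (-Γ x v v)

/-- The derivative in `t` of `jetCurve Γ x v s`, if `x` has derivative `T` and `v` has derivative
`v'`. -/
noncomputable def jetCurveDeriv (Γ : E → E →L[ℝ] E →L[ℝ] E) (x v T v' : E) (s : ℝ) : E :=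
  T + s • v' + (s ^ 2 / 2) • (-(fderiv ℝ Γ x T v v + Γ x v' v + Γ x v v'))

@[simp] theorem jetCurve_zero (x v : E) : jetCurve Γ x v 0 = x := by simp [jetCurve]

theorem jetCurve_zero_vec (x : E) (s : ℝ) : jetCurve Γ x 0 s = x := by simp [jetCurve]

theorem IsLeviCivita.hasDerivAt_jetCurve (h : IsLeviCivita U g Γ) {x v : ℝ → E} {T v' : E}
    {t : ℝ} (hx : x t ∈ U) (hx' : HasDerivAt x T t) (hv : HasDerivAt v v' t) (s : ℝ) :
    HasDerivAt (fun r ↦ jetCurve Γ (x r) (v r) s) (jetCurveDeriv Γ (x t) (v t) T v' s) t :=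
  (hx'.fun_add (hv.const_smul s)).fun_add
    ((h.hasDerivAt_gamma hx hx' hv hv).fun_neg.const_smul (s ^ 2 / 2))

theorem IsLeviCivita.continuousAt_metric_comp (h : IsLeviCivita U g Γ) {Y : Type*}
    [TopologicalSpace Y] {X : Y → E} {y : Y} (hX : ContinuousAt X y) (hy : X y ∈ U) :
    ContinuousAt (fun p ↦ g (X p)) y :=
  ContinuousAt.comp (g := g) (h.contDiffAt_metric hy).continuousAt hX

theorem IsLeviCivita.continuousAt_gamma_comp (h : IsLeviCivita U g Γ) {Y : Type*}
    [TopologicalSpace Y] {X : Y → E} {y : Y} (hX : ContinuousAt X y) (hy : X y ∈ U) :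
    ContinuousAt (fun p ↦ Γ (X p)) y :=
  ContinuousAt.comp (g := Γ) (h.contDiffAt_gamma hy).continuousAt hX

theorem IsLeviCivita.continuousAt_fderiv_gamma_comp (h : IsLeviCivita U g Γ) {Y : Type*}
    [TopologicalSpace Y] {X : Y → E} {y : Y} (hX : ContinuousAt X y) (hy : X y ∈ U) :
    ContinuousAt (fun p ↦ fderiv ℝ Γ (X p)) y :=
  ContinuousAt.comp (g := fderiv ℝ Γ)
    ((h.contDiffAt_gamma hy).fderiv_right (m := 0) (by norm_cast)).continuousAt hX

theorem IsLeviCivita.continuousAt_sqSpeedSecondDeriv (h : IsLeviCivita U g Γ) {Y : Type*}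
    [TopologicalSpace Y] {x v z x' v' z' : Y → E} {s : Y → ℝ} {y : Y}
    (hx : ContinuousAt x y) (hv : ContinuousAt v y) (hz : ContinuousAt z y)
    (hx' : ContinuousAt x' y) (hv' : ContinuousAt v' y) (hz' : ContinuousAt z' y)
    (hs : ContinuousAt s y) (hy : x y + s y • v y + (s y ^ 2 / 2) • z y ∈ U) :
    ContinuousAt (fun p ↦ sqSpeedSecondDeriv g Γ (x p) (v p) (z p) (x' p) (v' p) (z' p) (s p))
      y := by
  have hX : ContinuousAt (fun p ↦ x p + s p • v p + (s p ^ 2 / 2) • z p) y := by fun_prop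
  have h1 := h.continuousAt_metric_comp hX hy
  have h2 := h.continuousAt_gamma_comp hX hy
  have h3 := h.continuousAt_fderiv_gamma_comp hX hy
  -- Once the coefficients along `X` are replaced by arbitrary continuous families, only continuity
  -- of bilinear evaluation is left.
  have key : ∀ (G : Y → E →L[ℝ] E →L[ℝ] ℝ) (C : Y → E →L[ℝ] E →L[ℝ] E)
      (D : Y → E →L[ℝ] E →L[ℝ] E →L[ℝ] E) (P Q T : Y → E), ContinuousAt G y → ContinuousAt C y →
      ContinuousAt D y → ContinuousAt P y → ContinuousAt Q y → ContinuousAt T y →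
      ContinuousAt (fun p ↦ G p (z' p + (D p (P p) (P p) (T p) + C p (z p) (T p) + C p (P p) (Q p))
        + C p (P p) (Q p + C p (P p) (T p))) (T p)
        + G p (Q p + C p (P p) (T p)) (Q p + C p (P p) (T p))) y := by
    intros
    fun_prop
  exact key _ _ _ (fun p ↦ v p + s p • z p) (fun p ↦ v' p + s p • z' p)
    (fun p ↦ x' p + s p • v' p + (s p ^ 2 / 2) • z' p) h1 h2 h3 (by fun_prop) (by fun_prop)
    (by fun_prop)

/-- Along a unit speed curve, the variation in the direction of a multiple `φ e` of a parallel
unit normal field has squared speed controlled by the curvature. -/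
theorem IsLeviCivita.eventually_sq_speed_le (h : IsLeviCivita U g Γ) {x T e : ℝ → E}
    {φ φ' : ℝ → ℝ} {J : Set ℝ} (hxU : ∀ t ∈ J, x t ∈ U)
    (hx : ∀ t ∈ J, HasDerivAt x (T t) t) (hT : ∀ t ∈ J, ContinuousAt T t)
    (he : ∀ t ∈ J, HasDerivAt e (-Γ (x t) (T t) (e t)) t)
    (hφ' : ∀ t, ContinuousAt φ' t) (hφ : ∀ t, ContinuousAt φ t)
    (hTT : ∀ t ∈ J, g (x t) (T t) (T t) = 1) (hee : ∀ t ∈ J, g (x t) (e t) (e t) = 1)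
    (heT : ∀ t ∈ J, g (x t) (e t) (T t) = 0) {a b : ℝ} (hab : Icc a b ⊆ J) {ε : ℝ} (hε : 0 < ε) :
    ∀ᶠ s in 𝓝 (0 : ℝ), ∀ t ∈ Icc a b, jetCurve Γ (x t) (φ t • e t) s ∈ U ∧
      g (jetCurve Γ (x t) (φ t • e t) s)
        (jetCurveDeriv Γ (x t) (φ t • e t) (T t) (φ' t • e t - φ t • Γ (x t) (T t) (e t)) s)
        (jetCurveDeriv Γ (x t) (φ t • e t) (T t) (φ' t • e t - φ t • Γ (x t) (T t) (e t)) s) ≤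
      1 + s ^ 2 * ((φ' t ^ 2 - φ t ^ 2 * g (x t) (curvature Γ (x t) (e t) (T t) (T t)) (e t))
        + ε) := by
  have cx : ∀ t ∈ J, ContinuousAt (fun p : ℝ × ℝ ↦ x p.2) (0, t) := fun t ht ↦
    ContinuousAt.comp (f := Prod.snd) (hx t ht).continuousAt continuousAt_snd
  have ce : ∀ t ∈ J, ContinuousAt (fun p : ℝ × ℝ ↦ e p.2) (0, t) := fun t ht ↦
    ContinuousAt.comp (f := Prod.snd) (he t ht).continuousAt continuousAt_snd
  have cT : ∀ t ∈ J, ContinuousAt (fun p : ℝ × ℝ ↦ T p.2) (0, t) := fun t ht ↦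
    ContinuousAt.comp (f := Prod.snd) (hT t ht) continuousAt_snd
  have cφ : ∀ t, ContinuousAt (fun p : ℝ × ℝ ↦ φ p.2) (0, t) := fun t ↦
    ContinuousAt.comp (f := Prod.snd) (hφ t) continuousAt_snd
  have cφ' : ∀ t, ContinuousAt (fun p : ℝ × ℝ ↦ φ' p.2) (0, t) := fun t ↦
    ContinuousAt.comp (f := Prod.snd) (hφ' t) continuousAt_snd
  have cΓ : ∀ t ∈ J, ContinuousAt (fun p : ℝ × ℝ ↦ Γ (x p.2)) (0, t) := fun t ht ↦
    h.continuousAt_gamma_comp (cx t ht) (hxU t ht)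
  have cdΓ : ∀ t ∈ J, ContinuousAt (fun p : ℝ × ℝ ↦ fderiv ℝ Γ (x p.2)) (0, t) := fun t ht ↦
    h.continuousAt_fderiv_gamma_comp (cx t ht) (hxU t ht)
  set v : ℝ → E := fun t ↦ φ t • e t with hv
  set v' : ℝ → E := fun t ↦ φ' t • e t - φ t • Γ (x t) (T t) (e t) with hv'
  have cv : ∀ t ∈ J, ContinuousAt (fun p : ℝ × ℝ ↦ v p.2) (0, t) := fun t ht ↦
    (cφ t).smul (ce t ht)
  have cv' : ∀ t ∈ J, ContinuousAt (fun p : ℝ × ℝ ↦ v' p.2) (0, t) := fun t ht ↦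
    ((cφ' t).smul (ce t ht)).sub
      ((cφ t).smul (((cΓ t ht).clm_apply (cT t ht)).clm_apply (ce t ht)))
  have cz : ∀ t ∈ J, ContinuousAt (fun p : ℝ × ℝ ↦ -Γ (x p.2) (v p.2) (v p.2)) (0, t) := fun t ht ↦
    (((cΓ t ht).clm_apply (cv t ht)).clm_apply (cv t ht)).neg
  have cz' : ∀ t ∈ J, ContinuousAt (fun p : ℝ × ℝ ↦ -(fderiv ℝ Γ (x p.2) (T p.2) (v p.2) (v p.2)
      + Γ (x p.2) (v' p.2) (v p.2) + Γ (x p.2) (v p.2) (v' p.2))) (0, t) := fun t ht ↦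
    ((((((cdΓ t ht).clm_apply (cT t ht)).clm_apply (cv t ht)).clm_apply (cv t ht)).add
      (((cΓ t ht).clm_apply (cv' t ht)).clm_apply (cv t ht))).add
      (((cΓ t ht).clm_apply (cv t ht)).clm_apply (cv' t ht))).neg
  have hmem : ∀ t ∈ Icc a b, ∀ᶠ z : ℝ × ℝ in 𝓝 (0, t), jetCurve Γ (x z.2) (v z.2) z.1 ∈ U := by
    intro t ht
    have : ContinuousAt (fun z : ℝ × ℝ ↦ jetCurve Γ (x z.2) (v z.2) z.1) (0, t) :=
      ((cx t (hab ht)).add (continuousAt_fst.smul (cv t (hab ht)))).add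
        (((continuousAt_fst.pow 2).div_const 2).smul (cz t (hab ht)))
    exact this.preimage_mem_nhds (h.isOpen.mem_nhds (by simpa using hxU t (hab ht)))
  -- The squared speed, with its first two `s`-derivatives. The remainder `2 * ε` becomes `s ^ 2 *
  -- ε` through the Taylor factor `s ^ 2 / 2`.
  have h1 := eventually_forall_le_taylor_two (K := Icc a b) isCompact_Icc
    (h := fun s t ↦ g (jetCurve Γ (x t) (v t) s) (jetCurveDeriv Γ (x t) (v t) (T t) (v' t) s)
      (jetCurveDeriv Γ (x t) (v t) (T t) (v' t) s))
    (h₁ := fun s t ↦ 2 * g (jetCurve Γ (x t) (v t) s)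
      (v' t + s • (-(fderiv ℝ Γ (x t) (T t) (v t) (v t) + Γ (x t) (v' t) (v t)
          + Γ (x t) (v t) (v' t)))
        + Γ (jetCurve Γ (x t) (v t) s) (v t + s • (-Γ (x t) (v t) (v t)))
          (jetCurveDeriv Γ (x t) (v t) (T t) (v' t) s))
      (jetCurveDeriv Γ (x t) (v t) (T t) (v' t) s))
    (h₂ := fun s t ↦ 2 * sqSpeedSecondDeriv g Γ (x t) (v t) (-Γ (x t) (v t) (v t)) (T t) (v' t)
      (-(fderiv ℝ Γ (x t) (T t) (v t) (v t) + Γ (x t) (v' t) (v t) + Γ (x t) (v t) (v' t))) s)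
    (fun t ht ↦ (hmem t ht).mono fun z hz ↦ h.hasDerivAt_sq_speed hz)
    (fun t ht ↦ (hmem t ht).mono fun z hz ↦ h.hasDerivAt_deriv_sq_speed hz)
    (fun t ht ↦ (h.continuousAt_sqSpeedSecondDeriv (cx t (hab ht)) (cv t (hab ht)) (cz t (hab ht))
      (cT t (hab ht)) (cv' t (hab ht)) (cz' t (hab ht)) continuousAt_fst
      (by simpa using hxU t (hab ht))).const_mul 2) (ε := 2 * ε) (by positivity)
  have h2 := isCompact_Icc.eventually_forall_of_forall_eventually
    (P := fun s t ↦ jetCurve Γ (x t) (v t) s ∈ U) hmem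
  filter_upwards [h1, h2] with s hs1 hs2 t ht
  refine ⟨hs2 t ht, (hs1 t ht).trans (le_of_eq ?_)⟩
  have htJ := hab ht
  rw [h.sqSpeedSecondDeriv_zero (hxU t htJ) _ _ (hee t htJ)]
  -- By symmetry of `Γ` the covariant derivative of φ e along the curve is φ' e. It is orthogonal to
  -- `T`, so the linear Taylor coefficient vanishes at every `t`.
  have h3 : Γ (x t) (e t) (T t) = Γ (x t) (T t) (e t) := h.gamma_symm _ (hxU t htJ) _ _
  simp [hv, hv', jetCurve, jetCurveDeriv, hTT t htJ, h3, heT t htJ]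
  ring

/-- Parallel fields have constant inner products. -/
theorem IsLeviCivita.metric_parallel_eq (h : IsLeviCivita U g Γ) {x T e e' : ℝ → E} {α β : ℝ}
    (hxU : ∀ t ∈ Ioo α β, x t ∈ U) (hx : ∀ t ∈ Ioo α β, HasDerivAt x (T t) t)
    (he : ∀ t ∈ Ioo α β, HasDerivAt e (-Γ (x t) (T t) (e t)) t)
    (he' : ∀ t ∈ Ioo α β, HasDerivAt e' (-Γ (x t) (T t) (e' t)) t) {a t : ℝ} (ha : a ∈ Ioo α β)
    (ht : t ∈ Ioo α β) : g (x t) (e t) (e' t) = g (x a) (e a) (e' a) := by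
  have hd : ∀ r ∈ Ioo α β, HasDerivAt (fun r ↦ g (x r) (e r) (e' r)) 0 r := fun r hr ↦ by
    simpa using h.hasDerivAt_metric (hxU r hr) (hx r hr) (he r hr) (he' r hr)
  exact isOpen_Ioo.is_const_of_deriv_eq_zero isPreconnected_Ioo
    (fun r hr ↦ (hd r hr).differentiableAt.differentiableWithinAt) (fun r hr ↦ (hd r hr).deriv)
    ht ha

end Variation

/-! ### Smoothness of the inverse matrix -/

section MatrixSmooth

theorem ContDiffOn.matrix_det {E : Type*} [NormedAddCommGroup E] [NormedSpace ℝ E] {n : ℕ}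
    {A : E → Matrix (Fin n) (Fin n) ℝ} {U : Set E}
    (hA : ∀ i j, ContDiffOn ℝ ∞ (fun y ↦ A y i j) U) : ContDiffOn ℝ ∞ (fun y ↦ (A y).det) U := by
  simp only [Matrix.det_apply']
  exact ContDiffOn.sum fun σ _ ↦ contDiffOn_const.mul (contDiffOn_prod fun i _ ↦ hA _ _)

/-- Cramer's rule: each entry of the inverse is a quotient of determinants, which are polynomials in
the entries. -/
theorem ContDiffOn.matrix_inv_apply {E : Type*} [NormedAddCommGroup E] [NormedSpace ℝ E] {n : ℕ}
    {A : E → Matrix (Fin n) (Fin n) ℝ} {U : Set E}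
    (hA : ∀ i j, ContDiffOn ℝ ∞ (fun y ↦ A y i j) U) (hdet : ∀ y ∈ U, (A y).det ≠ 0)
    (i j : Fin n) : ContDiffOn ℝ ∞ (fun y ↦ (A y)⁻¹ i j) U := by
  have h1 : ∀ y, (A y)⁻¹ i j = (A y).det⁻¹ * ((A y).updateRow j (Pi.single i 1)).det := fun y ↦ by
    rw [Matrix.inv_def, Matrix.smul_apply, Matrix.adjugate_apply, Ring.inverse_eq_inv', smul_eq_mul]
  simp only [h1]
  refine ((ContDiffOn.matrix_det hA).inv hdet).mul (ContDiffOn.matrix_det fun k l ↦ ?_)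
  by_cases hk : k = j
  · subst hk
    simpa using contDiffOn_const
  · simpa [Matrix.updateRow_ne hk] using hA k l

end MatrixSmooth

/-! ### Metric and Christoffel symbols in a chart -/

namespace WeightedManifold

attribute [local instance 5000] chartedSpaceSelf

theorem isInvertible_mfderiv_symm {n : ℕ} {M : Type*} [TopologicalSpace M]
    [ChartedSpace (EuclideanSpace ℝ (Fin n)) M] [IsManifold (𝓡 n) ∞ M] {x₀ : M}
    {y : EuclideanSpace ℝ (Fin n)} (hy : y ∈ (extChartAt (𝓡 n) x₀).target) :
    (mfderiv (𝓡 n) (𝓡 n) (extChartAt (𝓡 n) x₀).symm y).IsInvertible := by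
  have h1 := isInvertible_mfderivWithin_extChartAt_symm (I := 𝓡 n) hy
  rw [ModelWithCorners.range_eq_univ, mfderivWithin_univ] at h1
  exact h1

theorem fderiv_apply_eq_sum {n : ℕ} (F : EuclideanSpace ℝ (Fin n) → ℝ)
    (y u : EuclideanSpace ℝ (Fin n)) :
    fderiv ℝ F y u = ∑ k, u k * partialDeriv k F y := by
  conv_lhs => rw [← (EuclideanSpace.basisFun (Fin n) ℝ).sum_repr u]
  simp [partialDeriv]

theorem contDiffOn_partialDeriv {n : ℕ} {F : EuclideanSpace ℝ (Fin n) → ℝ}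
    {U : Set (EuclideanSpace ℝ (Fin n))} (hU : IsOpen U) (hF : ContDiffOn ℝ ∞ F U) (i : Fin n) :
    ContDiffOn ℝ ∞ (partialDeriv i F) U :=
  (hF.fderiv_of_isOpen hU (m := ∞) (by simp)).clm_apply contDiffOn_const

variable {n : ℕ} {M : Type*} [TopologicalSpace M] [ChartedSpace (EuclideanSpace ℝ (Fin n)) M]
  [RiemannianBundle (fun x : M ↦ TangentSpace (𝓡 n) x)]

/-- The Riemannian metric in the preferred chart at `x₀`, as a bilinear form on `ℝⁿ`. -/
noncomputable def chartMetric (x₀ : M) (y : EuclideanSpace ℝ (Fin n)) :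
    EuclideanSpace ℝ (Fin n) →L[ℝ] EuclideanSpace ℝ (Fin n) →L[ℝ] ℝ :=
  ∑ i, ∑ j, metricCoeff x₀ y i j •
    (EuclideanSpace.proj i : EuclideanSpace ℝ (Fin n) →L[ℝ] ℝ).smulRight
      (EuclideanSpace.proj j : EuclideanSpace ℝ (Fin n) →L[ℝ] ℝ)

/-- The Christoffel symbols in the preferred chart at `x₀`, as a bilinear map on `ℝⁿ`. -/
noncomputable def chartGamma (x₀ : M) (y : EuclideanSpace ℝ (Fin n)) :
    EuclideanSpace ℝ (Fin n) →L[ℝ] EuclideanSpace ℝ (Fin n) →L[ℝ] EuclideanSpace ℝ (Fin n) :=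
  ∑ k, ∑ i, ∑ j, christoffel x₀ k i j y •
    (EuclideanSpace.proj i : EuclideanSpace ℝ (Fin n) →L[ℝ] ℝ).smulRight
      ((EuclideanSpace.proj j : EuclideanSpace ℝ (Fin n) →L[ℝ] ℝ).smulRight
        (EuclideanSpace.single k (1 : ℝ)))

theorem chartMetric_apply (x₀ : M) (y u v : EuclideanSpace ℝ (Fin n)) :
    chartMetric x₀ y u v = ∑ i, ∑ j, metricCoeff x₀ y i j * u i * v j := by
  simp [chartMetric, mul_assoc]

theorem chartGamma_apply (x₀ : M) (y u v : EuclideanSpace ℝ (Fin n)) (k : Fin n) :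
    chartGamma x₀ y u v k = ∑ i, ∑ j, christoffel x₀ k i j y * u i * v j := by
  simp [chartGamma, mul_assoc, Pi.single_apply]

theorem chartMetric_eq_inner (x₀ : M) (y u v : EuclideanSpace ℝ (Fin n)) :
    chartMetric x₀ y u v =
      inner ℝ (mfderiv (𝓡 n) (𝓡 n) (extChartAt (𝓡 n) x₀).symm y u)
        (mfderiv (𝓡 n) (𝓡 n) (extChartAt (𝓡 n) x₀).symm y v) := by
  have key : ∀ (F : EuclideanSpace ℝ (Fin n) →L[ℝ]
        TangentSpace (𝓡 n) ((extChartAt (𝓡 n) x₀).symm y))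
      (u v : EuclideanSpace ℝ (Fin n)),
      ∑ i, ∑ j, inner ℝ (F (EuclideanSpace.single i (1 : ℝ))) (F (EuclideanSpace.single j (1 : ℝ)))
        * u i * v j = inner ℝ (F u) (F v) := by
    intro F u v
    have hu : ∀ w : EuclideanSpace ℝ (Fin n), F w = ∑ i, w i • F (EuclideanSpace.single i 1) := by
      intro w
      have hw : w = ∑ i, w i • EuclideanSpace.single i (1 : ℝ) := by
        simpa using ((EuclideanSpace.basisFun (Fin n) ℝ).sum_repr w).symm
      exact (congrArg F hw).trans ((map_sum F _ _).trans
        (Finset.sum_congr rfl fun i _ ↦ map_smul F _ _))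
    rw [hu u, hu v, sum_inner]
    refine Finset.sum_congr rfl fun i _ ↦ ?_
    rw [inner_sum]
    refine Finset.sum_congr rfl fun j _ ↦ ?_
    rw [real_inner_smul_left, real_inner_smul_right]
    ring
  rw [chartMetric_apply]
  exact key _ u v

theorem chartMetric_symm (x₀ : M) (y u v : EuclideanSpace ℝ (Fin n)) :
    chartMetric x₀ y u v = chartMetric x₀ y v u := by
  rw [chartMetric_eq_inner, chartMetric_eq_inner]
  exact real_inner_comm _ _

theorem metricCoeff_eq_chartMetric (x₀ : M) (y : EuclideanSpace ℝ (Fin n)) (i j : Fin n) :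
    metricCoeff x₀ y i j =
      chartMetric x₀ y (EuclideanSpace.single i 1) (EuclideanSpace.single j 1) := by
  rw [chartMetric_eq_inner]
  rfl

theorem metricCoeff_symm (x₀ : M) (y : EuclideanSpace ℝ (Fin n)) (i j : Fin n) :
    metricCoeff x₀ y i j = metricCoeff x₀ y j i := by
  rw [metricCoeff_eq_chartMetric, chartMetric_symm, ← metricCoeff_eq_chartMetric]

theorem christoffel_symm (x₀ : M) (k i j : Fin n) (y : EuclideanSpace ℝ (Fin n)) :
    christoffel x₀ k i j y = christoffel x₀ k j i y := by
  have h1 : (fun z ↦ metricCoeff x₀ z i j) = fun z ↦ metricCoeff x₀ z j i :=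
    funext fun z ↦ metricCoeff_symm x₀ z i j
  simp only [christoffel]
  congr 1
  refine Finset.sum_congr rfl fun l _ ↦ ?_
  rw [h1]
  ring

theorem chartGamma_single (x₀ : M) (y : EuclideanSpace ℝ (Fin n)) (i j k : Fin n) :
    chartGamma x₀ y (EuclideanSpace.single i 1) (EuclideanSpace.single j 1) k =
      christoffel x₀ k i j y := by
  simp [chartGamma_apply]

theorem chartMetric_single_right (x₀ : M) (y u : EuclideanSpace ℝ (Fin n)) (l : Fin n) :
    chartMetric x₀ y u (EuclideanSpace.single l 1) = ∑ k, metricCoeff x₀ y l k * u k := by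
  simp [chartMetric_apply, metricCoeff_symm x₀ y l]

theorem chartMetric_pos [IsManifold (𝓡 n) ∞ M] {x₀ : M} {y : EuclideanSpace ℝ (Fin n)}
    (hy : y ∈ (extChartAt (𝓡 n) x₀).target) {u : EuclideanSpace ℝ (Fin n)} (hu : u ≠ 0) :
    0 < chartMetric x₀ y u u := by
  rw [chartMetric_eq_inner]
  refine real_inner_self_pos.2 fun h0 ↦ hu ?_
  exact (isInvertible_mfderiv_symm hy).injective (h0.trans (map_zero _).symm)

/-- A kernel vector of the Gram matrix would be null for a positive definite form. -/
theorem det_metricCoeff_ne_zero [IsManifold (𝓡 n) ∞ M] {x₀ : M} {y : EuclideanSpace ℝ (Fin n)}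
    (hy : y ∈ (extChartAt (𝓡 n) x₀).target) : (metricCoeff x₀ y).det ≠ 0 := by
  intro h0
  obtain ⟨v, hv, hv0⟩ := Matrix.exists_mulVec_eq_zero_iff.2 h0
  have h1 : (WithLp.toLp 2 v : EuclideanSpace ℝ (Fin n)) ≠ 0 := fun h ↦ hv (by simpa using h)
  refine (chartMetric_pos hy h1).ne' ?_
  rw [chartMetric_apply]
  have h2 : ∀ i, ∑ j, metricCoeff x₀ y i j * v j = 0 := fun i ↦ congrFun hv0 i
  calc ∑ i, ∑ j, metricCoeff x₀ y i j * v i * v j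
      = ∑ i, v i * ∑ j, metricCoeff x₀ y i j * v j := by
        refine Finset.sum_congr rfl fun i _ ↦ ?_
        rw [Finset.mul_sum]
        exact Finset.sum_congr rfl fun j _ ↦ by ring
    _ = 0 := by simp [h2]

/-- Lowering the upper index cancels the inverse matrix and leaves the Christoffel symbols of the
first kind, the form needed for metric compatibility. -/
theorem sum_metricCoeff_mul_christoffel [IsManifold (𝓡 n) ∞ M] {x₀ : M}
    {y : EuclideanSpace ℝ (Fin n)}
    (hy : y ∈ (extChartAt (𝓡 n) x₀).target) (i j l : Fin n) :
    ∑ k, metricCoeff x₀ y l k * christoffel x₀ k i j y =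
      (1 / 2 : ℝ) * (partialDeriv i (fun z ↦ metricCoeff x₀ z j l) y
        + partialDeriv j (fun z ↦ metricCoeff x₀ z i l) y
        - partialDeriv l (fun z ↦ metricCoeff x₀ z i j) y) := by
  set w : Fin n → ℝ := fun l ↦ partialDeriv i (fun z ↦ metricCoeff x₀ z j l) y
        + partialDeriv j (fun z ↦ metricCoeff x₀ z i l) y
        - partialDeriv l (fun z ↦ metricCoeff x₀ z i j) y with hw
  have h1 : ∀ k, christoffel x₀ k i j y = (1 / 2 : ℝ) * ((metricCoeff x₀ y)⁻¹.mulVec w) k :=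
    fun k ↦ rfl
  have h2 : (metricCoeff x₀ y).mulVec ((metricCoeff x₀ y)⁻¹.mulVec w) = w := by
    rw [Matrix.mulVec_mulVec, Matrix.mul_nonsing_inv _ (det_metricCoeff_ne_zero hy).isUnit,
      Matrix.one_mulVec]
  calc ∑ k, metricCoeff x₀ y l k * christoffel x₀ k i j y
      = (1 / 2 : ℝ) * ((metricCoeff x₀ y).mulVec ((metricCoeff x₀ y)⁻¹.mulVec w)) l := by
        rw [Matrix.mulVec, dotProduct, Finset.mul_sum]
        exact Finset.sum_congr rfl fun k _ ↦ by rw [h1]; ring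
    _ = _ := by rw [h2]

section Smooth

variable [IsManifold (𝓡 n) ∞ M] [IsContMDiffRiemannianBundle (𝓡 n) ∞ (EuclideanSpace ℝ (Fin n))
      (fun x : M ↦ TangentSpace (𝓡 n) x)]

/-- The coordinate field ∂ᵢ is the image of a constant section under the tangent map of the inverse
chart, hence smooth; the bundle metric is smooth on smooth sections. -/
theorem contDiffOn_metricCoeff (x₀ : M) (i j : Fin n) :
    ContDiffOn ℝ ∞ (fun y ↦ metricCoeff x₀ y i j) (extChartAt (𝓡 n) x₀).target := by
  have hopen := isOpen_extChartAt_target (I := 𝓡 n) x₀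
  have key : ∀ i : Fin n, ContMDiffOn (𝓡 n) ((𝓡 n).prod 𝓘(ℝ, EuclideanSpace ℝ (Fin n))) ∞
      (fun y ↦ (⟨(extChartAt (𝓡 n) x₀).symm y, mfderiv (𝓡 n) (𝓡 n) (extChartAt (𝓡 n) x₀).symm y
        (EuclideanSpace.single i (1 : ℝ))⟩ :
        TotalSpace (EuclideanSpace ℝ (Fin n)) (fun x : M ↦ TangentSpace (𝓡 n) x)))
      (extChartAt (𝓡 n) x₀).target := by
    intro i
    have h1 : ContMDiffOn (𝓡 n) (𝓡 n) ∞ (extChartAt (𝓡 n) x₀).symm (extChartAt (𝓡 n) x₀).target :=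
      contMDiffOn_extChartAt_symm x₀
    have h2 := h1.contMDiffOn_tangentMapWithin (m := ∞) (by simp) hopen.uniqueMDiffOn
    have h3 : ContMDiff (𝓡 n) (𝓡 n).tangent ∞ (fun y : EuclideanSpace ℝ (Fin n) ↦
        (⟨y, EuclideanSpace.single i (1 : ℝ)⟩ :
          TangentBundle (𝓡 n) (EuclideanSpace ℝ (Fin n)))) :=
      fun y ↦ contMDiffAt_vectorSpace_iff_contDiffAt.2 contDiffAt_const
    have h4 := h2.comp h3.contMDiffOn (s := (extChartAt (𝓡 n) x₀).target) (fun y hy ↦ hy)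
    refine h4.congr fun y hy ↦ ?_
    have h5 := mfderivWithin_of_isOpen (I := 𝓡 n) (I' := 𝓡 n) (f := (extChartAt (𝓡 n) x₀).symm)
      hopen hy
    exact congrArg (TotalSpace.mk ((extChartAt (𝓡 n) x₀).symm y))
      (congrArg (fun F ↦ F (EuclideanSpace.single i (1 : ℝ))) h5.symm)
  exact contMDiffOn_iff_contDiffOn.1 ((key i).inner_bundle (key j))

theorem contDiffOn_christoffel (x₀ : M) (k i j : Fin n) :
    ContDiffOn ℝ ∞ (christoffel x₀ k i j) (extChartAt (𝓡 n) x₀).target := by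
  have hopen := isOpen_extChartAt_target (I := 𝓡 n) x₀
  have hp : ∀ a b c : Fin n, ContDiffOn ℝ ∞ (partialDeriv a fun z ↦ metricCoeff x₀ z b c)
      (extChartAt (𝓡 n) x₀).target := fun a b c ↦
    contDiffOn_partialDeriv hopen (contDiffOn_metricCoeff x₀ b c) a
  refine contDiffOn_const.mul (ContDiffOn.sum fun l _ ↦ ?_)
  exact (ContDiffOn.matrix_inv_apply (contDiffOn_metricCoeff x₀)
    (fun y hy ↦ det_metricCoeff_ne_zero hy) k l).mul (((hp _ _ _).add (hp _ _ _)).sub (hp _ _ _))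

theorem contDiffOn_chartMetric (x₀ : M) :
    ContDiffOn ℝ ∞ (chartMetric x₀) (extChartAt (𝓡 n) x₀).target :=
  ContDiffOn.sum fun i _ ↦ ContDiffOn.sum fun j _ ↦
    (contDiffOn_metricCoeff x₀ i j).smul contDiffOn_const

theorem contDiffOn_chartGamma (x₀ : M) :
    ContDiffOn ℝ ∞ (chartGamma x₀) (extChartAt (𝓡 n) x₀).target :=
  ContDiffOn.sum fun k _ ↦ ContDiffOn.sum fun i _ ↦ ContDiffOn.sum fun j _ ↦
    (contDiffOn_christoffel x₀ k i j).smul contDiffOn_const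

end Smooth

end WeightedManifold

/-! ### Multilinearity of the curvature -/

section CurvatureLinear

variable {E : Type*} [NormedAddCommGroup E] [NormedSpace ℝ E] (Γ : E → E →L[ℝ] E →L[ℝ] E)
  (x u v w z : E) (c : ℝ)

theorem curvature_add_left :
    curvature Γ x (u + z) v w = curvature Γ x u v w + curvature Γ x z v w := by
  simp [curvature]; abel

theorem curvature_smul_left : curvature Γ x (c • u) v w = c • curvature Γ x u v w := by
  simp [curvature, smul_sub, smul_add]

theorem curvature_add_middle :
    curvature Γ x u (v + z) w = curvature Γ x u v w + curvature Γ x u z w := by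
  simp [curvature]; abel

theorem curvature_smul_middle : curvature Γ x u (c • v) w = c • curvature Γ x u v w := by
  simp [curvature, smul_sub, smul_add]

theorem curvature_add_right :
    curvature Γ x u v (w + z) = curvature Γ x u v w + curvature Γ x u v z := by
  simp [curvature]; abel

theorem curvature_smul_right : curvature Γ x u v (c • w) = c • curvature Γ x u v w := by
  simp [curvature, smul_sub, smul_add]

end CurvatureLinear

namespace WeightedManifold

attribute [local instance 5000] chartedSpaceSelf

/-- Reduces a multilinear identity to basis vectors one slot at a time; bare functions with
`IsLinearMap` avoid bundling the other slots. -/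
theorem eq_of_forall_single {n : ℕ} {F : Type*} [AddCommGroup F] [Module ℝ F]
    {A B : EuclideanSpace ℝ (Fin n) → F} (hA : IsLinearMap ℝ A) (hB : IsLinearMap ℝ B)
    (h : ∀ i, A (EuclideanSpace.single i 1) = B (EuclideanSpace.single i 1))
    (u : EuclideanSpace ℝ (Fin n)) : A u = B u := by
  have : hA.mk' A = hB.mk' B :=
    (EuclideanSpace.basisFun (Fin n) ℝ).toBasis.ext fun i ↦ by simpa using h i
  exact DFunLike.congr_fun this u

/-! ### The Levi-Civita property and the Ricci trace in a chart -/

section LeviCivita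

open Filter Topology

variable {n : ℕ} {M : Type*} [TopologicalSpace M] [ChartedSpace (EuclideanSpace ℝ (Fin n)) M]
  [RiemannianBundle (fun x : M ↦ TangentSpace (𝓡 n) x)]
  [IsManifold (𝓡 n) ∞ M] [IsContMDiffRiemannianBundle (𝓡 n) ∞ (EuclideanSpace ℝ (Fin n))
      (fun x : M ↦ TangentSpace (𝓡 n) x)]

theorem fderiv_chartMetric_single {x₀ : M} {y : EuclideanSpace ℝ (Fin n)}
    (hy : y ∈ (extChartAt (𝓡 n) x₀).target) (u : EuclideanSpace ℝ (Fin n)) (i j : Fin n) :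
    fderiv ℝ (chartMetric x₀) y u (EuclideanSpace.single i 1) (EuclideanSpace.single j 1) =
      fderiv ℝ (fun z ↦ metricCoeff x₀ z i j) y u := by
  have hd : HasFDerivAt (chartMetric x₀) (fderiv ℝ (chartMetric x₀) y) y :=
    (((contDiffOn_chartMetric x₀).contDiffAt ((isOpen_extChartAt_target x₀).mem_nhds hy)
      ).differentiableAt (by simp)).hasFDerivAt
  have h1 := (hd.clm_apply (hasFDerivAt_const (EuclideanSpace.single i (1 : ℝ)) y)).clm_apply
    (hasFDerivAt_const (EuclideanSpace.single j (1 : ℝ)) y)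
  simp only [← metricCoeff_eq_chartMetric] at h1
  rw [h1.fderiv]
  simp

theorem fderiv_chartGamma_single {x₀ : M} {y : EuclideanSpace ℝ (Fin n)}
    (hy : y ∈ (extChartAt (𝓡 n) x₀).target) (u : EuclideanSpace ℝ (Fin n)) (i j k : Fin n) :
    fderiv ℝ (chartGamma x₀) y u (EuclideanSpace.single i 1) (EuclideanSpace.single j 1) k =
      fderiv ℝ (christoffel x₀ k i j) y u := by
  have hd : HasFDerivAt (chartGamma x₀) (fderiv ℝ (chartGamma x₀) y) y :=
    (((contDiffOn_chartGamma x₀).contDiffAt ((isOpen_extChartAt_target x₀).mem_nhds hy)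
      ).differentiableAt (by simp)).hasFDerivAt
  have h1 := (EuclideanSpace.proj k : EuclideanSpace ℝ (Fin n) →L[ℝ] ℝ).hasFDerivAt.comp y
    ((hd.clm_apply (hasFDerivAt_const (EuclideanSpace.single i (1 : ℝ)) y)).clm_apply
      (hasFDerivAt_const (EuclideanSpace.single j (1 : ℝ)) y))
  have h2 : (christoffel x₀ k i j) = (EuclideanSpace.proj k : EuclideanSpace ℝ (Fin n) →L[ℝ] ℝ) ∘
      fun z ↦ chartGamma x₀ z (EuclideanSpace.single i 1) (EuclideanSpace.single j 1) :=
    funext fun z ↦ (chartGamma_single x₀ z i j k).symm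
  rw [h2, h1.fderiv]
  simp

/-- The Christoffel symbols define the Levi-Civita connection of the metric in the chart. -/
theorem isLeviCivita_chart (x₀ : M) :
    IsLeviCivita (extChartAt (𝓡 n) x₀).target (chartMetric x₀) (chartGamma x₀) where
  isOpen := isOpen_extChartAt_target x₀
  contDiffOn_metric := contDiffOn_chartMetric x₀
  contDiffOn_gamma := contDiffOn_chartGamma x₀
  metric_symm := fun y _ u v ↦ chartMetric_symm x₀ y u v
  metric_pos := fun y hy u hu ↦ chartMetric_pos hy hu
  gamma_symm := fun y _ u v ↦ by
    ext k
    rw [chartGamma_apply, chartGamma_apply, Finset.sum_comm]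
    refine Finset.sum_congr rfl fun j _ ↦ Finset.sum_congr rfl fun i _ ↦ ?_
    rw [christoffel_symm]
    ring
  compat := fun y hy u v w ↦ by
    revert u
    refine eq_of_forall_single ⟨by intros; simp, by intros; simp⟩
      ⟨by intros; simp; ring, by intros; simp; ring⟩ fun i ↦ ?_
    revert v
    refine eq_of_forall_single ⟨by intros; simp, by intros; simp⟩
      ⟨by intros; simp; ring, by intros; simp; ring⟩ fun j ↦ ?_
    revert w
    refine eq_of_forall_single ⟨by intros; simp, by intros; simp⟩
      ⟨by intros; simp; ring, by intros; simp; ring⟩ fun l ↦ ?_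
    rw [fderiv_chartMetric_single hy, chartMetric_symm x₀ y (EuclideanSpace.single j 1),
      chartMetric_single_right, chartMetric_single_right]
    simp only [chartGamma_single]
    -- Of the six derivatives in the two first-kind symbols, four cancel and the other two are both
    -- ½ ∂ᵢ gⱼₗ.
    rw [sum_metricCoeff_mul_christoffel hy, sum_metricCoeff_mul_christoffel hy]
    have h1 : (fun z ↦ metricCoeff x₀ z l j) = fun z ↦ metricCoeff x₀ z j l :=
      funext fun z ↦ metricCoeff_symm x₀ z l j
    rw [h1]
    simp only [partialDeriv]
    ring

/-- The Ricci tensor is the trace of the curvature. -/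
theorem sum_curvature_eq_ricciCoeff {x₀ : M} {y : EuclideanSpace ℝ (Fin n)}
    (hy : y ∈ (extChartAt (𝓡 n) x₀).target) (v w : EuclideanSpace ℝ (Fin n)) :
    ∑ k, curvature (chartGamma x₀) y (EuclideanSpace.single k 1) v w k =
      ∑ i, ∑ j, ricciCoeff x₀ i j y * w i * v j := by
  revert v
  refine eq_of_forall_single
    ⟨by intros; simp [curvature_add_middle, Finset.sum_add_distrib],
      by intros; simp [curvature_smul_middle, Finset.mul_sum]⟩
    ⟨by intros; simp [mul_add, Finset.sum_add_distrib],
      by intros; simp [Finset.mul_sum, mul_left_comm]⟩ fun j ↦ ?_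
  revert w
  refine eq_of_forall_single
    ⟨by intros; simp [curvature_add_right, Finset.sum_add_distrib],
      by intros; simp [curvature_smul_right, Finset.mul_sum]⟩
    ⟨by intros; simp [mul_add, Finset.sum_add_distrib],
      by intros; simp [Finset.mul_sum, mul_left_comm]⟩ fun i ↦ ?_
  have hs : ∀ a b c : Fin n, christoffel x₀ a b c = christoffel x₀ a c b := fun a b c ↦
    funext fun z ↦ christoffel_symm x₀ a b c z
  have hΓ : ∀ a b c k : Fin n, chartGamma x₀ y (EuclideanSpace.single a 1)
      (chartGamma x₀ y (EuclideanSpace.single b 1) (EuclideanSpace.single c 1)) k =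
        ∑ l, christoffel x₀ k a l y * christoffel x₀ l b c y := by
    intro a b c k
    rw [chartGamma_apply]
    simp [chartGamma_single]
  have h1 : ∑ a, ∑ b, ricciCoeff x₀ a b y *
      (EuclideanSpace.single i (1 : ℝ) : EuclideanSpace ℝ (Fin n)) a
      * (EuclideanSpace.single j (1 : ℝ) : EuclideanSpace ℝ (Fin n)) b = ricciCoeff x₀ i j y := by
    simp
  rw [h1]
  simp only [curvature, ricciCoeff, PiLp.sub_apply, PiLp.add_apply, fderiv_chartGamma_single hy, hΓ,
    ← Finset.sum_add_distrib, partialDeriv]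
  refine Finset.sum_congr rfl fun k _ ↦ ?_
  -- The trace of R(·, eⱼ)eᵢ has the terms of `ricciCoeff`, up to the order of the lower indices.
  rw [hs k j i, hs k k i, Finset.sum_sub_distrib]
  simp only [hs _ k i, hs _ j i]
  ring

end LeviCivita

/-! ### Transition maps as local isometries -/

section Transition

open Filter Topology

variable {n : ℕ} {M : Type*} [TopologicalSpace M] [ChartedSpace (EuclideanSpace ℝ (Fin n)) M]
  [IsManifold (𝓡 n) ∞ M]

/-- The coordinate change from the preferred chart at `x₀` to the one at `x₁`. -/
noncomputable def transition (x₀ x₁ : M) (y : EuclideanSpace ℝ (Fin n)) :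
    EuclideanSpace ℝ (Fin n) :=
  extChartAt (𝓡 n) x₁ ((extChartAt (𝓡 n) x₀).symm y)

variable {x₀ x₁ : M} {y : EuclideanSpace ℝ (Fin n)}

theorem contMDiffAt_symm (hy : y ∈ (extChartAt (𝓡 n) x₀).target) :
    ContMDiffAt (𝓡 n) (𝓡 n) ∞ (extChartAt (𝓡 n) x₀).symm y :=
  (contMDiffOn_extChartAt_symm x₀).contMDiffAt ((isOpen_extChartAt_target x₀).mem_nhds hy)

theorem hasMFDerivAt_symm (hy : y ∈ (extChartAt (𝓡 n) x₀).target) :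
    HasMFDerivAt (𝓡 n) (𝓡 n) (extChartAt (𝓡 n) x₀).symm y
      (mfderiv (𝓡 n) (𝓡 n) (extChartAt (𝓡 n) x₀).symm y) :=
  ((contMDiffAt_symm hy).mdifferentiableAt (by simp)).hasMFDerivAt

theorem contDiffAt_transition (hy : y ∈ (extChartAt (𝓡 n) x₀).target)
    (hy' : (extChartAt (𝓡 n) x₀).symm y ∈ (extChartAt (𝓡 n) x₁).source) :
    ContDiffAt ℝ ∞ (transition x₀ x₁) y := by
  rw [← contMDiffAt_iff_contDiffAt]
  exact (contMDiffAt_extChartAt' (by simpa using hy')).comp y (contMDiffAt_symm hy)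

theorem eventually_mem_symm_preimage (hy : y ∈ (extChartAt (𝓡 n) x₀).target)
    (hy' : (extChartAt (𝓡 n) x₀).symm y ∈ (extChartAt (𝓡 n) x₁).source) :
    ∀ᶠ z in 𝓝 y, z ∈ (extChartAt (𝓡 n) x₀).target ∧
      (extChartAt (𝓡 n) x₀).symm z ∈ (extChartAt (𝓡 n) x₁).source :=
  Filter.Eventually.and ((isOpen_extChartAt_target x₀).mem_nhds hy)
    ((contMDiffAt_symm hy).continuousAt.preimage_mem_nhds
      ((isOpen_extChartAt_source x₁).mem_nhds hy'))

/-- Near `y` the inverse chart at `x₀` is the inverse chart at `x₁` after the transition, so this is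
the chain rule. -/
theorem chartMetric_transition [RiemannianBundle (fun x : M ↦ TangentSpace (𝓡 n) x)]
    (hy : y ∈ (extChartAt (𝓡 n) x₀).target)
    (hy' : (extChartAt (𝓡 n) x₀).symm y ∈ (extChartAt (𝓡 n) x₁).source)
    (u v : EuclideanSpace ℝ (Fin n)) :
    chartMetric x₀ y u v = chartMetric x₁ (transition x₀ x₁ y)
      (fderiv ℝ (transition x₀ x₁) y u) (fderiv ℝ (transition x₀ x₁) y v) := by
  have hty : transition x₀ x₁ y ∈ (extChartAt (𝓡 n) x₁).target :=
    (extChartAt (𝓡 n) x₁).map_source hy'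
  have h1 : HasMFDerivAt (𝓡 n) (𝓡 n) (transition x₀ x₁) y (fderiv ℝ (transition x₀ x₁) y) :=
    (((contDiffAt_transition hy hy').differentiableAt (by simp)).hasFDerivAt).hasMFDerivAt
  have h2 := (hasMFDerivAt_symm hty).comp y h1
  have h3 : (extChartAt (𝓡 n) x₀).symm =ᶠ[𝓝 y]
      (extChartAt (𝓡 n) x₁).symm ∘ transition x₀ x₁ := by
    filter_upwards [eventually_mem_symm_preimage hy hy'] with z hz
    exact ((extChartAt (𝓡 n) x₁).left_inv hz.2).symm
  have h4 := hasMFDerivAt_unique (hasMFDerivAt_symm hy) (h2.congr_of_eventuallyEq h3)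
  have h5 : (extChartAt (𝓡 n) x₁).symm (transition x₀ x₁ y) = (extChartAt (𝓡 n) x₀).symm y :=
    (extChartAt (𝓡 n) x₁).left_inv hy'
  -- The two inner products live over base points that are equal only propositionally. Taking the
  -- base point as an argument and the vectors in ℝⁿ allows transport along `h5`.
  let Q : M → EuclideanSpace ℝ (Fin n) → EuclideanSpace ℝ (Fin n) → ℝ := fun x a b ↦
    inner ℝ (show TangentSpace (𝓡 n) x from a) (show TangentSpace (𝓡 n) x from b)
  let D : EuclideanSpace ℝ (Fin n) →L[ℝ] EuclideanSpace ℝ (Fin n) :=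
    mfderiv (𝓡 n) (𝓡 n) (extChartAt (𝓡 n) x₁).symm (transition x₀ x₁ y)
  rw [chartMetric_eq_inner, chartMetric_eq_inner, h4]
  exact congrArg (fun p ↦ Q p (D (fderiv ℝ (transition x₀ x₁) y u))
    (D (fderiv ℝ (transition x₀ x₁) y v))) h5.symm

/-- Preserving a positive definite form gives injectivity, and in finite dimension surjectivity
follows. -/
theorem surjective_fderiv_transition [RiemannianBundle (fun x : M ↦ TangentSpace (𝓡 n) x)]
    (hy : y ∈ (extChartAt (𝓡 n) x₀).target)
    (hy' : (extChartAt (𝓡 n) x₀).symm y ∈ (extChartAt (𝓡 n) x₁).source) :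
    Function.Surjective (fderiv ℝ (transition x₀ x₁) y) := by
  have hinj : Function.Injective 
      (fderiv ℝ (transition x₀ x₁) y).toLinearMap := by
    refine (injective_iff_map_eq_zero _).2 fun u hu ↦ ?_
    by_contra h0
    have h1 := chartMetric_pos hy h0
    rw [chartMetric_transition hy hy'] at h1
    have h2 : fderiv ℝ (transition x₀ x₁) y u = 0 := hu
    simp [h2] at h1
  exact LinearMap.injective_iff_surjective.1 hinj

variable [RiemannianBundle (fun x : M ↦ TangentSpace (𝓡 n) x)]
  [IsContMDiffRiemannianBundle (𝓡 n) ∞ (EuclideanSpace ℝ (Fin n))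
      (fun x : M ↦ TangentSpace (𝓡 n) x)]

theorem fderiv_transition_chartGamma (hy : y ∈ (extChartAt (𝓡 n) x₀).target)
    (hy' : (extChartAt (𝓡 n) x₀).symm y ∈ (extChartAt (𝓡 n) x₁).source)
    (u v : EuclideanSpace ℝ (Fin n)) :
    fderiv ℝ (transition x₀ x₁) y (chartGamma x₀ y u v) =
      chartGamma x₁ (transition x₀ x₁ y) (fderiv ℝ (transition x₀ x₁) y u)
        (fderiv ℝ (transition x₀ x₁) y v) +
      fderiv ℝ (fderiv ℝ (transition x₀ x₁)) y u v :=
  (isLeviCivita_chart x₀).fderiv_gamma_eq (isLeviCivita_chart x₁) hy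
    ((extChartAt (𝓡 n) x₁).map_source hy') (contDiffAt_transition hy hy')
    ((eventually_mem_symm_preimage hy hy').mono fun _ hz ↦ chartMetric_transition hz.1 hz.2)
    (surjective_fderiv_transition hy hy') u v

end Transition

/-! ### Distance bounded by length -/

section Length

open MeasureTheory

variable {n : ℕ} {M : Type*} [MetricSpace M]
  [ChartedSpace (EuclideanSpace ℝ (Fin n)) M]
  [RiemannianBundle (fun x : M ↦ TangentSpace (𝓡 n) x)] [IsRiemannianManifold (𝓡 n) M]

/-- The distance is the infimum of lengths. Since end points have measure zero, the speed bound is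
needed only on the open interval, where the derivative is two-sided. -/
theorem dist_le_integral_of_norm_mfderiv_le {c : ℝ → M} {F : ℝ → ℝ} {a b : ℝ} (hab : a ≤ b)
    (hc : ContMDiffOn 𝓘(ℝ, ℝ) (𝓡 n) 1 c (Icc a b)) (hF : ContinuousOn F (Icc a b))
    (hF0 : ∀ t ∈ Icc a b, 0 ≤ F t)
    (hle : ∀ t ∈ Ioo a b, ‖mfderiv 𝓘(ℝ, ℝ) (𝓡 n) c t (1 : ℝ)‖ ≤ F t) :
    dist (c a) (c b) ≤ ∫ t in a..b, F t := by
  have hF_int : 0 ≤ ∫ t in a..b, F t := intervalIntegral.integral_nonneg hab hF0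
  have h1 : edist (c a) (c b) ≤ pathELength (𝓡 n) c a b := by
    rw [IsRiemannianManifold.out (I := 𝓡 n) (c a) (c b)]
    exact riemannianEDist_le_pathELength hc rfl rfl hab
  have h2 : pathELength (𝓡 n) c a b ≤ ENNReal.ofReal (∫ t in a..b, F t) := by
    rw [pathELength_eq_lintegral_mfderiv_Ioo, intervalIntegral.integral_of_le hab,
      ← setIntegral_congr_set Ioo_ae_eq_Ioc,
      ofReal_integral_eq_lintegral_ofReal]
    · refine setLIntegral_mono' measurableSet_Ioo fun t ht ↦ ?_
      rw [← ofReal_norm]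
      exact ENNReal.ofReal_le_ofReal (hle t ht)
    · exact (hF.integrableOn_Icc).mono_set Ioo_subset_Icc_self
    · exact (ae_restrict_iff' measurableSet_Ioo).2
        (.of_forall fun t ht ↦ hF0 t ⟨ht.1.le, ht.2.le⟩)
  rw [dist_edist]
  exact ENNReal.toReal_le_of_le_ofReal hF_int (h1.trans h2)

/-- The length bound for a curve given in coordinates. Comparing squared speed with `F t ^ 2` means
no square root is ever expanded. -/
theorem dist_symm_le_integral [IsManifold (𝓡 n) ∞ M] {x₀ : M}
    {η η' : ℝ → EuclideanSpace ℝ (Fin n)} {F : ℝ → ℝ}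
    {a b : ℝ} (hab : a ≤ b) (hη : ∀ t ∈ Icc a b, HasDerivAt η (η' t) t)
    (hη' : ContinuousOn η' (Icc a b)) (hmem : ∀ t ∈ Icc a b, η t ∈ (extChartAt (𝓡 n) x₀).target)
    (hF : ContinuousOn F (Icc a b)) (hF0 : ∀ t ∈ Icc a b, 0 ≤ F t)
    (hle : ∀ t ∈ Icc a b, chartMetric x₀ (η t) (η' t) (η' t) ≤ F t ^ 2) :
    dist ((extChartAt (𝓡 n) x₀).symm (η a)) ((extChartAt (𝓡 n) x₀).symm (η b)) ≤
      ∫ t in a..b, F t := by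
  rcases hab.eq_or_lt with rfl | hlt
  · simp
  have hsm : ContDiffOn ℝ 1 η (Icc a b) := by
    rw [contDiffOn_one_iff_derivWithin (uniqueDiffOn_Icc hlt)]
    refine ⟨fun t ht ↦ (hη t ht).differentiableAt.differentiableWithinAt, hη'.congr fun t ht ↦ ?_⟩
    exact (hη t ht).hasDerivWithinAt.derivWithin (uniqueDiffOn_Icc hlt t ht)
  have hc : ContMDiffOn 𝓘(ℝ, ℝ) (𝓡 n) 1 ((extChartAt (𝓡 n) x₀).symm ∘ η) (Icc a b) :=
    (contMDiffOn_extChartAt_symm x₀).comp (contMDiffOn_iff_contDiffOn.2 hsm) hmem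
  refine dist_le_integral_of_norm_mfderiv_le hab hc hF hF0 fun t ht ↦ ?_
  have ht' : t ∈ Icc a b := ⟨ht.1.le, ht.2.le⟩
  have h1 : HasMFDerivAt 𝓘(ℝ, ℝ) (𝓡 n) η t (ContinuousLinearMap.toSpanSingleton ℝ (η' t)) :=
    (hη t ht').hasFDerivAt.hasMFDerivAt
  have h2 := ((hasMFDerivAt_symm (hmem t ht')).comp t h1).mfderiv
  have h3 : mfderiv 𝓘(ℝ, ℝ) (𝓡 n) ((extChartAt (𝓡 n) x₀).symm ∘ η) t (1 : ℝ) =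
      mfderiv (𝓡 n) (𝓡 n) (extChartAt (𝓡 n) x₀).symm (η t) (η' t) := by
    rw [h2]
    exact congrArg (mfderiv (𝓡 n) (𝓡 n) (extChartAt (𝓡 n) x₀).symm (η t)) (one_smul ℝ (η' t))
  have h4 := hle t ht'
  rw [chartMetric_eq_inner, ← h3] at h4
  have h5 : ‖mfderiv 𝓘(ℝ, ℝ) (𝓡 n) ((extChartAt (𝓡 n) x₀).symm ∘ η) t (1 : ℝ)‖ ^ 2 ≤ F t ^ 2 :=
    (real_inner_self_eq_norm_sq _).symm.le.trans h4
  exact (le_abs_self _).trans (abs_le_of_sq_le_sq h5 (hF0 t ht'))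

end Length

/-! ### Curves and Hessians in a chart -/

section GeodesicChart

open Filter Topology

variable {n : ℕ} {M : Type*} [TopologicalSpace M] [ChartedSpace (EuclideanSpace ℝ (Fin n)) M]

/-- The curve `γ` in the preferred chart at `x₀`. -/
noncomputable def chartCurve (n : ℕ) {M : Type*} [TopologicalSpace M]
    [ChartedSpace (EuclideanSpace ℝ (Fin n)) M] (x₀ : M) (γ : ℝ → M) (t : ℝ) :
    EuclideanSpace ℝ (Fin n) :=
  extChartAt (𝓡 n) x₀ (γ t)

theorem symm_chartCurve {x₀ : M} {γ : ℝ → M} {t : ℝ}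
    (hs : γ t ∈ (extChartAt (𝓡 n) x₀).source) :
    (extChartAt (𝓡 n) x₀).symm (chartCurve n x₀ γ t) = γ t :=
  (extChartAt (𝓡 n) x₀).left_inv hs

theorem chartCurve_mem_target {x₀ : M} {γ : ℝ → M} {t : ℝ}
    (hs : γ t ∈ (extChartAt (𝓡 n) x₀).source) :
    chartCurve n x₀ γ t ∈ (extChartAt (𝓡 n) x₀).target :=
  (extChartAt (𝓡 n) x₀).map_source hs

theorem eventually_mem_source {x₀ : M} {γ : ℝ → M} {t : ℝ} (hγ : ContinuousAt γ t)
    (hs : γ t ∈ (extChartAt (𝓡 n) x₀).source) :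
    ∀ᶠ s in 𝓝 t, γ s ∈ (extChartAt (𝓡 n) x₀).source :=
  hγ.preimage_mem_nhds ((isOpen_extChartAt_source x₀).mem_nhds hs)

theorem differential_mfderiv {γ : ℝ → M} {t : ℝ} (hγ : ContMDiffAt 𝓘(ℝ, ℝ) (𝓡 n) ∞ γ t)
    {f : M → ℝ} (hf : ContMDiff (𝓡 n) 𝓘(ℝ, ℝ) ∞ f) :
    differential f (γ t) (mfderiv 𝓘(ℝ, ℝ) (𝓡 n) γ t (1 : ℝ)) = deriv (f ∘ γ) t := by
  have h1 : HasMFDerivAt 𝓘(ℝ, ℝ) (𝓡 n) γ t (mfderiv 𝓘(ℝ, ℝ) (𝓡 n) γ t) :=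
    (hγ.mdifferentiableAt (by simp)).hasMFDerivAt
  have h2 : HasMFDerivAt (𝓡 n) 𝓘(ℝ, ℝ) f (γ t) (mfderiv (𝓡 n) 𝓘(ℝ, ℝ) f (γ t)) :=
    ((hf (γ t)).mdifferentiableAt (by simp)).hasMFDerivAt
  let A : ℝ →L[ℝ] EuclideanSpace ℝ (Fin n) := mfderiv 𝓘(ℝ, ℝ) (𝓡 n) γ t
  let B : EuclideanSpace ℝ (Fin n) →L[ℝ] ℝ := mfderiv (𝓡 n) 𝓘(ℝ, ℝ) f (γ t)
  have h3 : HasFDerivAt (f ∘ γ) (B.comp A) t := hasMFDerivAt_iff_hasFDerivAt.1 (h2.comp t h1)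
  exact h3.hasDerivAt.deriv.symm

variable [IsManifold (𝓡 n) ∞ M]

theorem contDiffAt_chartCurve {x₀ : M} {γ : ℝ → M} {t : ℝ}
    (hγ : ContMDiffAt 𝓘(ℝ, ℝ) (𝓡 n) ∞ γ t) (hs : γ t ∈ (extChartAt (𝓡 n) x₀).source) :
    ContDiffAt ℝ ∞ (chartCurve n x₀ γ) t := by
  rw [← contMDiffAt_iff_contDiffAt]
  exact (contMDiffAt_extChartAt' (by simpa using hs)).comp t hγ

theorem hasDerivAt_chartCurve {x₀ : M} {γ : ℝ → M} {t : ℝ}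
    (hγ : ContMDiffAt 𝓘(ℝ, ℝ) (𝓡 n) ∞ γ t) (hs : γ t ∈ (extChartAt (𝓡 n) x₀).source) :
    HasDerivAt (chartCurve n x₀ γ) (deriv (chartCurve n x₀ γ) t) t :=
  ((contDiffAt_chartCurve hγ hs).differentiableAt (by simp)).hasDerivAt

theorem differentiableAt_deriv_chartCurve {x₀ : M} {γ : ℝ → M} {t : ℝ}
    (hγ : ContMDiffAt 𝓘(ℝ, ℝ) (𝓡 n) ∞ γ t) (hs : γ t ∈ (extChartAt (𝓡 n) x₀).source) :
    DifferentiableAt ℝ (deriv (chartCurve n x₀ γ)) t :=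
  (((contDiffAt_chartCurve hγ hs).fderiv_right (m := 1) (by norm_cast)).clm_apply
    contDiffAt_const).differentiableAt (by simp)

/-- The velocity of a curve in terms of the velocity in a chart. -/
theorem mfderiv_curve_eq {x₀ : M} {γ : ℝ → M} {t : ℝ}
    (hγ : ContMDiffAt 𝓘(ℝ, ℝ) (𝓡 n) ∞ γ t) (hs : γ t ∈ (extChartAt (𝓡 n) x₀).source) :
    (mfderiv 𝓘(ℝ, ℝ) (𝓡 n) γ t (1 : ℝ) : EuclideanSpace ℝ (Fin n)) =
      mfderiv (𝓡 n) (𝓡 n) (extChartAt (𝓡 n) x₀).symm (chartCurve n x₀ γ t)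
        (deriv (chartCurve n x₀ γ) t) := by
  have h1 : HasMFDerivAt 𝓘(ℝ, ℝ) (𝓡 n) (chartCurve n x₀ γ) t
      (ContinuousLinearMap.toSpanSingleton ℝ (deriv (chartCurve n x₀ γ) t)) :=
    (hasDerivAt_chartCurve hγ hs).hasFDerivAt.hasMFDerivAt
  have h2 := (hasMFDerivAt_symm (chartCurve_mem_target hs)).comp t h1
  have h3 : γ =ᶠ[𝓝 t] (extChartAt (𝓡 n) x₀).symm ∘ chartCurve n x₀ γ := by
    filter_upwards [eventually_mem_source hγ.continuousAt hs] with s hs'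
    exact (symm_chartCurve hs').symm
  have h4 := (h2.congr_of_eventuallyEq h3).mfderiv
  rw [h4]
  exact congrArg (mfderiv (𝓡 n) (𝓡 n) (extChartAt (𝓡 n) x₀).symm (chartCurve n x₀ γ t))
    (one_smul ℝ (deriv (chartCurve n x₀ γ) t))

theorem chartMetric_deriv_chartCurve [RiemannianBundle (fun x : M ↦ TangentSpace (𝓡 n) x)]
    {x₀ : M} {γ : ℝ → M} {t : ℝ} (hγ : ContMDiffAt 𝓘(ℝ, ℝ) (𝓡 n) ∞ γ t)
    (hs : γ t ∈ (extChartAt (𝓡 n) x₀).source) :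
    chartMetric x₀ (chartCurve n x₀ γ t) (deriv (chartCurve n x₀ γ) t)
        (deriv (chartCurve n x₀ γ) t) =
      ‖mfderiv 𝓘(ℝ, ℝ) (𝓡 n) γ t (1 : ℝ)‖ ^ 2 := by
  let Q : M → EuclideanSpace ℝ (Fin n) → ℝ := fun x a ↦
    ‖(show TangentSpace (𝓡 n) x from a)‖ ^ 2
  rw [chartMetric_eq_inner]
  refine (real_inner_self_eq_norm_sq _).trans ?_
  change Q _ _ = Q _ _
  rw [mfderiv_curve_eq hγ hs, symm_chartCurve hs]
  rfl

theorem tangentCoord_mfderiv {γ : ℝ → M} {t : ℝ} (hγ : ContMDiffAt 𝓘(ℝ, ℝ) (𝓡 n) ∞ γ t) :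
    tangentCoord (γ t) (mfderiv 𝓘(ℝ, ℝ) (𝓡 n) γ t (1 : ℝ)) = deriv (chartCurve n (γ t) γ) t := by
  have h1 : HasMFDerivAt 𝓘(ℝ, ℝ) (𝓡 n) γ t (mfderiv 𝓘(ℝ, ℝ) (𝓡 n) γ t) :=
    (hγ.mdifferentiableAt (by simp)).hasMFDerivAt
  have h2 : HasMFDerivAt (𝓡 n) (𝓡 n) (extChartAt (𝓡 n) (γ t)) (γ t)
      (mfderiv (𝓡 n) (𝓡 n) (extChartAt (𝓡 n) (γ t)) (γ t)) :=
    (mdifferentiableAt_extChartAt (mem_chart_source _ _)).hasMFDerivAt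
  have h3 : HasMFDerivAt 𝓘(ℝ, ℝ) (𝓡 n) (chartCurve n (γ t) γ) t
      (ContinuousLinearMap.toSpanSingleton ℝ (deriv (chartCurve n (γ t) γ) t)) :=
    (hasDerivAt_chartCurve hγ (mem_extChartAt_source _)).hasFDerivAt.hasMFDerivAt
  have h4 := hasMFDerivAt_unique (h2.comp t h1) h3
  have h5 := congrArg (fun A : ℝ →L[ℝ] EuclideanSpace ℝ (Fin n) ↦ A 1) h4
  exact h5.trans (one_smul ℝ _)

variable [RiemannianBundle (fun x : M ↦ TangentSpace (𝓡 n) x)]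

/-- The form D²F(w, w) - DF(Γ(w, w)) is what the chain rule yields for (f ∘ γ)'' once γ'' is
replaced by -Γ(γ', γ'). -/
theorem hessian_eq_fderiv {f : M → ℝ} (hf : ContMDiff (𝓡 n) 𝓘(ℝ, ℝ) ∞ f) (x : M)
    (v : TangentSpace (𝓡 n) x) :
    hessian f x v v =
      fderiv ℝ (fderiv ℝ (f ∘ (extChartAt (𝓡 n) x).symm)) (extChartAt (𝓡 n) x x)
        (tangentCoord x v) (tangentCoord x v) -
      fderiv ℝ (f ∘ (extChartAt (𝓡 n) x).symm) (extChartAt (𝓡 n) x x)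
        (chartGamma x (extChartAt (𝓡 n) x x) (tangentCoord x v) (tangentCoord x v)) := by
  set F := f ∘ (extChartAt (𝓡 n) x).symm with hF
  set y := extChartAt (𝓡 n) x x
  set w := tangentCoord x v
  have hy : y ∈ (extChartAt (𝓡 n) x).target := mem_extChartAt_target x
  have hFs : ContDiffAt ℝ ∞ F y := by
    rw [← contMDiffAt_iff_contDiffAt]
    exact (hf _).comp y (contMDiffAt_symm hy)
  have hF2 : HasFDerivAt (fderiv ℝ F) (fderiv ℝ (fderiv ℝ F) y) y :=
    ((hFs.fderiv_right (m := 1) (by norm_cast)).differentiableAt (by simp)).hasFDerivAt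
  have h1 : ∀ i j : Fin n, partialDeriv i (partialDeriv j F) y =
      fderiv ℝ (fderiv ℝ F) y (EuclideanSpace.single i 1) (EuclideanSpace.single j 1) := by
    intro i j
    have := (hF2.clm_apply (hasFDerivAt_const (EuclideanSpace.single j (1 : ℝ)) y)).fderiv
    change fderiv ℝ (fun z ↦ fderiv ℝ F z (EuclideanSpace.single j 1)) y _ = _
    rw [this]
    simp
  have hw : w = ∑ i, w i • EuclideanSpace.single i (1 : ℝ) := by
    simpa using ((EuclideanSpace.basisFun (Fin n) ℝ).sum_repr w).symm
  have h2 : fderiv ℝ (fderiv ℝ F) y w w =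
      ∑ i, ∑ j, partialDeriv i (partialDeriv j F) y * w i * w j := by
    have h3 : ∀ B : EuclideanSpace ℝ (Fin n) →L[ℝ] EuclideanSpace ℝ (Fin n) →L[ℝ] ℝ,
        B w w = ∑ i, ∑ j,
          B (EuclideanSpace.single i 1) (EuclideanSpace.single j 1) * w i * w j := by
      intro B
      conv_lhs => rw [hw]
      simp only [map_sum, map_smul, sum_apply, smul_apply, smul_eq_mul, Finset.mul_sum]
      rw [Finset.sum_comm]
      exact Finset.sum_congr rfl fun i _ ↦ Finset.sum_congr rfl fun j _ ↦ by ring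
    rw [h3]
    simp only [h1]
  have h4 : fderiv ℝ F y (chartGamma x y w w) =
      ∑ i, ∑ j, (∑ k, christoffel x k i j y * partialDeriv k F y) * w i * w j := by
    rw [fderiv_apply_eq_sum]
    simp only [chartGamma_apply, Finset.sum_mul]
    rw [Finset.sum_comm]
    refine Finset.sum_congr rfl fun i _ ↦ ?_
    rw [Finset.sum_comm]
    exact Finset.sum_congr rfl fun j _ ↦ Finset.sum_congr rfl fun k _ ↦ by ring
  rw [h2, h4, hessian]
  simp only [hessianCoeff, sub_mul, Finset.sum_sub_distrib]
  rfl

end GeodesicChart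

/-! ### The geodesic equation -/

section Geodesic

open Filter Topology

theorem velocity_eq {n : ℕ} {M : Type*} [TopologicalSpace M]
    [ChartedSpace (EuclideanSpace ℝ (Fin n)) M] {L : ℝ} {γ : ℝ → M} {t : ℝ} (ht : t ∈ Ioo 0 L) :
    velocity n L γ t = mfderiv 𝓘(ℝ, ℝ) (𝓡 n) γ t (1 : ℝ) := by
  rw [velocity, mfderivWithin_of_mem_nhds (Icc_mem_nhds ht.1 ht.2)]

variable {n : ℕ} {M : Type*} [TopologicalSpace M] [ChartedSpace (EuclideanSpace ℝ (Fin n)) M]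
  [RiemannianBundle (fun x : M ↦ TangentSpace (𝓡 n) x)]

namespace IsUnitSpeedGeodesic

variable {L : ℝ} {γ : ℝ → M} {t : ℝ}

theorem contMDiffAt (hγ : IsUnitSpeedGeodesic n L γ) (ht : t ∈ Ioo 0 L) :
    ContMDiffAt 𝓘(ℝ, ℝ) (𝓡 n) ∞ γ t :=
  hγ.smooth.contMDiffAt (Icc_mem_nhds ht.1 ht.2)

theorem norm_mfderiv (hγ : IsUnitSpeedGeodesic n L γ) (ht : t ∈ Ioo 0 L) :
    ‖mfderiv 𝓘(ℝ, ℝ) (𝓡 n) γ t (1 : ℝ)‖ = 1 := by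
  rw [← velocity_eq ht]
  exact hγ.unit_speed t ⟨ht.1.le, ht.2.le⟩

variable [IsManifold (𝓡 n) ∞ M]

theorem chartMetric_eq_one (hγ : IsUnitSpeedGeodesic n L γ) (ht : t ∈ Ioo 0 L) {x₀ : M}
    (hs : γ t ∈ (extChartAt (𝓡 n) x₀).source) :
    chartMetric x₀ (chartCurve n x₀ γ t) (deriv (chartCurve n x₀ γ) t)
      (deriv (chartCurve n x₀ γ) t) = 1 := by
  rw [chartMetric_deriv_chartCurve (hγ.contMDiffAt ht) hs, hγ.norm_mfderiv ht, one_pow]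

/-- The definition gives the equation at time `t` only, componentwise, in the chart centred at `γ
t`, and with derivatives within `[0, L]`; at interior times these are ordinary derivatives. -/
theorem hasDerivAt_deriv_self (hγ : IsUnitSpeedGeodesic n L γ) (ht : t ∈ Ioo 0 L) :
    HasDerivAt (deriv (chartCurve n (γ t) γ))
      (-chartGamma (γ t) (chartCurve n (γ t) γ t) (deriv (chartCurve n (γ t) γ) t)
        (deriv (chartCurve n (γ t) γ) t)) t := by
  have hsm := hγ.contMDiffAt ht
  have hs : γ t ∈ (extChartAt (𝓡 n) (γ t)).source := mem_extChartAt_source _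
  have hnh : Icc 0 L ∈ 𝓝 t := Icc_mem_nhds ht.1 ht.2
  have hd2 := (differentiableAt_deriv_chartCurve hsm hs).hasDerivAt
  refine hd2.congr_deriv ?_
  ext k
  have hcoord : ∀ {c : ℝ → EuclideanSpace ℝ (Fin n)} {c' : EuclideanSpace ℝ (Fin n)} {s : ℝ},
      HasDerivAt c c' s → HasDerivAt (fun r ↦ c r k) (c' k) s := fun {c c' s} h ↦
    (EuclideanSpace.proj k : EuclideanSpace ℝ (Fin n) →L[ℝ] ℝ).hasFDerivAt.comp_hasDerivAt s h
  have hev : ∀ᶠ s in 𝓝 t, derivWithin (fun r ↦ chartCurve n (γ t) γ r k) (Icc 0 L) s =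
      deriv (chartCurve n (γ t) γ) s k := by
    filter_upwards [eventually_mem_source hsm.continuousAt hs, Ioo_mem_nhds ht.1 ht.2]
      with s hs1 hs2
    rw [derivWithin_of_mem_nhds (Icc_mem_nhds hs2.1 hs2.2)]
    exact (hcoord (hasDerivAt_chartCurve (hγ.contMDiffAt hs2) hs1)).deriv
  have h1 : iteratedDerivWithin 2 (fun s ↦ extChartAt (𝓡 n) (γ t) (γ s) k) (Icc 0 L) t =
      deriv (deriv (chartCurve n (γ t) γ)) t k := by
    rw [iteratedDerivWithin_succ, derivWithin_of_mem_nhds hnh]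
    refine Eq.trans (Filter.EventuallyEq.deriv_eq ?_) (hcoord hd2).deriv
    filter_upwards [hev] with s hs'
    rw [iteratedDerivWithin_one]
    exact hs'
  have h2 : ∀ i, derivWithin (fun s ↦ extChartAt (𝓡 n) (γ t) (γ s) i) (Icc 0 L) t =
      deriv (chartCurve n (γ t) γ) t i := fun i ↦ by
    rw [derivWithin_of_mem_nhds hnh]
    exact ((EuclideanSpace.proj i : EuclideanSpace ℝ (Fin n) →L[ℝ] ℝ).hasFDerivAt.comp_hasDerivAt t
      (hasDerivAt_chartCurve hsm hs)).deriv
  have h3 := hγ.geodesic_eq t ⟨ht.1.le, ht.2.le⟩ k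
  rw [h1] at h3
  simp only [h2] at h3
  rw [PiLp.neg_apply, chartGamma_apply]
  exact eq_neg_of_add_eq_zero_left h3

/-- The derivative of `f ∘ γ` has derivative `Hess f (γ', γ')`. -/
theorem hasDerivAt_deriv_comp (hγ : IsUnitSpeedGeodesic n L γ) (ht : t ∈ Ioo 0 L) {f : M → ℝ}
    (hf : ContMDiff (𝓡 n) 𝓘(ℝ, ℝ) ∞ f) :
    HasDerivAt (deriv (f ∘ γ)) (hessian f (γ t) (velocity n L γ t) (velocity n L γ t)) t := by
  have hsm := hγ.contMDiffAt ht
  have hs : γ t ∈ (extChartAt (𝓡 n) (γ t)).source := mem_extChartAt_source _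
  rw [hessian_eq_fderiv hf, velocity_eq ht, tangentCoord_mfderiv hsm]
  set F := f ∘ (extChartAt (𝓡 n) (γ t)).symm with hF
  set x := chartCurve n (γ t) γ with hx
  have hFs : ∀ y ∈ (extChartAt (𝓡 n) (γ t)).target, ContDiffAt ℝ ∞ F y := fun y hy ↦ by
    rw [← contMDiffAt_iff_contDiffAt]
    exact (hf _).comp y (contMDiffAt_symm hy)
  have hxt : x t = extChartAt (𝓡 n) (γ t) (γ t) := rfl
  have hF2 : HasFDerivAt (fderiv ℝ F) (fderiv ℝ (fderiv ℝ F) (x t)) (x t) :=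
    (((hFs _ (chartCurve_mem_target hs)).fderiv_right (m := 1) (by norm_cast)).differentiableAt
      (by simp)).hasFDerivAt
  have h1 := (hF2.comp_hasDerivAt t (hasDerivAt_chartCurve hsm hs)).clm_apply
    (hγ.hasDerivAt_deriv_self ht)
  have hfγ : ∀ᶠ s in 𝓝 t, f ∘ γ =ᶠ[𝓝 s] F ∘ x := by
    filter_upwards [(eventually_mem_source hsm.continuousAt hs).eventually_nhds] with s hs'
    filter_upwards [hs'] with r hr
    exact (congrArg f (symm_chartCurve hr)).symm
  have h2 : deriv (f ∘ γ) =ᶠ[𝓝 t] fun s ↦ fderiv ℝ F (x s) (deriv x s) := by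
    filter_upwards [hfγ, eventually_mem_source hsm.continuousAt hs, Ioo_mem_nhds ht.1 ht.2]
      with s h1 h2 h3
    rw [h1.deriv_eq]
    exact ((((hFs _ (chartCurve_mem_target h2)).differentiableAt
      (by simp)).hasFDerivAt).comp_hasDerivAt s
        (hasDerivAt_chartCurve (hγ.contMDiffAt h3) h2)).deriv
  refine (h1.congr_of_eventuallyEq h2).congr_deriv ?_
  rw [← hxt]
  simp [← hx, sub_eq_add_neg]

variable [IsContMDiffRiemannianBundle (𝓡 n) ∞ (EuclideanSpace ℝ (Fin n))
      (fun x : M ↦ TangentSpace (𝓡 n) x)]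

/-- The geodesic equation holds in every chart. -/
theorem hasDerivAt_deriv (hγ : IsUnitSpeedGeodesic n L γ) (ht : t ∈ Ioo 0 L) {x₀ : M}
    (hs : γ t ∈ (extChartAt (𝓡 n) x₀).source) :
    HasDerivAt (deriv (chartCurve n x₀ γ))
      (-chartGamma x₀ (chartCurve n x₀ γ t) (deriv (chartCurve n x₀ γ) t)
        (deriv (chartCurve n x₀ γ) t)) t := by
  have hsm := hγ.contMDiffAt ht
  have hs0 : γ t ∈ (extChartAt (𝓡 n) (γ t)).source := mem_extChartAt_source _
  have hy := chartCurve_mem_target hs0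
  have hy' : (extChartAt (𝓡 n) (γ t)).symm (chartCurve n (γ t) γ t) ∈
      (extChartAt (𝓡 n) x₀).source := by rwa [symm_chartCurve hs0]
  set τ := transition (n := n) (γ t) x₀ with hτ
  have hev : ∀ᶠ s in 𝓝 t, chartCurve n x₀ γ s = τ (chartCurve n (γ t) γ s) := by
    filter_upwards [eventually_mem_source hsm.continuousAt hs0] with s hs'
    exact (congrArg (extChartAt (𝓡 n) x₀) (symm_chartCurve hs')).symm
  have hder : deriv (chartCurve n x₀ γ) =ᶠ[𝓝 t]
      fun s ↦ fderiv ℝ τ (chartCurve n (γ t) γ s) (deriv (chartCurve n (γ t) γ) s) := by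
    filter_upwards [hev.eventually_nhds, eventually_mem_source hsm.continuousAt hs0,
      eventually_mem_source hsm.continuousAt hs, Ioo_mem_nhds ht.1 ht.2] with s h1 h2 h3 h4
    rw [Filter.EventuallyEq.deriv_eq h1]
    have h5 : (extChartAt (𝓡 n) (γ t)).symm (chartCurve n (γ t) γ s) ∈
        (extChartAt (𝓡 n) x₀).source := by rwa [symm_chartCurve h2]
    exact (((contDiffAt_transition (chartCurve_mem_target h2) h5).differentiableAt
      (by simp)).hasFDerivAt.comp_hasDerivAt s
        (hasDerivAt_chartCurve (hγ.contMDiffAt h4) h2)).deriv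
  have h1 := hasDerivAt_fderiv_comp (contDiffAt_transition hy hy')
    (hasDerivAt_chartCurve hsm hs0) (hγ.hasDerivAt_deriv_self ht)
  refine (h1.congr_of_eventuallyEq hder).congr_deriv ?_
  -- The second derivative of the transition map from the chain rule cancels the inhomogeneous term
  -- of the transformation law.
  rw [hder.self_of_nhds, map_neg, fderiv_transition_chartGamma hy hy', hev.self_of_nhds]
  simp [hτ]

/-- The Ricci curvature in the direction of the geodesic as a trace in the preferred chart. -/
theorem ricci_eq_sum_curvature  (hγ : IsUnitSpeedGeodesic n L γ) (ht : t ∈ Ioo 0 L) :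
    ricci (γ t) (velocity n L γ t) (velocity n L γ t) =
      ∑ k, curvature (chartGamma (γ t)) (chartCurve n (γ t) γ t) (EuclideanSpace.single k 1)
          (deriv (chartCurve n (γ t) γ) t) (deriv (chartCurve n (γ t) γ) t) k := by
  rw [sum_curvature_eq_ricciCoeff (chartCurve_mem_target (mem_extChartAt_source _)), ricci,
    velocity_eq ht, tangentCoord_mfderiv (hγ.contMDiffAt ht)]
  rfl

end IsUnitSpeedGeodesic

end Geodesic

/-! ### Second order bounds on the distance, and change of chart -/

section SecondOrder

open Filter Topology

variable {n : ℕ} {M : Type*} [MetricSpace M] [ChartedSpace (EuclideanSpace ℝ (Fin n)) M]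
  [RiemannianBundle (fun x : M ↦ TangentSpace (𝓡 n) x)]

/-- The distance from `p` to the curve with initial velocity `v` and vanishing initial
acceleration at the point with coordinates `y` in the preferred chart at `x₀` is at most
`ℓ + k s² / 2 + o(s²)`. -/
def SecondOrderBound (p : M) (ℓ : ℝ) (x₀ : M) (y v : EuclideanSpace ℝ (Fin n)) (k : ℝ) : Prop :=
  ∀ ε > 0, ∀ᶠ s in 𝓝 (0 : ℝ),
    dist p ((extChartAt (𝓡 n) x₀).symm (jetCurve (chartGamma x₀) y v s)) ≤ ℓ + s ^ 2 / 2 * (k + ε)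

/-- There is an orthonormal frame at `γ b` (in the preferred chart at `x₀`) containing the velocity
of `γ` such that the second order bounds in the directions `r eᵢ` normal to `γ` add up to at most
`K`. -/
def NormalBound (p : M) (ℓ : ℝ) (γ : ℝ → M) (r : ℝ) (j₀ : Fin n) (x₀ : M) (b K : ℝ) : Prop :=
  ∃ (e : Fin n → EuclideanSpace ℝ (Fin n)) (k : Fin n → ℝ),
    (∀ i j, chartMetric x₀ (chartCurve n x₀ γ b) (e i) (e j) = if i = j then 1 else 0) ∧
    e j₀ = deriv (chartCurve n x₀ γ) b ∧
    (∀ i, i ≠ j₀ → SecondOrderBound p ℓ x₀ (chartCurve n x₀ γ b) (r • e i) (k i)) ∧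
    ∑ i ∈ Finset.univ.erase j₀, k i ≤ K

theorem NormalBound.mono {p : M} {ℓ : ℝ} {γ : ℝ → M} {r : ℝ} {j₀ : Fin n} {x₀ : M} {b K K' : ℝ}
    (h : NormalBound p ℓ γ r j₀ x₀ b K) (hK : K ≤ K') : NormalBound p ℓ γ r j₀ x₀ b K' := by
  obtain ⟨e, k, h1, h2, h3, h4⟩ := h
  exact ⟨e, k, h1, h2, h3, h4.trans hK⟩

variable [IsManifold (𝓡 n) ∞ M] [IsContMDiffRiemannianBundle (𝓡 n) ∞ (EuclideanSpace ℝ (Fin n))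
      (fun x : M ↦ TangentSpace (𝓡 n) x)] [IsRiemannianManifold (𝓡 n) M]

/-- The inverse chart is locally Lipschitz: segments in a small ball have controlled length. This
turns o(s²) in coordinates into o(s²) in distance. -/
theorem exists_eventually_dist_symm_le {x₀ : M} {y : EuclideanSpace ℝ (Fin n)}
    (hy : y ∈ (extChartAt (𝓡 n) x₀).target) :
    ∃ C > 0, ∃ r > 0, ∀ z ∈ Metric.ball y r, ∀ w ∈ Metric.ball y r,
      dist ((extChartAt (𝓡 n) x₀).symm z) ((extChartAt (𝓡 n) x₀).symm w) ≤ C * ‖w - z‖ := by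
  set K : ℝ := ‖chartMetric x₀ y‖ + 1 with hK
  -- Makes `K ≤ K ^ 2`, so `K * ‖w - z‖` can serve as the speed bound.
  have hK1 : 1 ≤ K := by have := norm_nonneg (chartMetric x₀ y); linarith
  have hc := (isLeviCivita_chart x₀).contDiffAt_metric hy |>.continuousAt
  have h1 : ∀ᶠ z in 𝓝 y, ‖chartMetric x₀ z‖ < K :=
    hc.norm.eventually_lt continuousAt_const (by rw [hK]; linarith)
  obtain ⟨r, hr, H⟩ := Metric.eventually_nhds_iff_ball.1
    (h1.and ((isOpen_extChartAt_target (I := 𝓡 n) x₀).mem_nhds hy))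
  refine ⟨K, by linarith, r, hr, fun z hz w hw ↦ ?_⟩
  have hmem : ∀ t ∈ Icc (0 : ℝ) 1, z + t • (w - z) ∈ Metric.ball y r := fun t ht ↦
    (convex_ball y r).add_smul_sub_mem hz hw ht
  have hd : ∀ t : ℝ, HasDerivAt (fun t : ℝ ↦ z + t • (w - z)) (w - z) t := fun t ↦ by
    simpa using ((hasDerivAt_id t).smul_const (w - z)).const_add z
  have := dist_symm_le_integral (x₀ := x₀) (η := fun t : ℝ ↦ z + t • (w - z))
    (η' := fun _ ↦ w - z) (F := fun _ ↦ K * ‖w - z‖) zero_le_one (fun t _ ↦ hd t)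
    continuousOn_const (fun t ht ↦ (H _ (hmem t ht)).2) continuousOn_const
    (fun _ _ ↦ by positivity) (fun t ht ↦ by
      have h2 := (H _ (hmem t ht)).1
      calc chartMetric x₀ (z + t • (w - z)) (w - z) (w - z)
          ≤ ‖chartMetric x₀ (z + t • (w - z)) (w - z) (w - z)‖ := le_abs_self _
        _ ≤ ‖chartMetric x₀ (z + t • (w - z))‖ * ‖w - z‖ * ‖w - z‖ :=
          ContinuousLinearMap.le_opNorm₂ _ _ _
        _ ≤ K * ‖w - z‖ * ‖w - z‖ := by gcongr
        _ ≤ (K * ‖w - z‖) ^ 2 := by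
          have h3 : 0 ≤ ‖w - z‖ * ‖w - z‖ := by positivity
          nlinarith)
  simpa using this

theorem hasDerivAt_jetCurve_param {E : Type*} [NormedAddCommGroup E] [NormedSpace ℝ E]
    (Γ : E → E →L[ℝ] E →L[ℝ] E) (x v : E) (s : ℝ) :
    HasDerivAt (jetCurve Γ x v) (v + s • (-Γ x v v)) s :=
  hasDerivAt_quadratic x v _ s

/-- Second order bounds do not depend on the chart. -/
theorem SecondOrderBound.transition {p : M} {ℓ : ℝ} {x₀ x₁ : M} {y v : EuclideanSpace ℝ (Fin n)}
    {k : ℝ} (h : SecondOrderBound p ℓ x₀ y v k) (hy : y ∈ (extChartAt (𝓡 n) x₀).target)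
    (hy' : (extChartAt (𝓡 n) x₀).symm y ∈ (extChartAt (𝓡 n) x₁).source) :
    SecondOrderBound p ℓ x₁ (WeightedManifold.transition x₀ x₁ y)
      (fderiv ℝ (WeightedManifold.transition x₀ x₁) y v) k := by
  intro ε hε
  set τ := WeightedManifold.transition (n := n) x₀ x₁ with hτ
  set c := jetCurve (chartGamma x₀) y v with hc
  set d := jetCurve (chartGamma x₁) (τ y) (fderiv ℝ τ y v) with hd
  have hty : τ y ∈ (extChartAt (𝓡 n) x₁).target := (extChartAt (𝓡 n) x₁).map_source hy'
  have hc0 : c 0 = y := jetCurve_zero _ _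
  have hd0 : d 0 = τ y := jetCurve_zero _ _
  have hcd : ∀ s, HasDerivAt c (v + s • (-chartGamma x₀ y v v)) s :=
    hasDerivAt_jetCurve_param _ _ _
  have hdd := hasDerivAt_jetCurve_param (chartGamma x₁) (τ y) (fderiv ℝ τ y v)
  have hct : Tendsto c (𝓝 0) (𝓝 y) := by simpa [hc0] using (hcd 0).continuousAt.tendsto
  have hdt : Tendsto d (𝓝 0) (𝓝 (τ y)) := by simpa [hd0] using (hdd 0).continuousAt.tendsto
  have hlin : ∀ a b : EuclideanSpace ℝ (Fin n), HasDerivAt (fun r : ℝ ↦ a + r • b) b 0 :=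
    fun a b ↦ by simpa using ((hasDerivAt_id (0 : ℝ)).smul_const b).const_add a
  have hev := hct.eventually (eventually_mem_symm_preimage hy hy')
  obtain ⟨C, hC, r, hr, hLip⟩ := exists_eventually_dist_symm_le hty
  -- The parabola in the new chart and the image of the old one share their 2-jet at 0, by the
  -- transformation law. The constant makes the error C · ε/(4C) · s² = (s²/2)(ε/2).
  have hjet := eventually_norm_le_sq_of_jet_eq_zero (f := fun s ↦ d s - τ (c s))
    (f' := fun s ↦ (fderiv ℝ τ y v + s • (-chartGamma x₁ (τ y) (fderiv ℝ τ y v) (fderiv ℝ τ y v)))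
      - fderiv ℝ τ (c s) (v + s • (-chartGamma x₀ y v v)))
    (by simp [hc0, hd0]) (by simp [hc0])
    (hev.mono fun s hs ↦ (hdd s).fun_sub
      (((contDiffAt_transition hs.1 hs.2).differentiableAt
        (by simp)).hasFDerivAt.comp_hasDerivAt s (hcd s)))
    (by
      have h1 := hasDerivAt_fderiv_comp (τ := τ) (c := c)
        (c' := fun s : ℝ ↦ v + s • (-chartGamma x₀ y v v)) (t := 0)
        (by rw [hc0]; exact contDiffAt_transition hy hy') (hcd 0) (hlin v (-chartGamma x₀ y v v))
      refine ((hlin _ _).fun_sub h1).congr_deriv ?_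
      simp only [hc0, zero_smul, add_zero, map_neg]
      rw [hτ, fderiv_transition_chartGamma hy hy']
      abel) (ε := ε / (4 * C)) (by positivity)
  have hτc : Tendsto (fun s ↦ τ (c s)) (𝓝 0) (𝓝 (τ y)) :=
    (contDiffAt_transition hy hy').continuousAt.tendsto.comp hct
  filter_upwards [h (ε / 2) (by positivity), hev, hjet, hτc.eventually (Metric.ball_mem_nhds _ hr),
    hdt.eventually (Metric.ball_mem_nhds _ hr)] with s h1 h2 h3 h4 h5
  have h6 := hLip _ h4 _ h5
  have h7 : (extChartAt (𝓡 n) x₁).symm (τ (c s)) = (extChartAt (𝓡 n) x₀).symm (c s) :=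
    (extChartAt (𝓡 n) x₁).left_inv h2.2
  rw [h7] at h6
  calc dist p ((extChartAt (𝓡 n) x₁).symm (d s))
      ≤ dist p ((extChartAt (𝓡 n) x₀).symm (c s)) +
        dist ((extChartAt (𝓡 n) x₀).symm (c s)) ((extChartAt (𝓡 n) x₁).symm (d s)) :=
        dist_triangle _ _ _
    _ ≤ (ℓ + s ^ 2 / 2 * (k + ε / 2)) + C * (ε / (4 * C) * s ^ 2) := by
      gcongr; exact h6.trans (by gcongr)
    _ = ℓ + s ^ 2 / 2 * (k + ε) := by field_simp; ring

/-- Bounds in normal directions do not depend on the chart. -/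
theorem NormalBound.transition {p : M} {ℓ : ℝ} {γ : ℝ → M} {r : ℝ} {j₀ : Fin n} {x₀ x₁ : M}
    {b K : ℝ} (h : NormalBound p ℓ γ r j₀ x₀ b K) (hγ : ContMDiffAt 𝓘(ℝ, ℝ) (𝓡 n) ∞ γ b)
    (h₀ : γ b ∈ (extChartAt (𝓡 n) x₀).source) (h₁ : γ b ∈ (extChartAt (𝓡 n) x₁).source) :
    NormalBound p ℓ γ r j₀ x₁ b K := by
  obtain ⟨e, k, he, hj, hb, hk⟩ := h
  have hy := chartCurve_mem_target h₀
  have hy' : (extChartAt (𝓡 n) x₀).symm (chartCurve n x₀ γ b) ∈ (extChartAt (𝓡 n) x₁).source := by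
    rwa [symm_chartCurve h₀]
  have hτ : chartCurve n x₁ γ b = WeightedManifold.transition x₀ x₁ (chartCurve n x₀ γ b) :=
    (congrArg (extChartAt (𝓡 n) x₁) (symm_chartCurve h₀)).symm
  refine ⟨fun i ↦ fderiv ℝ (WeightedManifold.transition x₀ x₁) (chartCurve n x₀ γ b) (e i), k,
    fun i j ↦ ?_, ?_, fun i hi ↦ ?_, hk⟩
  · rw [hτ, ← chartMetric_transition hy hy', he]
  · have hev : chartCurve n x₁ γ =ᶠ[𝓝 b]
        fun s ↦ WeightedManifold.transition x₀ x₁ (chartCurve n x₀ γ s) := by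
      filter_upwards [eventually_mem_source hγ.continuousAt h₀] with s hs
      exact (congrArg (extChartAt (𝓡 n) x₁) (symm_chartCurve hs)).symm
    beta_reduce
    rw [hev.deriv_eq, hj]
    exact ((((contDiffAt_transition hy hy').differentiableAt
      (by simp)).hasFDerivAt).comp_hasDerivAt b (hasDerivAt_chartCurve hγ h₀)).deriv.symm
  · have := (hb i hi).transition hy hy'
    rw [map_smul] at this
    rwa [hτ]

end SecondOrder

end WeightedManifold

/-! ### Continuity of curvature along curves -/

section CurvatureContinuity

variable {E : Type*} [NormedAddCommGroup E] [NormedSpace ℝ E] {U : Set E}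
  {g : E → E →L[ℝ] E →L[ℝ] ℝ} {Γ : E → E →L[ℝ] E →L[ℝ] E}

theorem curvature_self (x u w : E) : curvature Γ x u u w = 0 := by
  simp [curvature]

theorem IsLeviCivita.continuousAt_curvature_comp (h : IsLeviCivita U g Γ) {Y : Type*}
    [TopologicalSpace Y] {X u v w : Y → E} {y : Y} (hX : ContinuousAt X y) (hy : X y ∈ U)
    (hu : ContinuousAt u y) (hv : ContinuousAt v y) (hw : ContinuousAt w y) :
    ContinuousAt (fun p ↦ curvature Γ (X p) (u p) (v p) (w p)) y := by
  have h2 := h.continuousAt_gamma_comp hX hy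
  have h3 := h.continuousAt_fderiv_gamma_comp hX hy
  have h4 := ((h3.clm_apply hu).clm_apply hv).clm_apply hw
  have h5 := ((h3.clm_apply hv).clm_apply hu).clm_apply hw
  have h6 := (h2.clm_apply hu).clm_apply ((h2.clm_apply hv).clm_apply hw)
  have h7 := (h2.clm_apply hv).clm_apply ((h2.clm_apply hu).clm_apply hw)
  exact ((h4.sub h5).add h6).sub h7

theorem IsLeviCivita.continuousAt_jetCurveDeriv (h : IsLeviCivita U g Γ) {x v T v' : ℝ → E}
    {t : ℝ} (hx : ContinuousAt x t) (ht : x t ∈ U) (hv : ContinuousAt v t)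
    (hT : ContinuousAt T t) (hv' : ContinuousAt v' t) (s : ℝ) :
    ContinuousAt (fun r ↦ jetCurveDeriv Γ (x r) (v r) (T r) (v' r) s) t := by
  have h2 := h.continuousAt_gamma_comp hx ht
  have h3 := h.continuousAt_fderiv_gamma_comp hx ht
  have h4 := ((h3.clm_apply hT).clm_apply hv).clm_apply hv
  have h5 := (h2.clm_apply hv').clm_apply hv
  have h6 := (h2.clm_apply hv).clm_apply hv'
  exact (hT.add (hv'.const_smul s)).add (((h4.add h5).add h6).neg.const_smul (s ^ 2 / 2))

end CurvatureContinuity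

namespace WeightedManifold

attribute [local instance 5000] chartedSpaceSelf

/-! ### Propagation of bounds inside one chart -/

section Step

open Filter Topology

variable {n : ℕ} {M : Type*} [MetricSpace M] [ChartedSpace (EuclideanSpace ℝ (Fin n)) M]
  [RiemannianBundle (fun x : M ↦ TangentSpace (𝓡 n) x)]
  [IsManifold (𝓡 n) ∞ M] [IsContMDiffRiemannianBundle (𝓡 n) ∞ (EuclideanSpace ℝ (Fin n))
      (fun x : M ↦ TangentSpace (𝓡 n) x)]

theorem continuousAt_secondVariation {x₀ : M} {x T e : ℝ → EuclideanSpace ℝ (Fin n)}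
    {φ φ' : ℝ → ℝ} {t : ℝ} (hx : ContinuousAt x t) (hxU : x t ∈ (extChartAt (𝓡 n) x₀).target)
    (hT : ContinuousAt T t) (he : ContinuousAt e t) (hφ : ContinuousAt φ t)
    (hφ' : ContinuousAt φ' t) :
    ContinuousAt (fun t ↦ φ' t ^ 2 - φ t ^ 2 * chartMetric x₀ (x t)
        (curvature (chartGamma x₀) (x t) (e t) (T t) (T t)) (e t)) t := by
  have hLC := isLeviCivita_chart (n := n) x₀
  have h1 := hLC.continuousAt_metric_comp hx hxU
  have h2 := hLC.continuousAt_curvature_comp hx hxU he hT hT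
  exact (hφ'.pow 2).sub ((hφ.pow 2).mul ((h1.clm_apply h2).clm_apply he))

variable [IsRiemannianManifold (𝓡 n) M]

/-- Propagation of a second order bound along a unit speed curve in a chart, in the direction of
a multiple of a normal parallel unit field `e`. -/
theorem SecondOrderBound.step {p : M} {ℓ : ℝ} {x₀ : M} {x T e : ℝ → EuclideanSpace ℝ (Fin n)}
    {φ φ' : ℝ → ℝ} {J : Set ℝ} (hxU : ∀ t ∈ J, x t ∈ (extChartAt (𝓡 n) x₀).target)
    (hx : ∀ t ∈ J, HasDerivAt x (T t) t) (hT : ∀ t ∈ J, ContinuousAt T t)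
    (he : ∀ t ∈ J, HasDerivAt e (-chartGamma x₀ (x t) (T t) (e t)) t)
    (hφ : ∀ t, HasDerivAt φ (φ' t) t) (hφ' : Continuous φ')
    (hTT : ∀ t ∈ J, chartMetric x₀ (x t) (T t) (T t) = 1)
    (hee : ∀ t ∈ J, chartMetric x₀ (x t) (e t) (e t) = 1)
    (heT : ∀ t ∈ J, chartMetric x₀ (x t) (e t) (T t) = 0) {a b : ℝ} (hab : a ≤ b)
    (hJ : Icc a b ⊆ J) {k : ℝ} (h : SecondOrderBound p ℓ x₀ (x a) (φ a • e a) k) :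
    SecondOrderBound p (ℓ + (b - a)) x₀ (x b) (φ b • e b)
      (k + ∫ t in a..b, (φ' t ^ 2 - φ t ^ 2 * chartMetric x₀ (x t)
        (curvature (chartGamma x₀) (x t) (e t) (T t) (T t)) (e t))) := by
  intro ε hε
  have hLC := isLeviCivita_chart (n := n) x₀
  set q : ℝ → ℝ := fun t ↦ φ' t ^ 2 - φ t ^ 2 * chartMetric x₀ (x t)
        (curvature (chartGamma x₀) (x t) (e t) (T t) (T t)) (e t) with hq
  have hφc : Continuous φ := continuous_iff_continuousAt.2 fun t ↦ (hφ t).continuousAt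
  have hqc : ContinuousOn q (Icc a b) := fun t ht ↦ by
    have ht := hJ ht
    exact (continuousAt_secondVariation (hx t ht).continuousAt (hxU t ht) (hT t ht)
      (he t ht).continuousAt hφc.continuousAt hφ'.continuousAt).continuousWithinAt
  -- Chosen so that ε₂(b - a) ≤ ε/2; the added 1 covers a = b.
  set ε₂ : ℝ := ε / (2 * (b - a + 1)) with hε₂
  have hba : 0 ≤ b - a := sub_nonneg.2 hab
  have hε₂0 : 0 < ε₂ := by positivity
  have hε₂1 : ε₂ * (b - a) ≤ ε / 2 := by
    rw [hε₂, div_mul_eq_mul_div, div_le_div_iff₀ (by positivity) (by positivity)]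
    nlinarith
  obtain ⟨C, hC⟩ := isCompact_Icc.exists_bound_of_continuousOn hqc
  have hC0 : 0 ≤ C := (norm_nonneg _).trans (hC a ⟨le_rfl, hab⟩)
  -- Keeps the comparison speed 1 + (s²/2)(q + ε₂) nonnegative.
  have hsmall : ∀ᶠ s in 𝓝 (0 : ℝ), s ^ 2 / 2 * C < 1 :=
    ContinuousAt.eventually_lt (by fun_prop) continuousAt_const (by simp)
  filter_upwards [h (ε / 2) (by positivity), hsmall, hLC.eventually_sq_speed_le hxU hx hT he
    (fun t ↦ hφ'.continuousAt) (fun t ↦ hφc.continuousAt) hTT hee heT hJ hε₂0] with s h1 h2 h3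
  have hF : ContinuousOn (fun t ↦ 1 + s ^ 2 / 2 * (q t + ε₂)) (Icc a b) := by fun_prop
  have hv : ∀ t ∈ J, HasDerivAt (fun t ↦ φ t • e t)
      (φ' t • e t - φ t • chartGamma x₀ (x t) (T t) (e t)) t := fun t ht ↦
    ((hφ t).smul (he t ht)).congr_deriv (by rw [smul_neg]; abel)
  have hdist := dist_symm_le_integral hab
    (fun t ht ↦ hLC.hasDerivAt_jetCurve (hxU t (hJ ht)) (hx t (hJ ht)) (hv t (hJ ht)) s)
    (fun t ht ↦ (hLC.continuousAt_jetCurveDeriv (hx t (hJ ht)).continuousAt (hxU t (hJ ht))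
      (hv t (hJ ht)).continuousAt (hT t (hJ ht))
      ((hφ'.continuousAt.smul (he t (hJ ht)).continuousAt).sub (hφc.continuousAt.smul
        (((hLC.continuousAt_gamma_comp (hx t (hJ ht)).continuousAt (hxU t (hJ ht))).clm_apply
          (hT t (hJ ht))).clm_apply (he t (hJ ht)).continuousAt))) s).continuousWithinAt)
    (fun t ht ↦ (h3 t ht).1) hF
    (fun t ht ↦ by
      have h4 : -C ≤ q t := neg_le_of_abs_le (hC t ht)
      have h5 : s ^ 2 / 2 * (-C) ≤ s ^ 2 / 2 * (q t + ε₂) :=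
        mul_le_mul_of_nonneg_left (by linarith) (by positivity)
      linarith)
    -- This is 1 + 2x ≤ (1 + x)² with x = (s²/2)(q + ε₂).
    (fun t ht ↦ (h3 t ht).2.trans (by
      change 1 + s ^ 2 * (q t + ε₂) ≤ (1 + s ^ 2 / 2 * (q t + ε₂)) ^ 2
      nlinarith [sq_nonneg (s ^ 2 / 2 * (q t + ε₂))]))
  have hF_int : ∫ t in a..b, (1 + s ^ 2 / 2 * (q t + ε₂)) =
      (b - a) + s ^ 2 / 2 * ((∫ t in a..b, q t) + ε₂ * (b - a)) := by
    have hqi : IntervalIntegrable q MeasureTheory.volume a b :=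
      (hqc.mono (uIcc_of_le hab).le).intervalIntegrable
    rw [intervalIntegral.integral_add (by simp) ((hqi.add (by simp)).const_mul _),
      intervalIntegral.integral_const_mul, intervalIntegral.integral_add hqi (by simp)]
    simp only [intervalIntegral.integral_const, smul_eq_mul, mul_one]
    ring
  rw [hF_int] at hdist
  refine (dist_triangle _ _ _).trans ((add_le_add h1 hdist).trans ?_)
  have h6 : s ^ 2 / 2 * (ε₂ * (b - a)) ≤ s ^ 2 / 2 * (ε / 2) := by gcongr
  linarith

/-- Propagation of a normal bound along a geodesic in a chart. -/
theorem NormalBound.exists_step {L t₀ C : ℝ} {γ : ℝ → M} (hγ : IsUnitSpeedGeodesic n L γ)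
    (ht₀ : t₀ ∈ Ioo 0 L) {φ φ' : ℝ → ℝ} (hφ : ∀ t, HasDerivAt φ (φ' t) t) (hφ' : Continuous φ')
    (hC : (n - 1) * φ' t₀ ^ 2 -
      φ t₀ ^ 2 * ricci (γ t₀) (velocity n L γ t₀) (velocity n L γ t₀) < C) :
    ∃ δ > 0, ∀ a ∈ Ioo (t₀ - δ) (t₀ + δ), ∀ b ∈ Ioo (t₀ - δ) (t₀ + δ), a ≤ b →
      ∀ (p : M) (ℓ K : ℝ) (j₀ : Fin n), NormalBound p ℓ γ (φ a) j₀ (γ t₀) a K →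
        NormalBound p (ℓ + (b - a)) γ (φ b) j₀ (γ t₀) b (K + C * (b - a)) := by
  set x₀ := γ t₀ with hx₀
  set x := chartCurve n x₀ γ with hx
  set T := deriv x with hTdef
  have hLC := isLeviCivita_chart (n := n) x₀
  have hs₀ : γ t₀ ∈ (extChartAt (𝓡 n) x₀).source := mem_extChartAt_source _
  have hφc : Continuous φ := continuous_iff_continuousAt.2 fun t ↦ (hφ t).continuousAt
  have hgood : ∀ᶠ t in 𝓝 t₀, t ∈ Ioo 0 L ∧ γ t ∈ (extChartAt (𝓡 n) x₀).source :=
    (isOpen_Ioo.eventually_mem ht₀).and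
      (eventually_mem_source (hγ.contMDiffAt ht₀).continuousAt hs₀)
  have hxd : ∀ t, t ∈ Ioo 0 L ∧ γ t ∈ (extChartAt (𝓡 n) x₀).source → HasDerivAt x (T t) t :=
    fun t ht ↦ hasDerivAt_chartCurve (hγ.contMDiffAt ht.1) ht.2
  have hTd : ∀ t, t ∈ Ioo 0 L ∧ γ t ∈ (extChartAt (𝓡 n) x₀).source →
      HasDerivAt T (-chartGamma x₀ (x t) (T t) (T t)) t :=
    fun t ht ↦ hγ.hasDerivAt_deriv ht.1 ht.2
  have hxU : ∀ t, t ∈ Ioo 0 L ∧ γ t ∈ (extChartAt (𝓡 n) x₀).source →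
      x t ∈ (extChartAt (𝓡 n) x₀).target := fun t ht ↦ chartCurve_mem_target ht.2
  obtain ⟨δ₁, hδ₁, hpar⟩ := exists_forall_hasDerivAt_linear
    (A := fun t ↦ -chartGamma x₀ (x t) (T t)) (t₀ := t₀) (hgood.mono fun t ht ↦
      ((hLC.continuousAt_gamma_comp (hxd t ht).continuousAt (hxU t ht)).clm_apply
        (hTd t ht).continuousAt).neg)
  -- `ricci` uses a chart that moves with the point. Written in the fixed chart at `γ t₀`, the rate
  -- is visibly continuous, and it agrees with the given one at `t₀`.
  set ψ : ℝ → ℝ := fun t ↦ (n - 1) * φ' t ^ 2 - φ t ^ 2 *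
    ∑ k, curvature (chartGamma x₀) (x t) (EuclideanSpace.single k 1) (T t) (T t) k with hψ
  have hψc : ContinuousAt ψ t₀ := by
    refine (continuousAt_const.mul (hφ'.continuousAt.pow 2)).sub ((hφc.continuousAt.pow 2).mul ?_)
    refine tendsto_finsetSum _ fun k _ ↦ ?_
    have h1 := hLC.continuousAt_curvature_comp (hxd t₀ ⟨ht₀, hs₀⟩).continuousAt
      (hxU t₀ ⟨ht₀, hs₀⟩) (continuousAt_const (y := EuclideanSpace.single k (1 : ℝ)))
      (hTd t₀ ⟨ht₀, hs₀⟩).continuousAt (hTd t₀ ⟨ht₀, hs₀⟩).continuousAt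
    exact ((EuclideanSpace.proj k : EuclideanSpace ℝ (Fin n) →L[ℝ] ℝ).continuous.tendsto _).comp h1
  have hψC : ∀ᶠ t in 𝓝 t₀, ψ t < C := by
    refine hψc.eventually_lt continuousAt_const ?_
    rw [hγ.ricci_eq_sum_curvature ht₀] at hC
    exact hC
  obtain ⟨δ₂, hδ₂, hball⟩ := Metric.eventually_nhds_iff_ball.1 (hgood.and hψC)
  rw [Real.ball_eq_Ioo] at hball
  set J := Ioo (t₀ - min δ₁ δ₂) (t₀ + min δ₁ δ₂) with hJ
  have hJ1 : J ⊆ Ioo (t₀ - δ₁) (t₀ + δ₁) :=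
    Ioo_subset_Ioo (by linarith [min_le_left δ₁ δ₂]) (by linarith [min_le_left δ₁ δ₂])
  have hJ2 : ∀ t ∈ J, (t ∈ Ioo 0 L ∧ γ t ∈ (extChartAt (𝓡 n) x₀).source) ∧ ψ t < C := fun t ht ↦
    hball t (Ioo_subset_Ioo (by linarith [min_le_right δ₁ δ₂]) (by linarith [min_le_right δ₁ δ₂])
      ht)
  refine ⟨min δ₁ δ₂, lt_min hδ₁ hδ₂, fun a ha b hb hab p ℓ K j₀ ⟨e, k, he, hj, hk, hK⟩ ↦ ?_⟩
  have hab' : Icc a b ⊆ J := fun t ht ↦ ⟨ha.1.trans_le ht.1, ht.2.trans_lt hb.2⟩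
  -- The velocity of a geodesic is parallel, so `T` itself continues `e j₀`; the other fields then
  -- stay normal to γ.
  have hex : ∀ i, ∃ Y : ℝ → EuclideanSpace ℝ (Fin n), Y a = e i ∧
      (∀ t ∈ J, HasDerivAt Y (-chartGamma x₀ (x t) (T t) (Y t)) t) ∧ (i = j₀ → Y = T) := by
    intro i
    by_cases hi : i = j₀
    · exact ⟨T, by rw [hi, hj], fun t ht ↦ hTd t (hJ2 t ht).1, fun _ ↦ rfl⟩
    · obtain ⟨Y, hY1, hY2⟩ := hpar a (hJ1 ha) (e i)
      exact ⟨Y, hY1, fun t ht ↦ hY2 t (hJ1 ht), fun h ↦ absurd h hi⟩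
  choose Y hYa hYd hYT using hex
  have hYT := hYT j₀ rfl
  have horth : ∀ t ∈ J, ∀ i j, chartMetric x₀ (x t) (Y i t) (Y j t) = if i = j then 1 else 0 :=
    fun t ht i j ↦ by
      rw [hLC.metric_parallel_eq (fun r hr ↦ hxU r (hJ2 r hr).1) (fun r hr ↦ hxd r (hJ2 r hr).1)
        (hYd i) (hYd j) ha ht, hYa, hYa, he]
  set q : Fin n → ℝ → ℝ := fun i t ↦ φ' t ^ 2 - φ t ^ 2 * chartMetric x₀ (x t)
    (curvature (chartGamma x₀) (x t) (Y i t) (T t) (T t)) (Y i t) with hq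
  have hqi : ∀ i, IntervalIntegrable (q i) MeasureTheory.volume a b := fun i ↦ by
    refine ContinuousOn.intervalIntegrable fun t ht ↦ ?_
    rw [uIcc_of_le hab] at ht
    have ht' := hab' ht
    exact (continuousAt_secondVariation (hxd t (hJ2 t ht').1).continuousAt (hxU t (hJ2 t ht').1)
      (hTd t (hJ2 t ht').1).continuousAt (hYd i t ht').continuousAt hφc.continuousAt
      hφ'.continuousAt).continuousWithinAt
  -- The full trace is the Ricci term. Dropping `j₀` changes nothing there, since R(T, T) = 0, but
  -- removes one copy of φ'², which gives the factor n - 1.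
  have hsum : ∀ t ∈ J, ∑ i ∈ Finset.univ.erase j₀, q i t = ψ t := fun t ht ↦ by
    have h1 := sum_apply_orthonormal_eq_sum_coord (horth t ht)
      (IsLinearMap.mk' (fun u ↦ curvature (chartGamma x₀) (x t) u (T t) (T t))
        ⟨fun u v ↦ curvature_add_left _ _ _ _ _ _, fun c u ↦ curvature_smul_left _ _ _ _ _ _⟩)
    simp only [IsLinearMap.mk'_apply] at h1
    rw [Finset.sum_erase_eq_sub (Finset.mem_univ _)]
    simp only [hq, hψ, Finset.sum_sub_distrib, ← Finset.mul_sum, h1, hYT, curvature_self]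
    simp
    ring
  refine ⟨fun i ↦ Y i b, fun i ↦ k i + ∫ t in a..b, q i t, horth b hb, congrFun hYT b,
    fun i hi ↦ ?_, ?_⟩
  · refine SecondOrderBound.step (J := J) (fun r hr ↦ hxU r (hJ2 r hr).1)
      (fun r hr ↦ hxd r (hJ2 r hr).1) (fun r hr ↦ (hTd r (hJ2 r hr).1).continuousAt) (hYd i) hφ hφ'
      (fun r hr ↦ hγ.chartMetric_eq_one (hJ2 r hr).1.1 (hJ2 r hr).1.2)
      (fun r hr ↦ by rw [horth r hr, if_pos rfl])
      (fun r hr ↦ by rw [← hYT, horth r hr, if_neg hi]) hab hab' ?_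
    rw [hYa]
    exact hk i hi
  · rw [Finset.sum_add_distrib, ← intervalIntegral.integral_finsetSum fun i _ ↦ hqi i]
    refine add_le_add hK ?_
    have h1 : ∫ t in a..b, ∑ i ∈ Finset.univ.erase j₀, q i t ≤ ∫ t in a..b, C :=
      intervalIntegral.integral_mono_on hab
        (by rw [← Finset.sum_fn]; exact IntervalIntegrable.sum _ fun i _ ↦ hqi i)
        (by simp) fun t ht ↦ by rw [hsum t (hab' ht)]; exact (hJ2 t (hab' ht)).2.le
    simpa [mul_comm] using h1

end Step

end WeightedManifold

/-! ### From local rates to an interval -/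

section Induction

open Filter Topology

/-- If a predicate `P t K`, monotone in `K`, propagates near each `t` with rate `> ψ t`, and
`ψ ≤ H'`, then it propagates from `A` to `B` with gain `H B - H A + ε (B - A)`. -/
theorem propagate_of_local_rate {P : ℝ → ℝ → Prop} (hmono : ∀ t K K', K ≤ K' → P t K → P t K')
    {A B : ℝ} (hAB : A ≤ B) {H h ψ : ℝ → ℝ} (hH : ∀ t ∈ Icc A B, HasDerivAt H (h t) t)
    (hψ : ∀ t ∈ Icc A B, ψ t ≤ h t)
    (hP : ∀ t ∈ Icc A B, ∀ C > ψ t, ∃ δ > 0, ∀ a ∈ Ioo (t - δ) (t + δ),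
      ∀ b ∈ Ioo (t - δ) (t + δ), a ≤ b → ∀ K, P a K → P b (K + C * (b - a)))
    {K : ℝ} (h0 : P A K) {ε : ℝ} (hε : 0 < ε) : P B (K + (H B - H A) + ε * (B - A)) := by
  set S : ℝ → Prop := fun b ↦ P b (K + (H b - H A) + ε * (b - A)) with hS
  -- Moving up to `t` from the left shows that the supremum belongs to the set; moving right from
  -- `t` shows that it cannot lie below `B`.
  have hstep : ∀ t ∈ Icc A B, ∃ δ > 0, (∀ a ∈ Ioc (t - δ) t, S a → S t) ∧
      ∀ b ∈ Ico t (t + δ), S t → S b := by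
    intro t ht
    -- Half of ε gives a rate strictly above `ψ t`; the other half absorbs the first order error of
    -- `H`.
    obtain ⟨δ₁, hδ₁, h1⟩ := hP t ht (h t + ε / 2) (by linarith [hψ t ht])
    have h2 := (hasDerivAt_iff_isLittleO.1 (hH t ht)).bound (half_pos hε)
    obtain ⟨δ₂, hδ₂, h3⟩ := Metric.eventually_nhds_iff_ball.1 h2
    rw [Real.ball_eq_Ioo] at h3
    have hd : 0 < min δ₁ δ₂ := lt_min hδ₁ hδ₂
    have e1 := min_le_left δ₁ δ₂
    have e2 := min_le_right δ₁ δ₂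
    refine ⟨min δ₁ δ₂, hd, fun a ha hSa ↦ ?_, fun b hb hSt ↦ ?_⟩
    · refine hmono _ _ _ ?_ (h1 a ⟨by linarith [ha.1], by linarith [ha.2]⟩ t
        ⟨by linarith, by linarith⟩ ha.2 _ hSa)
      have h4 := h3 a ⟨by linarith [ha.1], by linarith [ha.2]⟩
      rw [smul_eq_mul, Real.norm_eq_abs, Real.norm_eq_abs, abs_of_nonpos (sub_nonpos.2 ha.2)] at h4
      have h5 := (abs_le.1 h4).2
      nlinarith
    · refine hmono _ _ _ ?_ (h1 t ⟨by linarith, by linarith⟩ b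
        ⟨by linarith [hb.1], by linarith [hb.2]⟩ hb.1 _ hSt)
      have h4 := h3 b ⟨by linarith [hb.1], by linarith [hb.2]⟩
      rw [smul_eq_mul, Real.norm_eq_abs, Real.norm_eq_abs, abs_of_nonneg (sub_nonneg.2 hb.1)] at h4
      have h5 := (abs_le.1 h4).1
      nlinarith
  set s : Set ℝ := {b | b ∈ Icc A B ∧ S b} with hs
  have hA : A ∈ s := ⟨⟨le_rfl, hAB⟩, by simpa [hS] using h0⟩
  have hbdd : BddAbove s := ⟨B, fun b hb ↦ hb.1.2⟩
  have hσ : sSup s ∈ Icc A B := ⟨le_csSup hbdd hA, csSup_le ⟨A, hA⟩ fun b hb ↦ hb.1.2⟩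
  obtain ⟨δ, hδ, h1, h2⟩ := hstep _ hσ
  obtain ⟨a, ha, haσ⟩ := exists_lt_of_lt_csSup ⟨A, hA⟩ (sub_lt_self (sSup s) hδ)
  have hSσ : S (sSup s) := h1 a ⟨haσ, le_csSup hbdd ha⟩ ha.2
  rcases hσ.2.eq_or_lt with hB | hB
  · rwa [hB] at hSσ
  · exfalso
    have hm : sSup s < min B (sSup s + δ / 2) := lt_min hB (by linarith)
    refine hm.not_ge (le_csSup hbdd ⟨⟨hσ.1.trans hm.le, min_le_left _ _⟩, h2 _ ⟨hm.le, ?_⟩ hSσ⟩)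
    linarith [min_le_right B (sSup s + δ / 2)]

end Induction

/-- Extend the unit vector `D T` to an orthonormal basis of `V` and pull it back. `V` will be a
tangent space with its Riemannian inner product. -/
theorem exists_orthonormal_pullback {n : ℕ} {V : Type*} [NormedAddCommGroup V]
    [InnerProductSpace ℝ V] (D : EuclideanSpace ℝ (Fin n) ≃ₗ[ℝ] V) (j₀ : Fin n)
    {T : EuclideanSpace ℝ (Fin n)} (hT : inner ℝ (D T) (D T) = 1) :
    ∃ e : Fin n → EuclideanSpace ℝ (Fin n),
      (∀ i j, inner ℝ (D (e i)) (D (e j)) = if i = j then 1 else 0) ∧ e j₀ = T := by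
  have : FiniteDimensional ℝ V := D.finiteDimensional
  have hcard : Module.finrank ℝ V = Fintype.card (Fin n) := by
    rw [← D.finrank_eq]; simp
  have ho : Orthonormal ℝ (({j₀} : Set (Fin n)).domRestrict fun _ ↦ D T) := by
    refine ⟨fun i ↦ ?_, fun i j hij ↦ (hij (Subsingleton.elim _ _)).elim⟩
    rw [real_inner_self_eq_norm_sq] at hT
    exact (pow_eq_one_iff_of_nonneg (norm_nonneg _) two_ne_zero).1 hT
  obtain ⟨b, hb⟩ := ho.exists_orthonormalBasis_extension_of_card_eq hcard
  refine ⟨fun i ↦ D.symm (b i), fun i j ↦ ?_, ?_⟩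
  · simpa using orthonormal_iff_ite.1 b.orthonormal i j
  · simp [hb j₀ rfl]

namespace WeightedManifold

attribute [local instance 5000] chartedSpaceSelf

/-! ### The summed second variation inequality -/

section SecondVariation

open Filter Topology

/-- For zero velocity the curve is constant, so ℓ ≤ ℓ + (s²/2)(k + ε); divide by s²/2 with s > 0.
Minimality of the geodesic enters through `hℓ`. -/
theorem SecondOrderBound.nonneg {n : ℕ} {M : Type*} [MetricSpace M]
    [ChartedSpace (EuclideanSpace ℝ (Fin n)) M]
    [RiemannianBundle (fun x : M ↦ TangentSpace (𝓡 n) x)] {p : M} {ℓ : ℝ} {x₀ : M}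
    {y : EuclideanSpace ℝ (Fin n)} {k : ℝ} (h : SecondOrderBound p ℓ x₀ y 0 k)
    (hℓ : ℓ ≤ dist p ((extChartAt (𝓡 n) x₀).symm y)) : 0 ≤ k := by
  refine le_of_forall_pos_le_add fun ε hε ↦ ?_
  obtain ⟨s, hs, hs0⟩ := (((h ε hε).filter_mono nhdsWithin_le_nhds).and
    (self_mem_nhdsWithin (s := Ioi (0 : ℝ)))).exists
  rw [jetCurve_zero_vec] at hs
  have h1 : 0 ≤ s ^ 2 / 2 * (k + ε) := by linarith
  have h2 : 0 < s ^ 2 / 2 := by have : 0 < s := hs0; positivity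
  exact nonneg_of_mul_nonneg_right h1 h2

variable {n : ℕ} {M : Type*} [MetricSpace M] [ChartedSpace (EuclideanSpace ℝ (Fin n)) M]
  [RiemannianBundle (fun x : M ↦ TangentSpace (𝓡 n) x)]
  [IsManifold (𝓡 n) ∞ M]

theorem exists_orthonormal_frame {x₀ : M} {y T : EuclideanSpace ℝ (Fin n)}
    (hy : y ∈ (extChartAt (𝓡 n) x₀).target) (hT : chartMetric x₀ y T T = 1) (j₀ : Fin n) :
    ∃ e : Fin n → EuclideanSpace ℝ (Fin n),
      (∀ i j, chartMetric x₀ y (e i) (e j) = if i = j then 1 else 0) ∧ e j₀ = T := by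
  obtain ⟨D, hD⟩ := isInvertible_mfderiv_symm hy
  have hD' : ∀ u, D u = mfderiv (𝓡 n) (𝓡 n) (extChartAt (𝓡 n) x₀).symm y u := fun u ↦ by
    rw [← hD]; rfl
  have key := exists_orthonormal_pullback (V := TangentSpace (𝓡 n) ((extChartAt (𝓡 n) x₀).symm y))
    D.toLinearEquiv j₀ (T := T)
  have hI : ∀ u v, chartMetric x₀ y u v =
      inner ℝ (show TangentSpace (𝓡 n) ((extChartAt (𝓡 n) x₀).symm y) from D u) (D v) :=
    fun u v ↦ by
      rw [hD' u, hD' v]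
      exact chartMetric_eq_inner x₀ y u v
  simp only [hI] at hT ⊢
  exact key hT

/-- In dimension zero there is no unit vector. This supplies the index `j₀` of the velocity and n -
1 ≥ 0. -/
theorem IsUnitSpeedGeodesic.pos_dim {L : ℝ} {γ : ℝ → M} (hγ : IsUnitSpeedGeodesic n L γ)
    {t : ℝ} (ht : t ∈ Ioo 0 L) : 0 < n := by
  rcases Nat.eq_zero_or_pos n with rfl | h
  · have h1 := hγ.chartMetric_eq_one ht (mem_extChartAt_source (γ t))
    rw [Subsingleton.elim (deriv (chartCurve 0 (γ t) γ) t) 0] at h1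
    simp at h1
  · exact h

variable [IsContMDiffRiemannianBundle (𝓡 n) ∞ (EuclideanSpace ℝ (Fin n))
      (fun x : M ↦ TangentSpace (𝓡 n) x)] [IsRiemannianManifold (𝓡 n) M]

/-- Enter the chart at `γ t₀`, take the step there, and return to the chart at the end point. The
bound is then a predicate of `t` and `K` alone, as the supremum argument requires. -/
theorem NormalBound.exists_step_self {L t₀ C : ℝ} {γ : ℝ → M} (hγ : IsUnitSpeedGeodesic n L γ)
    (ht₀ : t₀ ∈ Ioo 0 L) {φ φ' : ℝ → ℝ} (hφ : ∀ t, HasDerivAt φ (φ' t) t) (hφ' : Continuous φ')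
    (hC : (n - 1) * φ' t₀ ^ 2 -
      φ t₀ ^ 2 * ricci (γ t₀) (velocity n L γ t₀) (velocity n L γ t₀) < C) (p : M) (j₀ : Fin n)
    (A : ℝ) :
    ∃ δ > 0, ∀ a ∈ Ioo (t₀ - δ) (t₀ + δ), ∀ b ∈ Ioo (t₀ - δ) (t₀ + δ), a ≤ b →
      ∀ K : ℝ, NormalBound p (a - A) γ (φ a) j₀ (γ a) a K →
        NormalBound p (b - A) γ (φ b) j₀ (γ b) b (K + C * (b - a)) := by
  obtain ⟨δ₁, hδ₁, h1⟩ := NormalBound.exists_step hγ ht₀ hφ hφ' hC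
  have hgood : ∀ᶠ t in 𝓝 t₀, t ∈ Ioo 0 L ∧ γ t ∈ (extChartAt (𝓡 n) (γ t₀)).source :=
    (isOpen_Ioo.eventually_mem ht₀).and (eventually_mem_source (hγ.contMDiffAt ht₀).continuousAt
      (mem_extChartAt_source _))
  obtain ⟨δ₂, hδ₂, h2⟩ := Metric.eventually_nhds_iff_ball.1 hgood
  rw [Real.ball_eq_Ioo] at h2
  have e1 := min_le_left δ₁ δ₂
  have e2 := min_le_right δ₁ δ₂
  refine ⟨min δ₁ δ₂, lt_min hδ₁ hδ₂, fun a ha b hb hab K hK ↦ ?_⟩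
  obtain ⟨ha1, ha2⟩ := h2 a ⟨by linarith [ha.1], by linarith [ha.2]⟩
  obtain ⟨hb1, hb2⟩ := h2 b ⟨by linarith [hb.1], by linarith [hb.2]⟩
  have h3 := h1 a ⟨by linarith [ha.1], by linarith [ha.2]⟩ b
    ⟨by linarith [hb.1], by linarith [hb.2]⟩ hab p _ K j₀
    (hK.transition (hγ.contMDiffAt ha1) (mem_extChartAt_source _) ha2)
  rw [show a - A + (b - a) = b - A by ring] at h3
  exact h3.transition (hγ.contMDiffAt hb1) hb2 (mem_extChartAt_source _)

/-- The second variation inequality, summed over a parallel normal frame: along a minimizing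
geodesic, the integral of `(n - 1) φ'² - φ² Ric` is nonnegative if `φ` vanishes at the
end points. -/
theorem IsUnitSpeedGeodesic.le_of_second_variation {L A B : ℝ} {γ : ℝ → M}
    (hγ : IsUnitSpeedGeodesic n L γ) (hA : 0 < A) (hAB : A ≤ B) (hB : B < L)
    (hmin : dist (γ A) (γ B) = B - A) {φ φ' : ℝ → ℝ} (hφ : ∀ t, HasDerivAt φ (φ' t) t)
    (hφ' : Continuous φ') (hφA : φ A = 0) (hφB : φ B = 0) {H h : ℝ → ℝ}
    (hH : ∀ t ∈ Icc A B, HasDerivAt H (h t) t)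
    (hh : ∀ t ∈ Icc A B, (n - 1) * φ' t ^ 2 -
      φ t ^ 2 * ricci (γ t) (velocity n L γ t) (velocity n L γ t) ≤ h t) : H A ≤ H B := by
  have hmem : ∀ t ∈ Icc A B, t ∈ Ioo 0 L := fun t ht ↦ ⟨hA.trans_le ht.1, ht.2.trans_lt hB⟩
  have hA' := hmem A ⟨le_rfl, hAB⟩
  let j₀ : Fin n := ⟨0, hγ.pos_dim hA'⟩
  have hsA : γ A ∈ (extChartAt (𝓡 n) (γ A)).source := mem_extChartAt_source _
  have hsB : γ B ∈ (extChartAt (𝓡 n) (γ B)).source := mem_extChartAt_source _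
  obtain ⟨e, he, hej⟩ := exists_orthonormal_frame (chartCurve_mem_target hsA)
    (hγ.chartMetric_eq_one hA' hsA) j₀
  -- As φ(A) = 0, every parabola is constant at γ(A), at distance 0, so all constants may be 0.
  have h0 : NormalBound (γ A) (A - A) γ (φ A) j₀ (γ A) A 0 := by
    refine ⟨e, 0, he, hej, fun i _ ε hε ↦ Eventually.of_forall fun s ↦ ?_, by simp⟩
    rw [hφA, zero_smul, jetCurve_zero_vec, symm_chartCurve hsA, dist_self]
    simp only [sub_self, Pi.zero_apply, zero_add]
    positivity
  refine le_of_forall_pos_le_add fun ε hε ↦ ?_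
  have h1 := propagate_of_local_rate
    (P := fun t K ↦ NormalBound (γ A) (t - A) γ (φ t) j₀ (γ t) t K)
    (fun t K K' hK hP ↦ hP.mono hK) hAB hH hh
    (fun t ht C hC ↦ NormalBound.exists_step_self hγ (hmem t ht) hφ hφ' hC (γ A) j₀ A) h0
    (ε := ε / (B - A + 1)) (by have := sub_nonneg.2 hAB; positivity)
  obtain ⟨e', k, -, -, hk, hsum⟩ := h1
  -- As φ(B) = 0, the parabolas are constant at γ(B), whose distance from γ(A) is exactly B - A.
  have h2 : 0 ≤ ∑ i ∈ Finset.univ.erase j₀, k i := Finset.sum_nonneg fun i hi ↦ by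
    have h3 := hk i (Finset.ne_of_mem_erase hi)
    rw [hφB, zero_smul] at h3
    exact h3.nonneg (by rw [symm_chartCurve hsB, hmin])
  have h4 : ε / (B - A + 1) * (B - A) ≤ ε := by
    have := sub_nonneg.2 hAB
    rw [div_mul_eq_mul_div, div_le_iff₀ (by positivity)]
    nlinarith
  linarith

end SecondVariation

/-! ### Segments of minimizing geodesics -/

section Distance

variable {n : ℕ} {M : Type*} [MetricSpace M] [ChartedSpace (EuclideanSpace ℝ (Fin n)) M]
  [RiemannianBundle (fun x : M ↦ TangentSpace (𝓡 n) x)] [IsRiemannianManifold (𝓡 n) M]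

theorem IsUnitSpeedGeodesic.dist_le {L s t : ℝ} {γ : ℝ → M}
    (hγ : IsUnitSpeedGeodesic n L γ) (hs : 0 ≤ s) (hst : s ≤ t) (ht : t ≤ L) :
    dist (γ s) (γ t) ≤ t - s := by
  have h := dist_le_integral_of_norm_mfderiv_le (F := fun _ ↦ 1) hst
    ((hγ.smooth.mono (Icc_subset_Icc hs ht)).of_le (by simp)) continuousOn_const
    (fun _ _ ↦ zero_le_one)
    fun r hr ↦ (hγ.norm_mfderiv ⟨hs.trans_lt hr.1, hr.2.trans_le ht⟩).le
  simpa using h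

/-- Each of the three pieces of the geodesic is at least as long as the distance of its ends, and
the lengths add up to `dist p q`; a strict inequality on one piece would contradict the triangle
inequality. -/
theorem IsMinimizingGeodesic.dist_eq {p q : M} {s t : ℝ} {γ : ℝ → M}
    (hγ : IsMinimizingGeodesic n p q γ) (hs : 0 ≤ s) (hst : s ≤ t) (ht : t ≤ dist p q) :
    dist (γ s) (γ t) = t - s := by
  have hg := hγ.isGeodesic
  refine le_antisymm (hg.dist_le hs hst ht) ?_
  have h1 := hg.dist_le le_rfl hs (hst.trans ht)
  have h2 := hg.dist_le (hs.trans hst) ht le_rfl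
  rw [hγ.source] at h1
  rw [hγ.target] at h2
  linarith [dist_triangle4 p (γ s) (γ t) q]

end Distance

end WeightedManifold

/-! ### The sine test function and the quadratic inequality -/

section Calculus

open Real

/-- The total weight ∫ |φφ'| by which the bound `G` on `g` enters; the cosine changes sign at π/2,
and each half contributes 1/2. -/
theorem integral_abs_sin_mul_cos : ∫ x in (0 : ℝ)..π, |sin x * cos x| = 1 := by
  have hi : ∀ a b : ℝ, IntervalIntegrable (fun x ↦ |sin x * cos x|) MeasureTheory.volume a b :=
    fun a b ↦ (by fun_prop : Continuous fun x ↦ |sin x * cos x|).intervalIntegrable a b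
  have hπ := pi_pos
  rw [← intervalIntegral.integral_add_adjacent_intervals (hi 0 (π / 2)) (hi (π / 2) π)]
  have h1 : ∫ x in (0 : ℝ)..(π / 2), |sin x * cos x| = ∫ x in (0 : ℝ)..(π / 2), sin x * cos x := by
    refine intervalIntegral.integral_congr fun x hx ↦ abs_of_nonneg ?_
    rw [uIcc_of_le (by positivity)] at hx
    exact mul_nonneg (sin_nonneg_of_mem_Icc ⟨hx.1, by linarith [hx.2]⟩)
      (cos_nonneg_of_mem_Icc ⟨by linarith [hx.1], hx.2⟩)
  have h2 : ∫ x in (π / 2)..π, |sin x * cos x| = ∫ x in (π / 2)..π, -(sin x * cos x) := by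
    refine intervalIntegral.integral_congr fun x hx ↦ abs_of_nonpos ?_
    rw [uIcc_of_le (by linarith)] at hx
    exact mul_nonpos_of_nonneg_of_nonpos (sin_nonneg_of_mem_Icc ⟨by linarith [hx.1], hx.2⟩)
      (cos_nonpos_of_pi_div_two_le_of_le hx.1 (by linarith [hx.2]))
  rw [h1, h2, intervalIntegral.integral_neg, integral_sin_mul_cos₁, integral_sin_mul_cos₁]
  norm_num

/-- Complete the square as (cL - 2G/c)². -/
theorem le_of_sq_mul_sub_le {c G L : ℝ} (hc : 0 < c)
    (h : c ^ 2 * L ^ 2 - 4 * G * L - π ^ 2 ≤ 0) :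
    L ≤ (1 / c) * (2 * G / c + √(4 * G ^ 2 / c ^ 2 + π ^ 2)) := by
  have h1 : (c * L - 2 * G / c) ^ 2 ≤ 4 * G ^ 2 / c ^ 2 + π ^ 2 := by
    have : (c * L - 2 * G / c) ^ 2 = c ^ 2 * L ^ 2 - 4 * G * L + 4 * G ^ 2 / c ^ 2 := by
      field_simp; ring
    linarith
  have h2 := le_sqrt_of_sq_le h1
  rw [one_div, inv_mul_eq_div, le_div_iff₀ hc]
  linarith

/-- If for `φ = sin (π (t - A) / (B - A))` the index inequality holds for all comparison
functions, a Riccati-type lower bound on the Ricci curvature `r` restricts `B - A`. -/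
theorem sq_mul_sub_le_of_index {A B c G m d : ℝ} (hAB : A < B) (hm : 0 < m) (hd : 0 ≤ d)
    {u w r p q : ℝ → ℝ} (hu : ∀ t ∈ Icc A B, HasDerivAt u (p t) t)
    (hw : ∀ t ∈ Icc A B, HasDerivAt w (q t) t) (hwG : ∀ t ∈ Icc A B, |w t| ≤ G)
    (hr : ∀ t ∈ Icc A B, (m + d) * (c ^ 2 + q t) ≤ r t + p t - 1 / m * (u t * u t))
    (hindex : ∀ φ φ' : ℝ → ℝ, (∀ t, HasDerivAt φ (φ' t) t) → Continuous φ' → φ A = 0 → φ B = 0 →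
      ∀ H h : ℝ → ℝ, (∀ t ∈ Icc A B, HasDerivAt H (h t) t) →
        (∀ t ∈ Icc A B, d * φ' t ^ 2 - φ t ^ 2 * r t ≤ h t) → H A ≤ H B) :
    c ^ 2 * (B - A) ^ 2 - 4 * G * (B - A) - π ^ 2 ≤ 0 := by
  have hL : 0 < B - A := sub_pos.2 hAB
  set κ : ℝ := π / (B - A) with hκ
  have hκ0 : 0 < κ := div_pos pi_pos hL
  have hκL : κ * (B - A) = π := by rw [hκ]; field_simp
  set θ : ℝ → ℝ := fun t ↦ κ * (t - A) with hθ
  have hθd : ∀ t, HasDerivAt θ κ t := fun t ↦ by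
    simpa using ((hasDerivAt_id t).sub_const A).const_mul κ
  have hθA : θ A = 0 := by simp [hθ]
  have hθB : θ B = π := hκL
  -- A primitive of |sin cos|, so that the estimate |w| ≤ G is already integrated in `H`.
  set V : ℝ → ℝ := fun y ↦ ∫ x in (0 : ℝ)..y, |sin x * cos x| with hV
  have hVd : ∀ t, HasDerivAt (fun t ↦ V (θ t)) (|sin (θ t) * cos (θ t)| * κ) t := fun t ↦ by
    have h1 : HasDerivAt V (|sin (θ t) * cos (θ t)|) (θ t) :=
      (by fun_prop : Continuous fun x ↦ |sin x * cos x|).integral_hasStrictDerivAt 0 (θ t)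
        |>.hasDerivAt
    exact h1.comp t (hθd t)
  have hsd : ∀ t, HasDerivAt (fun t ↦ sin (θ t)) (κ * cos (θ t)) t := fun t ↦
    (hθd t).sin.congr_deriv (mul_comm _ _)
  have hcd : ∀ t, HasDerivAt (fun t ↦ cos (θ t)) (-(κ * sin (θ t))) t := fun t ↦
    (hθd t).cos.congr_deriv (by ring)
  -- Integration by parts is encoded in `H`: the terms with sin² u and sin² w vanish at both ends.
  -- The linear term with sin cos is a primitive of κ² cos² - c² sin².
  have key := hindex (fun t ↦ sin (θ t)) (fun t ↦ κ * cos (θ t)) hsd (by fun_prop) (by simp [hθA])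
    (by simp [hθB])
    (fun t ↦ sin (θ t) ^ 2 * u t - (m + d) * (sin (θ t) ^ 2 * w t) +
      (m + d) * (((κ ^ 2 - c ^ 2) / 2 * t + (κ ^ 2 + c ^ 2) / (2 * κ) * (sin (θ t) * cos (θ t))) +
        2 * G * V (θ t)))
    (fun t ↦ (2 * sin (θ t) * (κ * cos (θ t)) * u t + sin (θ t) ^ 2 * p t) -
      (m + d) * (2 * sin (θ t) * (κ * cos (θ t)) * w t + sin (θ t) ^ 2 * q t) +
      (m + d) * (κ ^ 2 * cos (θ t) ^ 2 - c ^ 2 * sin (θ t) ^ 2 +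
        2 * G * (|sin (θ t) * cos (θ t)| * κ))) (fun t ht ↦ by
      have h2 := (hsd t).fun_pow 2
      have h3 := (h2.fun_mul (hu t ht)).fun_sub ((h2.fun_mul (hw t ht)).const_mul (m + d))
      have h4 := (((hasDerivAt_id t).const_mul ((κ ^ 2 - c ^ 2) / 2)).fun_add
        (((hsd t).fun_mul (hcd t)).const_mul ((κ ^ 2 + c ^ 2) / (2 * κ)))).fun_add
        ((hVd t).const_mul (2 * G))
      refine (h3.fun_add (h4.const_mul (m + d))).congr_deriv ?_
      have h5 : cos (θ t) ^ 2 = 1 - sin (θ t) ^ 2 := cos_sq' _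
      have h6 : (κ ^ 2 + c ^ 2) / (2 * κ) * (κ * cos (θ t) * cos (θ t) +
          sin (θ t) * -(κ * sin (θ t))) = (κ ^ 2 + c ^ 2) / 2 * (1 - 2 * sin (θ t) ^ 2) := by
        field_simp
        rw [h5]
        ring
      rw [h6, h5]
      rw [show (2 - 1 : ℕ) = 1 from rfl, pow_one]
      push_cast
      ring) (fun t ht ↦ by
      have h1 := mul_le_mul_of_nonneg_left (hr t ht) (sq_nonneg (sin (θ t)))
      -- This square supplies the extra mφ'² that raises the factor of φ'² from d to m + d and
      -- removes u.
      have h2 : 0 ≤ m * (κ * cos (θ t) + sin (θ t) * u t / m) ^ 2 := by positivity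
      have h3 : m * (κ * cos (θ t) + sin (θ t) * u t / m) ^ 2 = m * (κ * cos (θ t)) ^ 2 +
          2 * sin (θ t) * (κ * cos (θ t)) * u t + sin (θ t) ^ 2 * (1 / m * (u t * u t)) := by
        field_simp; ring
      have h4 : sin (θ t) * cos (θ t) * w t ≤ |sin (θ t) * cos (θ t)| * G :=
        (le_abs_self _).trans (by rw [abs_mul]; gcongr; exact hwG t ht)
      have h5 : 0 ≤ (m + d) * (2 * κ) * (|sin (θ t) * cos (θ t)| * G -
          sin (θ t) * cos (θ t) * w t) := by
        have := sub_nonneg.2 h4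
        positivity
      nlinarith [h1, h2, h3, h5])
  have hVB : V (θ B) = 1 := by rw [hθB]; exact integral_abs_sin_mul_cos
  have hVA : V (θ A) = 0 := by rw [hθA]; simp [hV]
  simp only [hVA, hVB] at key
  simp only [hθA, hθB, sin_zero, sin_pi] at key
  have hmd : 0 < m + d := by positivity
  have h1 : 0 ≤ (m + d) * ((κ ^ 2 - c ^ 2) / 2 * (B - A) + 2 * G) := by nlinarith [key]
  have h2 := nonneg_of_mul_nonneg_right h1 hmd
  -- Multiplying by 2(B - A) and using κ(B - A) = π clears κ.
  have h3 : 0 ≤ ((κ ^ 2 - c ^ 2) / 2 * (B - A) + 2 * G) * (2 * (B - A)) :=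
    mul_nonneg h2 (by positivity)
  nlinarith [h3, hκL, congrArg (· ^ 2) hκL]

end Calculus

/-! ### Compactness of closed balls -/

section HopfRinow

/-- In a complete locally compact geodesic space closed balls are compact. -/
theorem isCompact_closedBall_of_geodesic {X : Type*} [MetricSpace X] [CompleteSpace X]
    [LocallyCompactSpace X] (hgeo : ∀ p q : X, ∀ r ∈ Icc 0 (dist p q), ∃ z, dist p z = r ∧
      dist z q = dist p q - r) (p : X) (R : ℝ) : IsCompact (Metric.closedBall p R) := by
  rcases lt_or_ge R 0 with hR | hR
  · simp [Metric.closedBall_eq_empty.2 hR]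
  have hnear : ∀ {r ε : ℝ}, 0 ≤ r → 0 ≤ ε → ∀ q ∈ Metric.closedBall p (r + ε),
      ∃ z ∈ Metric.closedBall p r, dist q z ≤ ε := by
    intro r ε hr hε q hq
    rw [Metric.mem_closedBall'] at hq
    rcases le_total (dist p q) r with h | h
    · exact ⟨q, Metric.mem_closedBall'.2 h, by simpa⟩
    · obtain ⟨z, hz1, hz2⟩ := hgeo p q r ⟨hr, h⟩
      exact ⟨z, Metric.mem_closedBall'.2 hz1.le, by rw [dist_comm]; linarith⟩
  set s : Set ℝ := {r | r ∈ Icc 0 R ∧ IsCompact (Metric.closedBall p r)} with hs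
  have h0 : (0 : ℝ) ∈ s := ⟨⟨le_rfl, hR⟩, by simp⟩
  have hbdd : BddAbove s := ⟨R, fun r hr ↦ hr.1.2⟩
  have hσ : sSup s ∈ Icc 0 R := ⟨le_csSup hbdd h0, csSup_le ⟨0, h0⟩ fun r hr ↦ hr.1.2⟩
  have hlt : ∀ r < sSup s, IsCompact (Metric.closedBall p r) := fun r hr ↦ by
    obtain ⟨a, ha, hra⟩ := exists_lt_of_lt_csSup ⟨0, h0⟩ hr
    exact ha.2.of_isClosed_subset Metric.isClosed_closedBall
      (Metric.closedBall_subset_closedBall hra.le)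
  have hσc : IsCompact (Metric.closedBall p (sSup s)) := by
    rcases hσ.1.eq_or_lt with h | h
    · rw [← h]; simp
    -- By completeness, total boundedness suffices. An ε/2-net of a slightly smaller ball, compact
    -- by `hlt`, is an ε-net here, since geodesics reach the smaller ball within ε/2.
    refine TotallyBounded.isCompact_of_isClosed (Metric.totallyBounded_iff.2 fun ε hε ↦ ?_)
      Metric.isClosed_closedBall
    set r := max (sSup s - ε / 2) 0 with hr
    have hrσ : r < sSup s := max_lt (by linarith) h
    obtain ⟨t, ht, hcov⟩ := Metric.totallyBounded_iff.1 (hlt r hrσ).totallyBounded (ε / 2)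
      (by positivity)
    refine ⟨t, ht, fun q hq ↦ ?_⟩
    obtain ⟨z, hz, hqz⟩ := hnear (r := r) (ε := ε / 2) (le_max_right _ _) (by positivity) q
      (Metric.closedBall_subset_closedBall (by linarith [le_max_left (sSup s - ε / 2) 0]) hq)
    obtain ⟨y, hy, hzy⟩ := mem_iUnion₂.1 (hcov hz)
    refine mem_iUnion₂.2 ⟨y, hy, ?_⟩
    rw [Metric.mem_ball] at hzy ⊢
    linarith [dist_triangle q z y]
  rcases hσ.2.eq_or_lt with h | h
  · rwa [h] at hσc
  exfalso
  -- Local compactness gives a compact thickening, and it contains a ball beyond the supremum.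
  obtain ⟨δ, hδ, hcomp⟩ := hσc.exists_isCompact_cthickening
  have hm : sSup s < min R (sSup s + δ) := lt_min h (by linarith)
  refine hm.not_ge (le_csSup hbdd ⟨⟨hσ.1.trans hm.le, min_le_left _ _⟩,
    hcomp.of_isClosed_subset Metric.isClosed_closedBall fun q hq ↦ ?_⟩)
  obtain ⟨z, hz, hqz⟩ := hnear hσ.1 hδ.le q
    (Metric.closedBall_subset_closedBall (min_le_right _ _) hq)
  exact Metric.mem_cthickening_of_dist_le q z δ _ hz hqz

end HopfRinow

/-! ### The distance bound and the theorem -/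

namespace WeightedManifold

attribute [local instance 5000] chartedSpaceSelf

variable {n : ℕ} {M : Type*} [MetricSpace M] [ChartedSpace (EuclideanSpace ℝ (Fin n)) M]
  [RiemannianBundle (fun x : M ↦ TangentSpace (𝓡 n) x)] [IsManifold (𝓡 n) ∞ M]
  [IsContMDiffRiemannianBundle (𝓡 n) ∞ (EuclideanSpace ℝ (Fin n))
      (fun x : M ↦ TangentSpace (𝓡 n) x)] [IsRiemannianManifold (𝓡 n) M]

theorem IsMinimizingGeodesic.dist_le_of_bakryEmeryRicci {p q : M} {γ : ℝ → M}
    (hγ : IsMinimizingGeodesic n p q γ) {f g : M → ℝ} (hf : ContMDiff (𝓡 n) 𝓘(ℝ, ℝ) ∞ f)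
    (hg : ContMDiff (𝓡 n) 𝓘(ℝ, ℝ) 1 g) {m c G : ℝ} (hm : 0 < m) (hc : 0 < c) (hG : 0 ≤ G)
    (hgG : ∀ x, |g x| ≤ G)
    (hRic : ∀ t ∈ Icc 0 (dist p q),
      (m + n - 1) * (c ^ 2 + derivWithin (fun s ↦ g (γ s)) (Icc 0 (dist p q)) t) ≤
        bakryEmeryRicci m f (γ t) (velocity n (dist p q) γ t) (velocity n (dist p q) γ t)) :
    dist p q ≤ (1 / c) * (2 * G / c + √(4 * G ^ 2 / c ^ 2 + Real.pi ^ 2)) := by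
  set L := dist p q with hL
  have hgeo := hγ.isGeodesic
  -- Work on a centred subinterval of length l < L. It stays away from the end points, so all
  -- derivatives are two-sided, and l is arbitrarily close to L.
  refine le_of_forall_lt_imp_le_of_dense fun l hl ↦ ?_
  rcases le_or_gt l 0 with hl0 | hl0
  · exact hl0.trans (by positivity)
  set A := (L - l) / 2 with hA
  set B := (L + l) / 2 with hB
  have hBA : B - A = l := by rw [hA, hB]; ring
  have hA0 : 0 < A := by rw [hA]; linarith
  have hAB : A < B := by linarith
  have hBL : B < L := by rw [hB]; linarith
  have hmem : ∀ t ∈ Icc A B, t ∈ Ioo 0 L := fun t ht ↦ ⟨hA0.trans_le ht.1, ht.2.trans_lt hBL⟩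
  have hn : (1 : ℝ) ≤ n := by
    exact_mod_cast hgeo.pos_dim (hmem A ⟨le_rfl, hAB.le⟩)
  refine le_of_sq_mul_sub_le hc ?_
  rw [← hBA]
  refine sq_mul_sub_le_of_index (d := n - 1) hAB hm (by linarith)
    (u := deriv (f ∘ γ)) (w := fun s ↦ g (γ s))
    (r := fun t ↦ ricci (γ t) (velocity n L γ t) (velocity n L γ t))
    (fun t ht ↦ hgeo.hasDerivAt_deriv_comp (hmem t ht) hf)
    (q := derivWithin (fun s ↦ g (γ s)) (Icc 0 L)) (fun t ht ↦ ?_) (fun t _ ↦ hgG _)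
    (fun t ht ↦ ?_) fun φ φ' hφ hφ' h1 h2 H h hH hh ↦
      hgeo.le_of_second_variation hA0 hAB.le hBL
        (hγ.dist_eq hA0.le hAB.le hBL.le) hφ hφ' h1 h2 hH hh
  · have ht := hmem t ht
    rw [derivWithin_of_mem_nhds (Icc_mem_nhds ht.1 ht.2)]
    have h1 : ContMDiffAt 𝓘(ℝ, ℝ) 𝓘(ℝ, ℝ) 1 (fun s ↦ g (γ s)) t :=
      (hg (γ t)).comp t ((hgeo.contMDiffAt ht).of_le (by simp))
    exact (contMDiffAt_iff_contDiffAt.1 h1).differentiableAt (by simp) |>.hasDerivAt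
  · have ht := hmem t ht
    have h1 := hRic t ⟨ht.1.le, ht.2.le⟩
    have h2 : differential f (γ t) (velocity n L γ t) = deriv (f ∘ γ) t := by
      rw [velocity_eq ht, differential_mfderiv (hgeo.contMDiffAt ht) hf]
    rw [bakryEmeryRicci, h2] at h1
    rw [← add_sub_assoc]
    exact h1

end WeightedManifold

end

theorem mainTheorem8 {n : ℕ} {M : Type*} [MetricSpace M]
    [ChartedSpace (EuclideanSpace ℝ (Fin n)) M] [IsManifold (𝓡 n) ∞ M]
    [RiemannianBundle (fun x : M ↦ TangentSpace (𝓡 n) x)]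
    [IsContMDiffRiemannianBundle (𝓡 n) ∞ (EuclideanSpace ℝ (Fin n))
      (fun x : M ↦ TangentSpace (𝓡 n) x)]
    [IsRiemannianManifold (𝓡 n) M] [CompleteSpace M]
    (f : M → ℝ) (hf : ContMDiff (𝓡 n) 𝓘(ℝ, ℝ) ∞ f)
    (m : ℝ) (hm : 0 < m) (c G : ℝ) (hc : 0 < c) (hG : 0 ≤ G)
    (γ : M → M → ℝ → M)
    (hγ : ∀ p q : M, p ≠ q → WeightedManifold.IsMinimizingGeodesic n p q (γ p q))
    (hRic : ∀ p q : M, p ≠ q → ∃ g : M → ℝ,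
      ContMDiff (𝓡 n) 𝓘(ℝ, ℝ) 1 g ∧ (∀ x, |g x| ≤ G) ∧
      ∀ t ∈ Icc 0 (dist p q),
        (m + n - 1) * (c ^ 2 + derivWithin (fun s ↦ g (γ p q s)) (Icc 0 (dist p q)) t) ≤
          WeightedManifold.bakryEmeryRicci m f (γ p q t)
            (WeightedManifold.velocity n (dist p q) (γ p q) t)
            (WeightedManifold.velocity n (dist p q) (γ p q) t)) :
    CompactSpace M ∧
      Metric.diam (univ : Set M) ≤
        (1 / c) * (2 * G / c + Real.sqrt (4 * G ^ 2 / c ^ 2 + Real.pi ^ 2)) := by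
  have hdist : ∀ p q : M,
      dist p q ≤ (1 / c) * (2 * G / c + Real.sqrt (4 * G ^ 2 / c ^ 2 + Real.pi ^ 2)) := by
    intro p q
    rcases eq_or_ne p q with rfl | hpq
    · rw [dist_self]
      positivity
    · obtain ⟨g, hg, hgG, hle⟩ := hRic p q hpq
      exact (hγ p q hpq).dist_le_of_bakryEmeryRicci hf hg hm hc hG hgG hle
  have : LocallyCompactSpace M := ChartedSpace.locallyCompactSpace (EuclideanSpace ℝ (Fin n)) M
  have hball := isCompact_closedBall_of_geodesic (X := M) fun p q r hr ↦ by
    rcases eq_or_ne p q with rfl | hpq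
    · rw [dist_self] at hr
      exact ⟨p, by rw [dist_self]; exact le_antisymm hr.1 hr.2,
        by rw [dist_self]; linarith [hr.1, hr.2]⟩
    · have h := hγ p q hpq
      have h1 := h.dist_eq le_rfl hr.1 hr.2
      have h2 := h.dist_eq hr.1 hr.2 le_rfl
      rw [h.source] at h1
      rw [h.target] at h2
      exact ⟨γ p q r, by rw [h1, sub_zero], h2⟩
  refine ⟨⟨?_⟩, Metric.diam_le_of_forall_dist_le (by positivity) fun p _ q _ ↦ hdist p q⟩
  rcases isEmpty_or_nonempty M with hM | ⟨⟨p⟩⟩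
  · rw [univ_eq_empty_iff.2 hM]
    exact isCompact_empty
  -- The distance bound puts all of `M` into one closed ball.
  · exact (hball p _).of_isClosed_subset isClosed_univ fun q _ ↦
      Metric.mem_closedBall.2 (hdist q p)
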